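/- Let $M$ be a non-empty smooth manifold of positive dimension with a smooth action of the quaternion algebra $\mathbb H$ on $TM$ such that every $L\in\mathbb H$ with $L^2=-1$ acts as an integrable almost complex structure (a hypercomplex manifold), and let $g$ be a Riemannian metric on $M$ invariant under the unit quaternions. Let $I,J,K$ be the standard basis of imaginary quaternions ($IJ=-JI=K$), put $\omega_L(x,y)=g(x,Ly)$ and $\Omega=\frac12(\omega_J+\sqrt{-1}\,\omega_K)$, a form of type $(2,0)$ on the complex manifold $(M,I)$, and assume that $M$ is an HKT-manifold, that is, $\partial\Omega=0$, where $\partial,\bar\partial$ are the Dolbeault differentials of $(M,I)$. On the space $\Lambda^{*,0}(M,I)=\bigoplus_p\Lambda^{p,0}(M,I)$ of smooth complex forms consider the following $\mathbb C$-linear operators: $L_\Omega(\eta)=\Omega\wedge\eta$; its (pointwise) Hermitian adjoint $\Lambda_\Omega$ with respect to the Hermitian product on forms induced by $g$; $H_\Omega=[L_\Omega,\Lambda_\Omega]$; the Dolbeault differential $\partial$; and $\partial_J=J^{-1}\circ\bar\partial\circ J$, where $J$ acts on forms multiplicatively, $(J\eta)(v_1,\dots,v_k)=\eta(Jv_1,\dots,Jv_k)$,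 and interchanges $\Lambda^{p,q}(M,I)$ and $\Lambda^{q,p}(M,I)$. Let $\mathfrak g\subset\operatorname{End}_{\mathbb C}(\Lambda^{*,0}(M,I))$ be the complex Lie superalgebra generated under the supercommutator by the even operators $L_\Omega,\Lambda_\Omega,H_\Omega$ and the odd operators $\partial,\partial_J$. Then these operators are well defined on $\Lambda^{*,0}(M,I)$, and $\mathfrak g$ is isomorphic, as a Lie superalgebra, to the Kähler-de Rham superalgebra, i.e. to the complex Lie superalgebra with even generators $L,\Lambda,H$, odd generators $d,d^c$ and the defining relations $$[L,\Lambda]=H,\quad [H,L]=2L,\quad [H,\Lambda]=-2\Lambda,\qquad [H,d]=d,\quad [H,d^c]=d^c,\quad [L,d]=[L,d^c]=0,$$ $$[\Lambda,[\Lambda,d]]=[\Lambda,[\Lambda,d^c]]=0,\qquad \{d,d\}=\{d^c,d^c\}=\{d,d^c\}=0 .$$ -/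

import Mathlib

open scoped Manifold ContDiff Quaternion

noncomputable section

namespace HKT

universe u v

/-! ## Lie superalgebras -/

/-- A Lie superalgebra `Even ⊕ Odd` over `k`, given by its homogeneous parts and the
supercommutators of even-even, even-odd and odd-odd pairs; the supercommutator of an odd `x` with
an even `a` is `-[a, x]`.  The four Jacobi identities are the graded Jacobi identity
`[a, [b, c]] = [[a, b], c] + (-1)^{ab} [b, [a, c]]` for the possible parities. -/
structure LieSuperalgebra (k : Type*) [CommRing k] where
  Even : Type u
  Odd : Type u
  [addCommGroupEven : AddCommGroup Even]
  [addCommGroupOdd : AddCommGroup Odd]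
  [moduleEven : Module k Even]
  [moduleOdd : Module k Odd]
  ee : Even →ₗ[k] Even →ₗ[k] Even
  eo : Even →ₗ[k] Odd →ₗ[k] Odd
  oo : Odd →ₗ[k] Odd →ₗ[k] Even
  ee_skew : ∀ a b, ee a b = -ee b a
  oo_symm : ∀ x y, oo x y = oo y x
  jacobi_eee : ∀ a b c, ee a (ee b c) = ee (ee a b) c + ee b (ee a c)
  jacobi_eeo : ∀ a b x, eo a (eo b x) = eo (ee a b) x + eo b (eo a x)
  jacobi_eoo : ∀ a x y, ee a (oo x y) = oo (eo a x) y + oo x (eo a y)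
  jacobi_ooo : ∀ x y z, -eo (oo y z) x = eo (oo x y) z + eo (oo x z) y

namespace LieSuperalgebra

attribute [instance] addCommGroupEven addCommGroupOdd moduleEven moduleOdd

/-- An isomorphism of Lie superalgebras: an even linear bijection preserving supercommutators. -/
structure Iso {k : Type*} [CommRing k] (A : LieSuperalgebra.{u} k) (B : LieSuperalgebra.{v} k) where
  even : A.Even ≃ₗ[k] B.Even
  odd : A.Odd ≃ₗ[k] B.Odd
  map_ee : ∀ a b, even (A.ee a b) = B.ee (even a) (even b)
  map_eo : ∀ a x, odd (A.eo a x) = B.eo (even a) (odd x)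
  map_oo : ∀ x y, even (A.oo x y) = B.oo (odd x) (odd y)

/-! ### The Lie superalgebra generated by even and odd operators -/

section Generated

variable {k : Type*} [CommRing k] {B : Type*} [Ring B] [Algebra k B]

/-- `S₀ ⊕ S₁` (`S₀` consisting of even, `S₁` of odd elements) is closed under the supercommutator
`ab - (-1)^{ab} ba`. -/
structure IsSuperClosed (S₀ S₁ : Submodule k B) : Prop where
  ee : ∀ a ∈ S₀, ∀ b ∈ S₀, a * b - b * a ∈ S₀
  eo : ∀ a ∈ S₀, ∀ x ∈ S₁, a * x - x * a ∈ S₁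
  oo : ∀ x ∈ S₁, ∀ y ∈ S₁, x * y + y * x ∈ S₀

variable (k) in
/-- Even part of the smallest supercommutator-closed pair containing the even generators `G₀` and
the odd generators `G₁`. -/
def genEven (G₀ G₁ : Set B) : Submodule k B :=
  sInf {S₀ | ∃ S₁ : Submodule k B, IsSuperClosed S₀ S₁ ∧ G₀ ⊆ S₀ ∧ G₁ ⊆ S₁}

variable (k) in
/-- Odd part of the smallest supercommutator-closed pair containing the even generators `G₀` and
the odd generators `G₁`. -/
def genOdd (G₀ G₁ : Set B) : Submodule k B :=
  sInf {S₁ | ∃ S₀ : Submodule k B, IsSuperClosed S₀ S₁ ∧ G₀ ⊆ S₀ ∧ G₁ ⊆ S₁}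

theorem isSuperClosed_gen (G₀ G₁ : Set B) :
    IsSuperClosed (genEven k G₀ G₁) (genOdd k G₀ G₁) := by
  refine ⟨fun a ha b hb => ?_, fun a ha x hx => ?_, fun x hx y hy => ?_⟩
  · simp only [genEven, Submodule.mem_sInf, Set.mem_ofPred_eq] at *
    rintro S₀ ⟨S₁, h, h₀, h₁⟩
    exact h.ee a (ha _ ⟨S₁, h, h₀, h₁⟩) b (hb _ ⟨S₁, h, h₀, h₁⟩)
  · simp only [genEven, genOdd, Submodule.mem_sInf, Set.mem_ofPred_eq] at *
    rintro S₁ ⟨S₀, h, h₀, h₁⟩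
    exact h.eo a (ha _ ⟨S₁, h, h₀, h₁⟩) x (hx _ ⟨S₀, h, h₀, h₁⟩)
  · simp only [genEven, genOdd, Submodule.mem_sInf, Set.mem_ofPred_eq] at *
    rintro S₀ ⟨S₁, h, h₀, h₁⟩
    exact h.oo x (hx _ ⟨S₀, h, h₀, h₁⟩) y (hy _ ⟨S₀, h, h₀, h₁⟩)

/-- A supercommutator-closed pair of subspaces of an associative algebra, as a Lie superalgebra. -/
def ofClosed (S₀ S₁ : Submodule k B) (h : IsSuperClosed S₀ S₁) : LieSuperalgebra k where
  Even := S₀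
  Odd := S₁
  ee := LinearMap.mk₂ k (fun a b => ⟨a * b - b * a, h.ee a a.2 b b.2⟩)
    (fun _ _ _ => by ext; simp; noncomm_ring) (fun _ _ _ => by ext; simp [smul_sub])
    (fun _ _ _ => by ext; simp; noncomm_ring) (fun _ _ _ => by ext; simp [smul_sub])
  eo := LinearMap.mk₂ k (fun a x => ⟨a * x - x * a, h.eo a a.2 x x.2⟩)
    (fun _ _ _ => by ext; simp; noncomm_ring) (fun _ _ _ => by ext; simp [smul_sub])
    (fun _ _ _ => by ext; simp; noncomm_ring) (fun _ _ _ => by ext; simp [smul_sub])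
  oo := LinearMap.mk₂ k (fun x y => ⟨x * y + y * x, h.oo x x.2 y y.2⟩)
    (fun _ _ _ => by ext; simp; noncomm_ring) (fun _ _ _ => by ext; simp)
    (fun _ _ _ => by ext; simp; noncomm_ring) (fun _ _ _ => by ext; simp)
  ee_skew a b := by ext; simp
  oo_symm x y := by ext; simp [add_comm]
  jacobi_eee a b c := by ext; simp; noncomm_ring
  jacobi_eeo a b x := by ext; simp; noncomm_ring
  jacobi_eoo a x y := by ext; simp; noncomm_ring
  jacobi_ooo x y z := by ext; simp; noncomm_ring

variable (k) in
/-- The Lie superalgebra generated by the even elements `G₀` and the odd elements `G₁` of an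
associative superalgebra. -/
def generated (G₀ G₁ : Set B) : LieSuperalgebra k :=
  ofClosed (genEven k G₀ G₁) (genOdd k G₀ G₁) (isSuperClosed_gen G₀ G₁)

end Generated

/-! ### Lie superalgebras presented by generators and relations -/

section Presented

variable {k : Type*} [CommRing k] {X : Type*}

/-- The parity of a formal iterated bracket of generators. -/
def parity (par : X → ZMod 2) : FreeMagma X → ZMod 2
  | .of x => par x
  | .mul a b => parity par a + parity par b

variable (k) in
/-- A formal iterated bracket, as an element of the free non-associative algebra. -/
def mono (m : FreeMagma X) : FreeNonUnitalNonAssocAlgebra k X := MonoidAlgebra.single m 1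

variable (k) in
/-- The Koszul sign `(-1)^{ij}`. -/
def koszul (i j : ZMod 2) : k := if i = 1 ∧ j = 1 then -1 else 1

/-- The relators: graded anticommutativity and the graded Jacobi identity for all iterated
brackets of generators, and the given relators `rels`. -/
inductive Relator (par : X → ZMod 2) (rels : Set (FreeNonUnitalNonAssocAlgebra k X)) :
    FreeNonUnitalNonAssocAlgebra k X → Prop
  | skew (a b : FreeMagma X) : Relator par rels
      (mono k a * mono k b + koszul k (parity par a) (parity par b) • (mono k b * mono k a))
  | jacobi (a b c : FreeMagma X) : Relator par rels
      (mono k a * (mono k b * mono k c) - (mono k a * mono k b) * mono k c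
        - koszul k (parity par a) (parity par b) • (mono k b * (mono k a * mono k c)))
  | rel {r} (h : r ∈ rels) : Relator par rels r

/-- The two-sided ideal generated by the relators. -/
def relIdeal (par : X → ZMod 2) (rels : Set (FreeNonUnitalNonAssocAlgebra k X)) :
    Submodule k (FreeNonUnitalNonAssocAlgebra k X) :=
  sInf {N | (∀ r, Relator par rels r → r ∈ N) ∧ ∀ n ∈ N, ∀ u, u * n ∈ N ∧ n * u ∈ N}

variable (par : X → ZMod 2) (rels : Set (FreeNonUnitalNonAssocAlgebra k X))

theorem relIdeal_of_relator {r : FreeNonUnitalNonAssocAlgebra k X} (h : Relator par rels r) :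
    r ∈ relIdeal par rels :=
  Submodule.mem_sInf.2 fun _ hN => hN.1 r h

theorem relIdeal_mul {n : FreeNonUnitalNonAssocAlgebra k X} (hn : n ∈ relIdeal par rels)
    (u : FreeNonUnitalNonAssocAlgebra k X) :
    u * n ∈ relIdeal par rels ∧ n * u ∈ relIdeal par rels :=
  ⟨Submodule.mem_sInf.2 fun N hN => (hN.2 n (Submodule.mem_sInf.1 hn N hN) u).1,
    Submodule.mem_sInf.2 fun N hN => (hN.2 n (Submodule.mem_sInf.1 hn N hN) u).2⟩

/-- The bracket on the quotient of the free non-associative algebra by the relators. -/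
def quotBracket :
    (FreeNonUnitalNonAssocAlgebra k X ⧸ relIdeal par rels) →ₗ[k]
      (FreeNonUnitalNonAssocAlgebra k X ⧸ relIdeal par rels) →ₗ[k]
        (FreeNonUnitalNonAssocAlgebra k X ⧸ relIdeal par rels) :=
  (relIdeal par rels).liftQ
    (((relIdeal par rels).liftQ
      (((LinearMap.mul k (FreeNonUnitalNonAssocAlgebra k X)).compr₂ (relIdeal par rels).mkQ).flip)
      (fun n hn => by
        refine LinearMap.ext fun u => ?_
        simpa using (relIdeal_mul par rels hn u).1)).flip)
    (fun n hn => by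
      refine LinearMap.ext fun q => ?_
      obtain ⟨u, rfl⟩ := Submodule.Quotient.mk_surjective _ q
      exact (Submodule.Quotient.mk_eq_zero _).2 (relIdeal_mul par rels hn u).2)

@[simp]
theorem quotBracket_mk (u v : FreeNonUnitalNonAssocAlgebra k X) :
    quotBracket par rels (Submodule.Quotient.mk u) (Submodule.Quotient.mk v) =
      Submodule.Quotient.mk (u * v) := rfl

/-- The homogeneous part of parity `i` of the quotient, spanned by the iterated brackets of
parity `i`. -/
def quotPart (i : ZMod 2) : Submodule k (FreeNonUnitalNonAssocAlgebra k X ⧸ relIdeal par rels) :=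
  Submodule.span k {q | ∃ m : FreeMagma X, parity par m = i ∧ q = Submodule.Quotient.mk (mono k m)}

theorem mono_mul (a b : FreeMagma X) : mono k a * mono k b = mono k (a * b) := by
  simp [mono, MonoidAlgebra.single_mul_single]

theorem quotBracket_mem {i j : ZMod 2} {u v : FreeNonUnitalNonAssocAlgebra k X ⧸ relIdeal par rels}
    (hu : u ∈ quotPart par rels i) (hv : v ∈ quotPart par rels j) :
    quotBracket par rels u v ∈ quotPart par rels (i + j) := by
  refine Submodule.span_induction₂ (p := fun u v _ _ => quotBracket par rels u v ∈ _)
    ?_ ?_ ?_ ?_ ?_ ?_ ?_ hu hv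
  · rintro _ _ ⟨a, rfl, rfl⟩ ⟨b, rfl, rfl⟩
    refine Submodule.subset_span ⟨a * b, rfl, ?_⟩
    rw [quotBracket_mk, mono_mul]
  · intros; simp
  · intros; simp
  · intro x y z _ _ _ h h'; simpa using add_mem h h'
  · intro x y z _ _ _ h h'; simpa using add_mem h h'
  · intro r x y _ _ h; simpa using Submodule.smul_mem _ r h
  · intro r x y _ _ h; simpa using Submodule.smul_mem _ r h

theorem quotBracket_skew {i j : ZMod 2}
    {u v : FreeNonUnitalNonAssocAlgebra k X ⧸ relIdeal par rels}
    (hu : u ∈ quotPart par rels i) (hv : v ∈ quotPart par rels j) :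
    quotBracket par rels u v = -(koszul k i j • quotBracket par rels v u) := by
  refine Submodule.span_induction₂
    (p := fun u v _ _ => quotBracket par rels u v = -(koszul k i j • quotBracket par rels v u))
    ?_ ?_ ?_ ?_ ?_ ?_ ?_ hu hv
  · rintro _ _ ⟨a, rfl, rfl⟩ ⟨b, rfl, rfl⟩
    rw [eq_neg_iff_add_eq_zero, quotBracket_mk, quotBracket_mk, ← Submodule.Quotient.mk_smul,
      ← Submodule.Quotient.mk_add, Submodule.Quotient.mk_eq_zero]
    exact relIdeal_of_relator par rels (.skew a b)
  · intros; simp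
  · intros; simp
  · intro x y z _ _ _ h h'; simp only [map_add, LinearMap.add_apply, h, h', smul_add]; abel
  · intro x y z _ _ _ h h'; simp only [map_add, LinearMap.add_apply, h, h', smul_add]; abel
  · intro r x y _ _ h; simp only [map_smul, LinearMap.smul_apply, h, smul_neg, smul_comm r]
  · intro r x y _ _ h; simp only [map_smul, LinearMap.smul_apply, h, smul_neg, smul_comm r]

theorem quotBracket_jacobi {i j l : ZMod 2}
    {u v w : FreeNonUnitalNonAssocAlgebra k X ⧸ relIdeal par rels}
    (hu : u ∈ quotPart par rels i) (hv : v ∈ quotPart par rels j) (hw : w ∈ quotPart par rels l) :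
    quotBracket par rels u (quotBracket par rels v w) =
      quotBracket par rels (quotBracket par rels u v) w +
        koszul k i j • quotBracket par rels v (quotBracket par rels u w) := by
  refine Submodule.span_induction (p := fun w _ =>
    quotBracket par rels u (quotBracket par rels v w) =
      quotBracket par rels (quotBracket par rels u v) w +
        koszul k i j • quotBracket par rels v (quotBracket par rels u w)) ?_ ?_ ?_ ?_ hw
  · rintro _ ⟨c, -, rfl⟩
    refine Submodule.span_induction₂ (p := fun u v _ _ =>
      quotBracket par rels u (quotBracket par rels v (Submodule.Quotient.mk (mono k c))) =
        quotBracket par rels (quotBracket par rels u v) (Submodule.Quotient.mk (mono k c)) +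
          koszul k i j •
            quotBracket par rels v (quotBracket par rels u (Submodule.Quotient.mk (mono k c))))
      ?_ ?_ ?_ ?_ ?_ ?_ ?_ hu hv
    · rintro _ _ ⟨a, rfl, rfl⟩ ⟨b, rfl, rfl⟩
      rw [← sub_eq_zero, ← sub_sub]
      simp only [quotBracket_mk]
      rw [← Submodule.Quotient.mk_smul, ← Submodule.Quotient.mk_sub, ← Submodule.Quotient.mk_sub,
        Submodule.Quotient.mk_eq_zero]
      exact relIdeal_of_relator par rels (.jacobi a b c)
    · intros; simp
    · intros; simp
    · intro x y z _ _ _ h h'; simp only [map_add, LinearMap.add_apply, h, h', smul_add]; abel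
    · intro x y z _ _ _ h h'; simp only [map_add, LinearMap.add_apply, h, h', smul_add]; abel
    · intro r x y _ _ h; simp only [map_smul, LinearMap.smul_apply, h, smul_add, smul_comm r]
    · intro r x y _ _ h; simp only [map_smul, LinearMap.smul_apply, h, smul_add, smul_comm r]
  · simp
  · intro x y _ _ h h'; simp only [map_add, h, h', smul_add]; abel
  · intro r x _ h; simp only [map_smul, h, smul_add, smul_comm r]

/-- The bracket of the parts of parities `i` and `j`, with values in the part of parity `l`. -/
def partBracket (i j l : ZMod 2) (h : i + j = l) :
    quotPart par rels i →ₗ[k] quotPart par rels j →ₗ[k] quotPart par rels l :=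
  LinearMap.mk₂ k (fun u v => ⟨quotBracket par rels u v, h ▸ quotBracket_mem par rels u.2 v.2⟩)
    (fun _ _ _ => by ext; simp) (fun _ _ _ => by ext; simp)
    (fun _ _ _ => by ext; simp) (fun _ _ _ => by ext; simp)

@[simp]
theorem coe_partBracket (i j l : ZMod 2) (h : i + j = l) (u : quotPart par rels i)
    (v : quotPart par rels j) :
    (partBracket par rels i j l h u v : FreeNonUnitalNonAssocAlgebra k X ⧸ relIdeal par rels) =
      quotBracket par rels u v := rfl

/-- The Lie superalgebra with generators `x : X` of parity `par x` and with the (parity-homogeneous)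
relators `rels`. -/
def presented : LieSuperalgebra k where
  Even := quotPart par rels 0
  Odd := quotPart par rels 1
  ee := partBracket par rels 0 0 0 rfl
  eo := partBracket par rels 0 1 1 rfl
  oo := partBracket par rels 1 1 0 rfl
  ee_skew a b := by
    ext; simpa [koszul] using quotBracket_skew par rels a.2 b.2
  oo_symm x y := by
    ext; simpa [koszul] using quotBracket_skew par rels x.2 y.2
  jacobi_eee a b c := by
    ext; simpa [koszul] using quotBracket_jacobi par rels a.2 b.2 c.2
  jacobi_eeo a b x := by
    ext; simpa [koszul] using quotBracket_jacobi par rels a.2 b.2 x.2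
  jacobi_eoo a x y := by
    ext; simpa [koszul] using quotBracket_jacobi par rels a.2 x.2 y.2
  jacobi_ooo x y z := by
    ext
    have h := quotBracket_jacobi par rels x.2 y.2 z.2
    have h₁ := quotBracket_skew par rels x.2 (quotBracket_mem par rels y.2 z.2)
    have h₂ := quotBracket_skew par rels y.2 (quotBracket_mem par rels x.2 z.2)
    simp only [koszul, show (1 : ZMod 2) + 1 = 0 from rfl, zero_ne_one, and_false, and_self,
      if_true, if_false, one_smul, neg_smul] at h h₁ h₂
    simp only [Submodule.coe_neg, Submodule.coe_add, coe_partBracket]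
    rw [h₁, h₂, neg_neg] at h
    exact h

end Presented

end LieSuperalgebra

/-! ### The Kähler-de Rham superalgebra -/

/-- The generators of the Kähler-de Rham superalgebra: an `sl(2)`-triple `L`, `Λ`, `H` (even)
and `d`, `d^c` (odd). -/
inductive KdRGenerator
  | L | Lam | H | d | dc

namespace KdRGenerator

def parity : KdRGenerator → ZMod 2
  | L | Lam | H => 0
  | d | dc => 1

/-- The generator `x` as an element of the free non-associative algebra. -/
def gen (x : KdRGenerator) : FreeNonUnitalNonAssocAlgebra ℂ KdRGenerator :=
  FreeNonUnitalNonAssocAlgebra.of ℂ x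

/-- The defining relators: `⟨L, Λ, H⟩` is a standard `sl(2)`-triple; `d` and `d^c` are highest
weight vectors of weight `1` generating weight `1` (that is, two-dimensional) representations of it;
and `{d, d} = {d^c, d^c} = {d, d^c} = 0`. -/
def relators : Set (FreeNonUnitalNonAssocAlgebra ℂ KdRGenerator) :=
  {gen L * gen Lam - gen H,
   gen H * gen L - (2 : ℂ) • gen L,
   gen H * gen Lam + (2 : ℂ) • gen Lam,
   gen H * gen d - gen d,
   gen H * gen dc - gen dc,
   gen L * gen d,
   gen L * gen dc,
   gen Lam * (gen Lam * gen d),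
   gen Lam * (gen Lam * gen dc),
   gen d * gen d,
   gen dc * gen dc,
   gen d * gen dc}

end KdRGenerator

/-- The Kähler-de Rham superalgebra (over `ℂ`). -/
def kahlerDeRham : LieSuperalgebra ℂ :=
  LieSuperalgebra.presented KdRGenerator.parity KdRGenerator.relators

/-! ## Exterior algebra on a real vector space -/

section Pointwise

variable {V : Type*} [AddCommGroup V] [Module ℝ V] [TopologicalSpace V]

/-- The product `α(v₁, …, v_p) β(v_{p+1}, …, v_{p+q})` of two complex-valued forms. -/
def tensorForm {p q n : ℕ} (h : p + q = n) (α : V [⋀^Fin p]→L[ℝ] ℂ) (β : V [⋀^Fin q]→L[ℝ] ℂ) :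
    ContinuousMultilinearMap ℝ (fun _ : Fin n => V) ℂ where
  toFun v := α (fun i => v (Fin.cast h (Fin.castAdd q i))) *
    β (fun j => v (Fin.cast h (Fin.natAdd p j)))
  map_update_add' := by
    subst h
    intro _ v i x y
    refine Fin.addCases (fun a => ?_) (fun b => ?_) i
    · have h₁ : ∀ z, (fun i => Function.update v (Fin.castAdd q a) z (Fin.castAdd q i)) =
          Function.update (fun i => v (Fin.castAdd q i)) a z := fun z =>
        Function.update_comp_eq_of_injective v (Fin.castAdd_injective p q) a z
      have h₂ : ∀ z, (fun j => Function.update v (Fin.castAdd q a) z (Fin.natAdd p j)) =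
          fun j => v (Fin.natAdd p j) := fun z =>
        funext fun j => Function.update_of_ne (by simp [Fin.ext_iff]; omega) _ _
      simp only [Fin.cast_eq_self, h₁, h₂, α.map_update_add, add_mul]
    · have h₁ : ∀ z, (fun i => Function.update v (Fin.natAdd p b) z (Fin.natAdd p i)) =
          Function.update (fun i => v (Fin.natAdd p i)) b z := fun z =>
        Function.update_comp_eq_of_injective v (Fin.natAdd_injective q p) b z
      have h₂ : ∀ z, (fun j => Function.update v (Fin.natAdd p b) z (Fin.castAdd q j)) =
          fun j => v (Fin.castAdd q j) := fun z =>
        funext fun j => Function.update_of_ne (by simp [Fin.ext_iff]; omega) _ _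
      simp only [Fin.cast_eq_self, h₁, h₂, β.map_update_add, mul_add]
  map_update_smul' := by
    subst h
    intro _ v i c x
    refine Fin.addCases (fun a => ?_) (fun b => ?_) i
    · have h₁ : ∀ z, (fun i => Function.update v (Fin.castAdd q a) z (Fin.castAdd q i)) =
          Function.update (fun i => v (Fin.castAdd q i)) a z := fun z =>
        Function.update_comp_eq_of_injective v (Fin.castAdd_injective p q) a z
      have h₂ : ∀ z, (fun j => Function.update v (Fin.castAdd q a) z (Fin.natAdd p j)) =
          fun j => v (Fin.natAdd p j) := fun z =>
        funext fun j => Function.update_of_ne (by simp [Fin.ext_iff]; omega) _ _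
      simp only [Fin.cast_eq_self, h₁, h₂, α.map_update_smul, smul_mul_assoc]
    · have h₁ : ∀ z, (fun i => Function.update v (Fin.natAdd p b) z (Fin.natAdd p i)) =
          Function.update (fun i => v (Fin.natAdd p i)) b z := fun z =>
        Function.update_comp_eq_of_injective v (Fin.natAdd_injective q p) b z
      have h₂ : ∀ z, (fun j => Function.update v (Fin.natAdd p b) z (Fin.castAdd q j)) =
          fun j => v (Fin.castAdd q j) := fun z =>
        funext fun j => Function.update_of_ne (by simp [Fin.ext_iff]; omega) _ _
      simp only [Fin.cast_eq_self, h₁, h₂, β.map_update_smul, mul_smul_comm]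
  cont := by fun_prop

/-- The wedge product
`(α ∧ β)(v) = 1 / (p! q!) ∑_σ sgn(σ) α(v_{σ 1}, …, v_{σ p}) β(v_{σ (p+1)}, …, v_{σ (p+q)})`. -/
def wedge {p q n : ℕ} (h : p + q = n) (α : V [⋀^Fin p]→L[ℝ] ℂ) (β : V [⋀^Fin q]→L[ℝ] ℂ) :
    V [⋀^Fin n]→L[ℝ] ℂ :=
  ((p.factorial * q.factorial : ℂ)⁻¹) •
    ContinuousMultilinearMap.alternatization (tensorForm h α β)

/-- The Hermitian product on complex-valued `k`-forms induced by a Euclidean structure, in terms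
of an orthonormal basis `e`: `(α, β) = ∑_{i₁ < … < i_k} α(e_{i₁}, …, e_{i_k}) conj β(e_{i₁}, …)`,
written as `1 / k!` times the sum over all multi-indices. -/
def formInner {ι : Type*} [Fintype ι] {k : ℕ} (e : ι → V) (α β : V [⋀^Fin k]→L[ℝ] ℂ) : ℂ :=
  (k.factorial : ℂ)⁻¹ * ∑ i : Fin k → ι, α (e ∘ i) * starRingEnd ℂ (β (e ∘ i))

/-- `α` is of type `(k, 0)` for the complex structure `I`: it is `ℂ`-multilinear. -/
def IsHolomorphicType {k : ℕ} (I : V →L[ℝ] V) (α : V [⋀^Fin k]→L[ℝ] ℂ) : Prop :=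
  ∀ (v : Fin k → V) (j : Fin k), α (Function.update v j (I (v j))) = Complex.I * α v

variable [IsTopologicalAddGroup V] [ContinuousConstSMul ℝ V]

/-- The rotation `e^{θI} = cos θ + I sin θ`. -/
def rot (I : V →L[ℝ] V) (θ : ℝ) : V →L[ℝ] V :=
  Real.cos θ • ContinuousLinearMap.id ℝ V + Real.sin θ • I

/-- The `(p, q)`-component of a `k`-form `α`, `k = p + q`, with respect to the complex structure
`I`.  The rotation `e^{θI}` acts on forms of type `(r, s)` as `e^{i(r-s)θ}`, so the component is the
Fourier coefficient of frequency `p - q` of `θ ↦ α(e^{θI} ·, …, e^{θI} ·)`; as this is a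
trigonometric polynomial of degree at most `k`, the coefficient is the average over `2k + 1`
equidistant angles. -/
def hodgeComponent {k : ℕ} (I : V →L[ℝ] V) (p q : ℕ) (α : V [⋀^Fin k]→L[ℝ] ℂ) :
    V [⋀^Fin k]→L[ℝ] ℂ :=
  ((2 * k + 1 : ℂ)⁻¹) • ∑ m ∈ Finset.range (2 * k + 1),
    Complex.exp (-(((p : ℂ) - q) * (2 * Real.pi * m / (2 * k + 1)) * Complex.I)) •
      α.compContinuousLinearMap (rot I (2 * Real.pi * m / (2 * k + 1)))

end Pointwise

/-! ## Differential forms -/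

section Forms

variable (E : Type*) [NormedAddCommGroup E] [NormedSpace ℝ E]
  (M : Type*) [TopologicalSpace M] [ChartedSpace E M]

/-- A (not necessarily smooth) complex-valued differential `k`-form on `M`. -/
abbrev DForm (k : ℕ) : Type _ := ∀ x : M, TangentSpace 𝓘(ℝ, E) x [⋀^Fin k]→L[ℝ] ℂ

variable {E M}

variable (E M) in
/-- Sums `∑_k η k` of forms of all degrees. -/
def TotalForm : Type _ := ∀ k : ℕ, DForm E M k

instance : AddCommGroup (TotalForm E M) := inferInstanceAs (AddCommGroup (∀ k : ℕ, DForm E M k))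

instance : Module ℂ (TotalForm E M) := inferInstanceAs (Module ℂ (∀ k : ℕ, DForm E M k))

/-- The expression of a form in the chart around `x₀`: the pullback by the inverse chart. -/
def DForm.inChart {k : ℕ} (η : DForm E M k) (x₀ : M) (y : E) : E [⋀^Fin k]→L[ℝ] ℂ :=
  (η ((extChartAt 𝓘(ℝ, E) x₀).symm y)).compContinuousLinearMap
    (mfderiv 𝓘(ℝ, E) 𝓘(ℝ, E) (extChartAt 𝓘(ℝ, E) x₀).symm y)

/-- A form is smooth if its expressions in charts are. -/
def DForm.IsSmooth {k : ℕ} (η : DForm E M k) : Prop :=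
  ∀ x₀ : M, ContDiffOn ℝ ∞ (η.inChart x₀) (extChartAt 𝓘(ℝ, E) x₀).target

/-- The de Rham differential, computed at each point in the chart around that point. -/
def DForm.d {k : ℕ} (η : DForm E M k) : DForm E M (k + 1) := fun x =>
  (extDeriv (η.inChart x) (extChartAt 𝓘(ℝ, E) x x)).compContinuousLinearMap
    (mfderiv 𝓘(ℝ, E) 𝓘(ℝ, E) (extChartAt 𝓘(ℝ, E) x) x)

/-- The multiplicative action `(Aη)(v₁, …, v_k) = η(A v₁, …, A v_k)` of a field of
endomorphisms of the tangent spaces on forms. -/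
def DForm.act {k : ℕ} (A : ∀ x : M, TangentSpace 𝓘(ℝ, E) x →L[ℝ] TangentSpace 𝓘(ℝ, E) x)
    (η : DForm E M k) : DForm E M k := fun x => (η x).compContinuousLinearMap (A x)

/-- The Dolbeault differential `∂ : Λ^{p,q} → Λ^{p+1,q}`, `p + q = k`, of the complex structure `I`:
the `(p+1, q)`-component of the de Rham differential. -/
def DForm.del (I : ∀ x : M, TangentSpace 𝓘(ℝ, E) x →L[ℝ] TangentSpace 𝓘(ℝ, E) x) (p q : ℕ)
    {k : ℕ} (η : DForm E M k) : DForm E M (k + 1) := fun x =>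
  hodgeComponent (I x) (p + 1) q (η.d x)

/-- The Dolbeault differential `∂bar : Λ^{p,q} → Λ^{p,q+1}`, `p + q = k`, of the complex structure
`I`: the `(p, q+1)`-component of the de Rham differential. -/
def DForm.delBar (I : ∀ x : M, TangentSpace 𝓘(ℝ, E) x →L[ℝ] TangentSpace 𝓘(ℝ, E) x) (p q : ℕ)
    {k : ℕ} (η : DForm E M k) : DForm E M (k + 1) := fun x =>
  hodgeComponent (I x) p (q + 1) (η.d x)

end Forms

/-! ## Hypercomplex Hermitian manifolds and HKT manifolds -/

section Manifolds

variable (E : Type*) [NormedAddCommGroup E] [NormedSpace ℝ E]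
  (M : Type*) [TopologicalSpace M] [ChartedSpace E M] [IsManifold 𝓘(ℝ, E) ∞ M]

variable {E M} in
/-- Smooth vector fields. -/
def IsSmoothField (X : ∀ x : M, TangentSpace 𝓘(ℝ, E) x) : Prop :=
  ContMDiff 𝓘(ℝ, E) 𝓘(ℝ, E).tangent ∞ (fun x => (X x : TangentBundle 𝓘(ℝ, E) M))

variable {E M} in
/-- Integrability of an almost complex structure: its Nijenhuis tensor
`[LX, LY] - L[LX, Y] - L[X, LY] - [X, Y]` vanishes. -/
def IsIntegrable (L : ∀ x : M, TangentSpace 𝓘(ℝ, E) x →L[ℝ] TangentSpace 𝓘(ℝ, E) x) : Prop :=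
  ∀ X Y : ∀ x : M, TangentSpace 𝓘(ℝ, E) x, IsSmoothField X → IsSmoothField Y → ∀ x : M,
    VectorField.mlieBracket 𝓘(ℝ, E) (fun x => L x (X x)) (fun x => L x (Y x)) x
      - L x (VectorField.mlieBracket 𝓘(ℝ, E) (fun x => L x (X x)) Y x)
      - L x (VectorField.mlieBracket 𝓘(ℝ, E) X (fun x => L x (Y x)) x)
      - VectorField.mlieBracket 𝓘(ℝ, E) X Y x = 0

/-- A hypercomplex structure: a smooth action of the quaternions on the tangent bundle such that
every `q` with `q² = -1` gives an integrable almost complex structure. -/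
structure HypercomplexStructure where
  quat : ∀ x : M, ℍ[ℝ] →ₐ[ℝ] (TangentSpace 𝓘(ℝ, E) x →L[ℝ] TangentSpace 𝓘(ℝ, E) x)
  smooth : ∀ q : ℍ[ℝ], ContMDiff 𝓘(ℝ, E) (𝓘(ℝ, E).prod 𝓘(ℝ, E →L[ℝ] E)) ∞
    (fun x => Bundle.TotalSpace.mk' (E →L[ℝ] E)
      (E := fun x : M => TangentSpace 𝓘(ℝ, E) x →L[ℝ] TangentSpace 𝓘(ℝ, E) x) x (quat x q))
  integrable : ∀ q : ℍ[ℝ], q * q = -1 → IsIntegrable (fun x => quat x q)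

/-- A hypercomplex Hermitian structure: a hypercomplex structure with a Riemannian metric invariant
under the unit quaternions. -/
structure HypercomplexHermitian extends HypercomplexStructure E M where
  metric : Bundle.ContMDiffRiemannianMetric 𝓘(ℝ, E) ∞ E (fun x : M => TangentSpace 𝓘(ℝ, E) x)
  hermitian : ∀ (x : M) (q : ℍ[ℝ]), ‖q‖ = 1 → ∀ v w : TangentSpace 𝓘(ℝ, E) x,
    metric.inner x (quat x q v) (quat x q w) = metric.inner x v w

variable {E M}

/-- The standard basis `i, j, k` of the imaginary quaternions. -/
def quatI : ℍ[ℝ] := ⟨0, 1, 0, 0⟩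

def quatJ : ℍ[ℝ] := ⟨0, 0, 1, 0⟩

def quatK : ℍ[ℝ] := ⟨0, 0, 0, 1⟩

theorem quatJ_mul_self : quatJ * quatJ = -1 := by
  have h : quatJ.re = 0 ∧ quatJ.imI = 0 ∧ quatJ.imJ = 1 ∧ quatJ.imK = 0 := ⟨rfl, rfl, rfl, rfl⟩
  obtain ⟨h₀, h₁, h₂, h₃⟩ := h
  ext <;> simp [h₀, h₁, h₂, h₃]

theorem quatK_mul_self : quatK * quatK = -1 := by
  have h : quatK.re = 0 ∧ quatK.imI = 0 ∧ quatK.imJ = 0 ∧ quatK.imK = 1 := ⟨rfl, rfl, rfl, rfl⟩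
  obtain ⟨h₀, h₁, h₂, h₃⟩ := h
  ext <;> simp [h₀, h₁, h₂, h₃]

namespace HypercomplexStructure

variable (S : HypercomplexStructure E M)

/-- The standard triple of induced complex structures, `IJ = -JI = K`. -/
def I (x : M) : TangentSpace 𝓘(ℝ, E) x →L[ℝ] TangentSpace 𝓘(ℝ, E) x := S.quat x quatI

def J (x : M) : TangentSpace 𝓘(ℝ, E) x →L[ℝ] TangentSpace 𝓘(ℝ, E) x := S.quat x quatJ

def K (x : M) : TangentSpace 𝓘(ℝ, E) x →L[ℝ] TangentSpace 𝓘(ℝ, E) x := S.quat x quatK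

end HypercomplexStructure

namespace HypercomplexHermitian

variable (S : HypercomplexHermitian E M)

theorem inner_self_eq_zero (x : M) (q : ℍ[ℝ]) (hq : q * q = -1)
    (v : TangentSpace 𝓘(ℝ, E) x) : S.metric.inner x v (S.quat x q v) = 0 := by
  have hn : ‖q‖ = 1 := by
    have h := congrArg norm hq
    rw [norm_mul, norm_neg, norm_one] at h
    nlinarith [norm_nonneg q]
  have h₁ := S.hermitian x q hn v (S.quat x q v)
  have h₂ : S.quat x q (S.quat x q v) = -v := by
    rw [← mul_apply_eq_comp, ← map_mul, hq, map_neg, map_one]; rfl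
  rw [h₂, map_neg, S.metric.symm x] at h₁
  linarith

/-- The form `ω_L(v, w) = g(v, L w)` of the induced complex structure `L` given by a quaternion `q`
with `q² = -1`, as a complex-valued form. -/
def omega (q : ℍ[ℝ]) (hq : q * q = -1) : DForm E M 2 := fun x =>
  { toFun := fun v => (S.metric.inner x (v 0) (S.quat x q (v 1)) : ℂ)
    map_update_add' := by
      intro _ v i a b
      fin_cases i <;> simp
    map_update_smul' := by
      intro _ v i c a
      fin_cases i <;> simp
    cont := by
      have h : Continuous fun v : Fin 2 → E =>
          (show E →L[ℝ] E →L[ℝ] ℝ from S.metric.inner x) (v 0)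
            ((show E →L[ℝ] E from S.quat x q) (v 1)) := by fun_prop
      exact Complex.continuous_ofReal.comp h
    map_eq_zero_of_eq' := by
      intro v i j hv hij
      have h01 : v 0 = v 1 := by
        fin_cases i <;> fin_cases j <;> simp_all
      simp [← h01, S.inner_self_eq_zero x q hq] }

/-- The standard `(2, 0)`-form `Ω = (ω_J + i ω_K) / 2` on `(M, I)`. -/
def Omega : DForm E M 2 := fun x =>
  (1 / 2 : ℂ) • (S.omega quatJ quatJ_mul_self x + Complex.I • S.omega quatK quatK_mul_self x)

/-- `M` is an HKT manifold: `∂Ω = 0`. -/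
def IsHKT : Prop := DForm.del S.I 2 0 S.Omega = 0

end HypercomplexHermitian

end Manifolds

/-! ## The operators on `Λ^{*,0}(M, I)` -/

section Operators

variable {E : Type*} [NormedAddCommGroup E] [NormedSpace ℝ E]
  {M : Type*} [TopologicalSpace M] [ChartedSpace E M] [IsManifold 𝓘(ℝ, E) ∞ M]

namespace HypercomplexHermitian

variable (S : HypercomplexHermitian E M)

/-- The space `Λ^{*,0}(M, I) = ⨁_k Λ^{k,0}(M, I)` of smooth forms; `η k` is the component of
degree `k` of `η` (forms of degree greater than the dimension vanish). -/
def holForms : Submodule ℂ (TotalForm E M) where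
  carrier := {η | ∀ k, (η k).IsSmooth ∧ ∀ x, IsHolomorphicType (S.I x) (η k x)}
  add_mem' := by
    intro η ζ hη hζ k
    refine ⟨fun x₀ => ?_, fun x v j => ?_⟩
    · exact ((hη k).1 x₀).add ((hζ k).1 x₀)
    · have h₁ := (hη k).2 x v j
      have h₂ := (hζ k).2 x v j
      exact (congrArg₂ (· + ·) h₁ h₂).trans (mul_add _ _ _).symm
  zero_mem' := by
    refine fun k => ⟨fun x₀ => ?_, fun x v j => ?_⟩
    · exact contDiffOn_const (c := (0 : E [⋀^Fin k]→L[ℝ] ℂ))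
    · exact (mul_zero _).symm
  smul_mem' := by
    intro c η hη k
    refine ⟨fun x₀ => ?_, fun x v j => ?_⟩
    · exact ((hη k).1 x₀).const_smul c
    · have h₁ := (hη k).2 x v j
      exact (congrArg (c * ·) h₁).trans (mul_left_comm _ _ _)

/-- The operator `L_Ω` of multiplication by `Ω`. -/
def lefschetz (η : TotalForm E M) : TotalForm E M
  | 0 => 0
  | 1 => 0
  | k + 2 => fun x => wedge (Nat.add_comm 2 k) (S.Omega x) (η k x)

/-- The Dolbeault differential `∂` on `Λ^{*,0}(M, I)`. -/
def del (η : TotalForm E M) : TotalForm E M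
  | 0 => 0
  | k + 1 => DForm.del S.I k 0 (η k)

/-- The differential `∂_J = J⁻¹ ∘ ∂bar ∘ J` on `Λ^{*,0}(M, I)`; here `J` maps `(k, 0)`-forms to
`(0, k)`-forms and acts multiplicatively, and `J⁻¹ = -J` on tangent vectors. -/
def delJ (η : TotalForm E M) : TotalForm E M
  | 0 => 0
  | k + 1 => (DForm.delBar S.I 0 k ((η k).act S.J)).act (fun x => -S.J x)

/-- A frame of `T_x M` orthonormal for the metric. -/
def IsOrthonormalBasis {x : M} {ι : Type*} [DecidableEq ι]
    (e : Module.Basis ι ℝ (TangentSpace 𝓘(ℝ, E) x)) : Prop :=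
  ∀ i j, S.metric.inner x (e i) (e j) = if i = j then 1 else 0

/-- `Λ` is the Hermitian adjoint of `L` on `Λ^{*,0}(M, I)`: `(Lη, ζ) = (η, Λζ)` at every point, for
the Hermitian product on forms induced by the metric. -/
def IsHermitianAdjoint (L Λ : Module.End ℂ S.holForms) : Prop :=
  ∀ (η ζ : S.holForms) (x : M)
    (e : Module.Basis (Fin (Module.finrank ℝ E)) ℝ (TangentSpace 𝓘(ℝ, E) x)),
    S.IsOrthonormalBasis e →
      ∑ k ∈ Finset.range (Module.finrank ℝ E + 1), formInner e ((L η).1 k x) (ζ.1 k x) =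
        ∑ k ∈ Finset.range (Module.finrank ℝ E + 1), formInner e (η.1 k x) ((Λ ζ).1 k x)

end HypercomplexHermitian

end Operators

end HKT

end

/-! The abstract algebra behind the theorem is small. In any Lie superalgebra with elements
satisfying the relations, the Jacobi identity shows that the Laplacian Δ = {d, [Λ, d^c]} is central,
and that the span of L, Λ, H, Δ (even) and d, d^c, [Λ, d], [Λ, d^c] (odd) is closed under the
supercommutator. If Δ ≠ 0, these eight elements are linearly independent: the odd ones pair
nondegenerately into ℂΔ, and the adjoint action of sl(2) separates the even ones. Hence the
presented algebra is isomorphic to any algebra generated by operators that satisfy the relations and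
have a non-zero Laplacian (`nonempty_iso_generated`). It remains to verify the relations, and that Δ
≠ 0, for the operators of an HKT manifold.

Relations among the differentials. One works on smooth forms of all types, where each quaternion q
acts by a derivation `iOp q`. Integrability of a complex structure L is used in the form [L, [L, d]]
= -d (`der_der_dLoc`); applied to I, J, K and, by polarisation, to (I+J)/√2 and its analogues, it
determines all double brackets of d with I, J, K (`IsQuaternionicDifferential`). In these terms ∂ =
½(d - √-1 [I, d]), and J⁻¹dJ = -[J, d] (`pull_dLoc_pull`) gives ∂_J = -½([J, d] + √-1 [K, d]).
Bracketing d² = 0 repeatedly with I, J, K yields all the relations {∂, ∂} = {∂_J, ∂_J} = {∂, ∂_J} =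
0. The agreement with the Dolbeault differentials, which are defined through Hodge components, is a
comparison of weights under I (`coe_delOp`, `coe_delJOp`).

Commutation with L_Ω. The commutator of d with multiplication by a two-form is multiplication by a
three-form, and brackets with derivations preserve such operators. So [∂, L_Ω] and [∂_J, L_Ω] are
determined by their values on the constant function 1. These are ∂Ω, which vanishes on an HKT
manifold, and ∂_JΩ, which vanishes as well because JΩ is the complex conjugate of Ω.

The sl(2)-triple. In an orthonormal frame Λ_Ω is -½ Σ ι_{Je_i} ι_{e_i}, and a computation with
contractions gives [L_Ω, Λ_Ω] = degree - n/4 on (p,0)-forms, n being the real dimension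
(`IsON.wedgeTwo_lam`, `lie_res`). This fixes every bracket with H. The relation [Λ, [Λ, ∂]] = 0
needs no Kähler identity: ∂ is a highest weight vector of weight 1 for the adjoint action and Λ is
nilpotent, so ∂ generates a two-dimensional representation (`lie_lie_eq_zero_of_isNilpotent`);
likewise for ∂_J.

The Laplacian is non-zero. If f(x) = 0 and df(x) ≠ 0, the value of Δ(f²) at x is Λ_Ω(2 ∂_J f ∧ ∂f),
a positive multiple of the sum of the squares of df, df∘I, df∘J and df∘K over an orthonormal frame
(`exists_laplacian_ne_zero`). -/

noncomputable section

namespace HKT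

universe u v

/-! ### Recognition of the Kähler-de Rham superalgebra from its relations and a non-zero Laplacian
-/

namespace LieSuperalgebra

/-! ### The supercommutator on the direct sum of the homogeneous parts -/

section Bracket

variable {k : Type*} [CommRing k] (A : LieSuperalgebra k)

/-- The supercommutator on `Even × Odd`. -/
def bracket : (A.Even × A.Odd) →ₗ[k] (A.Even × A.Odd) →ₗ[k] (A.Even × A.Odd) :=
  LinearMap.mk₂ k (fun u v => (A.ee u.1 v.1 + A.oo u.2 v.2, A.eo u.1 v.2 - A.eo v.1 u.2))
    (fun _ _ _ => by ext <;> simp <;> abel)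
    (fun _ _ _ => by ext <;> simp [smul_sub])
    (fun _ _ _ => by ext <;> simp <;> abel)
    (fun _ _ _ => by ext <;> simp [smul_sub])

@[simp]
theorem bracket_apply (u v : A.Even × A.Odd) :
    A.bracket u v = (A.ee u.1 v.1 + A.oo u.2 v.2, A.eo u.1 v.2 - A.eo v.1 u.2) := rfl

variable {X : Type*}

/-- The value of a formal iterated bracket on given values of the generators. -/
def evalMagma (g : X → A.Even × A.Odd) : FreeMagma X → A.Even × A.Odd
  | .of x => g x
  | .mul a b => A.bracket (evalMagma g a) (evalMagma g b)

/-- The linear extension of `evalMagma` to the free non-associative algebra. -/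
def evalFree (g : X → A.Even × A.Odd) :
    FreeNonUnitalNonAssocAlgebra k X →ₗ[k] A.Even × A.Odd :=
  (Finsupp.linearCombination k (A.evalMagma g)) ∘ₗ
    (MonoidAlgebra.coeffLinearEquiv k).toLinearMap

@[simp]
theorem evalFree_mono (g : X → A.Even × A.Odd) (m : FreeMagma X) :
    A.evalFree g (mono k m) = A.evalMagma g m := by
  simp [evalFree, mono]

theorem evalFree_of (g : X → A.Even × A.Odd) (x : X) :
    A.evalFree g (FreeNonUnitalNonAssocAlgebra.of k x) = g x :=
  A.evalFree_mono g (.of x)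

theorem free_induction {p : FreeNonUnitalNonAssocAlgebra k X → Prop}
    (zero : p 0) (mono_mem : ∀ m, p (mono k m)) (add : ∀ u v, p u → p v → p (u + v))
    (smul : ∀ (c : k) u, p u → p (c • u)) (u : FreeNonUnitalNonAssocAlgebra k X) : p u := by
  induction u using MonoidAlgebra.induction_linear with
  | zero => exact zero
  | add u v hu hv => exact add u v hu hv
  | single m c =>
    have h := smul c _ (mono_mem m)
    rwa [mono, MonoidAlgebra.smul_single, smul_eq_mul, mul_one] at h

theorem evalFree_mul (g : X → A.Even × A.Odd) (u v : FreeNonUnitalNonAssocAlgebra k X) :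
    A.evalFree g (u * v) = A.bracket (A.evalFree g u) (A.evalFree g v) := by
  induction u using free_induction with
  | zero => simp
  | add u u' hu hu' => rw [add_mul, map_add, hu, hu', map_add, map_add]; rfl
  | smul c u hu => rw [smul_mul_assoc, map_smul, hu, map_smul, map_smul]; rfl
  | mono_mem m =>
    induction v using free_induction with
    | zero => rw [mul_zero, map_zero, map_zero]
    | add u u' hu hu' => rw [mul_add, map_add, hu, hu', map_add, map_add]
    | smul c u hu => rw [mul_smul_comm, map_smul, hu, map_smul, map_smul]
    | mono_mem m' =>
      rw [mono_mul, evalFree_mono, evalFree_mono, evalFree_mono]; rfl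

/-- The element `u` is homogeneous of parity `i`. -/
def IsHomogeneous (u : A.Even × A.Odd) (i : ZMod 2) : Prop :=
  (i = 0 ∧ u.2 = 0) ∨ (i = 1 ∧ u.1 = 0)

theorem IsHomogeneous.bracket {u v : A.Even × A.Odd} {i j : ZMod 2}
    (hu : A.IsHomogeneous u i) (hv : A.IsHomogeneous v j) :
    A.IsHomogeneous (A.bracket u v) (i + j) := by
  rcases hu with ⟨rfl, hu⟩ | ⟨rfl, hu⟩ <;> rcases hv with ⟨rfl, hv⟩ | ⟨rfl, hv⟩ <;>
    simp [IsHomogeneous, hu, hv, show (1 : ZMod 2) + 1 = 0 from rfl]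

theorem bracket_skew {u v : A.Even × A.Odd} {i j : ZMod 2}
    (hu : A.IsHomogeneous u i) (hv : A.IsHomogeneous v j) :
    A.bracket u v + koszul k i j • A.bracket v u = 0 := by
  rcases hu with ⟨rfl, hu⟩ | ⟨rfl, hu⟩ <;> rcases hv with ⟨rfl, hv⟩ | ⟨rfl, hv⟩ <;>
    simp [koszul, hu, hv, A.ee_skew u.1 v.1, A.oo_symm u.2 v.2]

/-- Of the eight parity patterns, four are the identities stored in the structure; the other four
follow from them by skew-symmetry of `ee` and symmetry of `oo`. -/
theorem bracket_jacobi {u v w : A.Even × A.Odd} {i j l : ZMod 2}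
    (hu : A.IsHomogeneous u i) (hv : A.IsHomogeneous v j) (hw : A.IsHomogeneous w l) :
    A.bracket u (A.bracket v w) - A.bracket (A.bracket u v) w -
      koszul k i j • A.bracket v (A.bracket u w) = 0 := by
  obtain ⟨a, x⟩ := u
  obtain ⟨b, y⟩ := v
  obtain ⟨c, z⟩ := w
  rcases hu with ⟨rfl, hu⟩ | ⟨rfl, hu⟩ <;> rcases hv with ⟨rfl, hv⟩ | ⟨rfl, hv⟩ <;>
    rcases hw with ⟨rfl, hw⟩ | ⟨rfl, hw⟩ <;> dsimp only at hu hv hw <;> subst hu hv hw <;>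
    simp only [koszul, bracket_apply, map_zero, LinearMap.zero_apply, add_zero,
      zero_add, sub_zero, zero_sub, Prod.mk_sub_mk, one_smul, zero_ne_one, and_true,
      and_false, and_self, if_true, if_false, neg_smul, map_neg, LinearMap.neg_apply,
      Prod.neg_mk, sub_neg_eq_add, neg_neg, neg_zero, sub_self, Prod.mk_eq_zero,
      true_and]
  · rw [A.jacobi_eee a b c]; abel
  · rw [A.jacobi_eeo a b z]; abel
  · rw [A.jacobi_eeo a c y, A.ee_skew a c]; simp
  · rw [A.jacobi_eoo a y z]; abel
  · rw [A.jacobi_eeo b c x, A.ee_skew b c]; simp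
  · rw [A.jacobi_eoo b x z]; abel
  · rw [A.ee_skew _ c, A.jacobi_eoo c x y, A.oo_symm y]; abel
  · rw [A.jacobi_ooo x y z]; abel

theorem isHomogeneous_evalMagma {par : X → ZMod 2} {g : X → A.Even × A.Odd}
    (hg : ∀ x, A.IsHomogeneous (g x) (par x)) (m : FreeMagma X) :
    A.IsHomogeneous (A.evalMagma g m) (parity par m) := by
  induction m with
  | ih1 x => exact hg x
  | ih2 a b ha hb => exact ha.bracket A hb

/-- Values of the generators satisfying the relations define a map of the presented algebra. -/
theorem relIdeal_le_ker_evalFree {par : X → ZMod 2} {g : X → A.Even × A.Odd}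
    (hg : ∀ x, A.IsHomogeneous (g x) (par x)) {rels : Set (FreeNonUnitalNonAssocAlgebra k X)}
    (hr : ∀ r ∈ rels, A.evalFree g r = 0) :
    relIdeal par rels ≤ LinearMap.ker (A.evalFree g) := by
  refine sInf_le ⟨fun r h => ?_, fun n hn u => ?_⟩
  · rw [LinearMap.mem_ker]
    induction h with
    | skew a b =>
      simpa only [map_add, map_smul, evalFree_mul, evalFree_mono] using A.bracket_skew
        (A.isHomogeneous_evalMagma hg a) (A.isHomogeneous_evalMagma hg b)
    | jacobi a b c =>
      simpa only [map_sub, map_smul, evalFree_mul, evalFree_mono] using A.bracket_jacobi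
        (A.isHomogeneous_evalMagma hg a) (A.isHomogeneous_evalMagma hg b)
        (A.isHomogeneous_evalMagma hg c)
    | rel h => exact hr _ h
  · rw [LinearMap.mem_ker] at hn
    simp [LinearMap.mem_ker, evalFree_mul, hn]

end Bracket

/-! ### Consequences of the relations of the Kähler-de Rham superalgebra -/

section KahlerDeRham

/-- The elements `l`, `m`, `h` (even) and `d`, `c` (odd) of a Lie superalgebra satisfy the defining
relations of the Kähler-de Rham superalgebra. -/
structure IsKdR (A : LieSuperalgebra ℂ) (l m h : A.Even) (d c : A.Odd) : Prop where
  lm : A.ee l m = h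
  hl : A.ee h l = (2 : ℂ) • l
  hm : A.ee h m = -((2 : ℂ) • m)
  hd : A.eo h d = d
  hc : A.eo h c = c
  ld : A.eo l d = 0
  lc : A.eo l c = 0
  mmd : A.eo m (A.eo m d) = 0
  mmc : A.eo m (A.eo m c) = 0
  dd : A.oo d d = 0
  cc : A.oo c c = 0
  dc : A.oo d c = 0

namespace IsKdR

variable {A : LieSuperalgebra ℂ} {l m h : A.Even} {d c : A.Odd}

theorem symm (H : A.IsKdR l m h d c) : A.IsKdR l m h c d :=
  ⟨H.lm, H.hl, H.hm, H.hc, H.hd, H.lc, H.ld, H.mmc, H.mmd, H.cc, H.dd, (A.oo_symm _ _).trans H.dc⟩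

/-- With `ld` and `mmd` this says that d and [m, d] form the standard two-dimensional representation
of sl(2). -/
theorem eo_l_md (H : A.IsKdR l m h d c) : A.eo l (A.eo m d) = d := by
  rw [A.jacobi_eeo, H.lm, H.hd, H.ld, map_zero, add_zero]

theorem eo_h_md (H : A.IsKdR l m h d c) : A.eo h (A.eo m d) = -A.eo m d := by
  rw [A.jacobi_eeo, H.hm, H.hd, map_neg, map_smul, LinearMap.neg_apply, LinearMap.smul_apply]
  module

/-- Bracketing {d, d} = 0 with m gives twice this element. -/
theorem oo_d_md (H : A.IsKdR l m h d c) : A.oo d (A.eo m d) = 0 := by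
  have h₁ := A.jacobi_eoo m d d
  rw [H.dd, map_zero, A.oo_symm (A.eo m d), ← two_smul ℂ] at h₁
  exact (smul_eq_zero.1 h₁.symm).resolve_left two_ne_zero

theorem oo_md_md (H : A.IsKdR l m h d c) : A.oo (A.eo m d) (A.eo m d) = 0 := by
  have h₁ := A.jacobi_eoo m d (A.eo m d)
  rwa [H.oo_d_md, H.mmd, map_zero, map_zero, add_zero, eq_comm] at h₁

theorem oo_c_md (H : A.IsKdR l m h d c) : A.oo c (A.eo m d) = -A.oo d (A.eo m c) := by
  have h₁ := A.jacobi_eoo m d c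
  rw [H.dc, map_zero, A.oo_symm (A.eo m d)] at h₁
  exact eq_neg_of_add_eq_zero_left h₁.symm

/-- The element is [m, {d, [m, c]}] and also, by symmetry, [m, {c, [m, d]}]. The two inner
anticommutators are opposite by `oo_c_md`, so the element equals its own negative. -/
theorem oo_md_mc (H : A.IsKdR l m h d c) : A.oo (A.eo m d) (A.eo m c) = 0 := by
  have h₁ := A.jacobi_eoo m d (A.eo m c)
  have h₂ := A.jacobi_eoo m c (A.eo m d)
  rw [H.mmc, map_zero, add_zero] at h₁
  rw [H.mmd, map_zero, add_zero, H.oo_c_md, map_neg, h₁, A.oo_symm (A.eo m c)] at h₂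
  have h₃ : (2 : ℂ) • A.oo (A.eo m d) (A.eo m c) = 0 := by
    rw [two_smul]; nth_rw 1 [← h₂]; simp
  exact (smul_eq_zero.1 h₃).resolve_left two_ne_zero

/-- This and the lemmas up to `eo_lap_mc` make the Laplacian central. It commutes with sl(2) because
it is, up to scale, the invariant pairing of the two-dimensional representations generated by d and
by c. -/
theorem ee_l_lap (H : A.IsKdR l m h d c) : A.ee l (A.oo d (A.eo m c)) = 0 := by
  rw [A.jacobi_eoo, H.ld, H.symm.eo_l_md, H.dc]; simp

theorem ee_m_lap (H : A.IsKdR l m h d c) : A.ee m (A.oo d (A.eo m c)) = 0 := by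
  rw [A.jacobi_eoo, H.mmc, H.oo_md_mc]; simp

theorem ee_h_lap (H : A.IsKdR l m h d c) : A.ee h (A.oo d (A.eo m c)) = 0 := by
  rw [A.jacobi_eoo, H.hd, H.symm.eo_h_md]; simp

/-- The Jacobi identity for [m, c], d, d gives twice this element on one side and [{d, d}, ·] = 0 on
the other. -/
theorem eo_lap_d (H : A.IsKdR l m h d c) : A.eo (A.oo d (A.eo m c)) d = 0 := by
  have h₁ := A.jacobi_ooo (A.eo m c) d d
  rw [H.dd, A.oo_symm (A.eo m c), ← two_smul ℂ] at h₁
  simpa using h₁.symm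

theorem eo_lap_c (H : A.IsKdR l m h d c) : A.eo (A.oo d (A.eo m c)) c = 0 := by
  have h₁ := H.symm.eo_lap_d
  rwa [H.oo_c_md, map_neg, LinearMap.neg_apply, neg_eq_zero] at h₁

theorem eo_lap_md (H : A.IsKdR l m h d c) : A.eo (A.oo d (A.eo m c)) (A.eo m d) = 0 := by
  have h₁ := A.jacobi_ooo d (A.eo m c) (A.eo m d)
  rw [A.oo_symm (A.eo m c), H.oo_md_mc, H.oo_d_md] at h₁
  simpa using h₁.symm

theorem eo_lap_mc (H : A.IsKdR l m h d c) : A.eo (A.oo d (A.eo m c)) (A.eo m c) = 0 := by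
  have h₁ := H.symm.eo_lap_md
  rwa [H.oo_c_md, map_neg, LinearMap.neg_apply, neg_eq_zero] at h₁

theorem ee_self (a : A.Even) : A.ee a a = 0 := by
  have h₁ := A.ee_skew a a
  rw [eq_neg_iff_add_eq_zero, ← two_smul ℂ] at h₁
  exact (smul_eq_zero.1 h₁).resolve_left two_ne_zero

/-- The even part of the Kähler-de Rham superalgebra is spanned by the `sl(2)`-triple and the
Laplacian. -/
def evenFamily (A : LieSuperalgebra ℂ) (l m h : A.Even) (d c : A.Odd) : Fin 4 → A.Even :=
  ![l, m, h, A.oo d (A.eo m c)]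

/-- The odd part of the Kähler-de Rham superalgebra is spanned by the differentials and their
brackets with `Λ`. -/
def oddFamily (A : LieSuperalgebra ℂ) (m : A.Even) (d c : A.Odd) : Fin 4 → A.Odd :=
  ![d, c, A.eo m d, A.eo m c]

/-- By bilinearity it suffices to look up the multiplication table on the spanning family; together
with `eo_mem` and `oo_mem` this bounds the dimension of the generated superalgebra by 4|4. -/
theorem ee_mem (H : A.IsKdR l m h d c) {a b : A.Even}
    (ha : a ∈ Submodule.span ℂ (Set.range (evenFamily A l m h d c)))
    (hb : b ∈ Submodule.span ℂ (Set.range (evenFamily A l m h d c))) :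
    A.ee a b ∈ Submodule.span ℂ (Set.range (evenFamily A l m h d c)) := by
  refine LinearMap.BilinMap.apply_apply_mem_of_mem_span _ _ _ A.ee ?_ a b ha hb
  have hv : ∀ i, evenFamily A l m h d c i ∈
      Submodule.span ℂ (Set.range (evenFamily A l m h d c)) := fun i =>
    Submodule.subset_span ⟨i, rfl⟩
  generalize Submodule.span ℂ (Set.range (evenFamily A l m h d c)) = W at hv ⊢
  have h0 : l ∈ W := hv 0
  have h1 : m ∈ W := hv 1
  have h2 : h ∈ W := hv 2
  have e1 := A.ee_skew m l
  have e2 := A.ee_skew l h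
  have e3 := A.ee_skew m h
  have e4 : ∀ a, A.ee (A.oo d (A.eo m c)) a = -A.ee a (A.oo d (A.eo m c)) := A.ee_skew _
  rintro _ ⟨i, rfl⟩ _ ⟨j, rfl⟩
  fin_cases i <;> fin_cases j <;>
    simp [evenFamily, ee_self, H.lm, H.hl, H.hm, e1, e2, e3, e4 l, e4 m, e4 h, H.ee_l_lap, H.ee_m_lap,
      H.ee_h_lap, h0, h1, h2]

theorem eo_mem (H : A.IsKdR l m h d c) {a : A.Even} {x : A.Odd}
    (ha : a ∈ Submodule.span ℂ (Set.range (evenFamily A l m h d c)))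
    (hx : x ∈ Submodule.span ℂ (Set.range (oddFamily A m d c))) :
    A.eo a x ∈ Submodule.span ℂ (Set.range (oddFamily A m d c)) := by
  refine LinearMap.BilinMap.apply_apply_mem_of_mem_span _ _ _ A.eo ?_ a x ha hx
  have hv : ∀ i, oddFamily A m d c i ∈ Submodule.span ℂ (Set.range (oddFamily A m d c)) :=
    fun i => Submodule.subset_span ⟨i, rfl⟩
  generalize Submodule.span ℂ (Set.range (oddFamily A m d c)) = W at hv ⊢
  have h0 : d ∈ W := hv 0
  have h1 : c ∈ W := hv 1
  have h2 : A.eo m d ∈ W := hv 2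
  have h3 : A.eo m c ∈ W := hv 3
  rintro _ ⟨i, rfl⟩ _ ⟨j, rfl⟩
  fin_cases i <;> fin_cases j <;>
    simp [evenFamily, oddFamily, H.ld, H.lc, H.hd, H.hc, H.mmd, H.mmc, H.eo_l_md, H.symm.eo_l_md,
      H.eo_h_md, H.symm.eo_h_md, H.eo_lap_d, H.eo_lap_c, H.eo_lap_md, H.eo_lap_mc, h0, h1, h2, h3]

theorem oo_mem (H : A.IsKdR l m h d c) {x y : A.Odd}
    (hx : x ∈ Submodule.span ℂ (Set.range (oddFamily A m d c)))
    (hy : y ∈ Submodule.span ℂ (Set.range (oddFamily A m d c))) :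
    A.oo x y ∈ Submodule.span ℂ (Set.range (evenFamily A l m h d c)) := by
  refine LinearMap.BilinMap.apply_apply_mem_of_mem_span _ _ _ A.oo ?_ x y hx hy
  have h3 : A.oo d (A.eo m c) ∈ Submodule.span ℂ (Set.range (evenFamily A l m h d c)) :=
    Submodule.subset_span ⟨3, rfl⟩
  generalize Submodule.span ℂ (Set.range (evenFamily A l m h d c)) = W at h3 ⊢
  have e1 := A.oo_symm c d
  have e2 : ∀ a y, A.oo (A.eo a d) y = A.oo y (A.eo a d) := fun _ _ => A.oo_symm _ _
  have e3 := A.oo_symm (A.eo m c)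
  have e4 := H.oo_md_mc
  rw [e2] at e4
  rintro _ ⟨i, rfl⟩ _ ⟨j, rfl⟩
  fin_cases i <;> fin_cases j <;>
    simp [oddFamily, H.dd, H.cc, H.dc, e1, H.oo_d_md, H.symm.oo_d_md, H.oo_c_md, e2 m d, e2 m c,
      e3 d, e3 c, e4, H.oo_md_md, H.symm.oo_md_md, H.oo_md_mc, h3]

/-- If the Laplacian does not vanish, the spanning families are linearly independent. -/
theorem evenFamily_injective (H : A.IsKdR l m h d c) (hΔ : A.oo d (A.eo m c) ≠ 0) :
    Function.Injective (Fintype.linearCombination ℂ (evenFamily A l m h d c)) := by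
  rw [← LinearMap.ker_eq_bot, LinearMap.ker_eq_bot']
  intro w hw
  -- If l = 0, then d = [l, [m, d]] = 0 and the Laplacian vanishes.
  have hl : l ≠ 0 := by
    rintro rfl
    have h₁ := H.eo_l_md
    rw [map_zero, LinearMap.zero_apply] at h₁
    simp [← h₁] at hΔ
  simp only [Fintype.linearCombination_apply, Fin.sum_univ_four, evenFamily,
    Matrix.cons_val] at hw
  -- The bracket with l sends m to h and h to -2l and kills l and the Laplacian; a second bracket
  -- with l isolates the coefficient of m.
  have h₁ : w 1 • h - ((2 : ℂ) * w 2) • l = 0 := by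
    have := congrArg (A.ee l) hw
    simp only [map_add, map_smul, ee_self, H.lm, A.ee_skew l h, H.hl, H.ee_l_lap, map_zero] at this
    rw [← this]; module
  have hw1 : w 1 = 0 := by
    have := congrArg (A.ee l) h₁
    simp only [map_sub, map_smul, ee_self, A.ee_skew l h, H.hl, map_zero, smul_zero, sub_zero,
      smul_neg, neg_eq_zero, smul_eq_zero, hl, or_false, two_ne_zero] at this
    exact this
  have hw2 : w 2 = 0 := by simpa [hw1, hl] using h₁
  have h₂ : w 0 • h = 0 := by
    have := congrArg (A.ee m) hw
    simpa [hw1, hw2, A.ee_skew m l, H.lm, H.ee_m_lap] using this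
  have hw0 : w 0 = 0 := by
    have := congrArg (A.ee · l) h₂
    simpa [H.hl, hl] using this
  have hw3 : w 3 = 0 := by simpa [hw0, hw1, hw2, hΔ] using hw
  ext i
  fin_cases i <;> simp [hw0, hw1, hw2, hw3]

/-- The anticommutator on the four odd elements takes values in multiples of the Laplacian and pairs
d with [m, c] and c with [m, d], all other pairs giving zero. Anticommuting a linear relation with
each element in turn reads off its coefficients. -/
theorem oddFamily_injective (H : A.IsKdR l m h d c) (hΔ : A.oo d (A.eo m c) ≠ 0) :
    Function.Injective (Fintype.linearCombination ℂ (oddFamily A m d c)) := by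
  rw [← LinearMap.ker_eq_bot, LinearMap.ker_eq_bot']
  intro w hw
  simp only [Fintype.linearCombination_apply, Fin.sum_univ_four, oddFamily,
    Matrix.cons_val] at hw
  have e1 := A.oo_symm c d
  have hd := congrArg (A.oo d) hw
  have hc := congrArg (A.oo c) hw
  have hmd := congrArg (A.oo (A.eo m d)) hw
  have hmc := congrArg (A.oo (A.eo m c)) hw
  simp only [map_add, map_smul, H.dd, H.dc, H.oo_d_md, map_zero, smul_zero, zero_add, add_zero,
    smul_eq_zero, hΔ, or_false] at hd
  simp only [map_add, map_smul, H.cc, e1, H.dc, H.oo_c_md, H.symm.oo_d_md, map_zero, smul_zero,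
    zero_add, add_zero, smul_neg, neg_eq_zero, smul_eq_zero, hΔ, or_false] at hc
  simp only [map_add, map_smul, A.oo_symm (A.eo m d) d, A.oo_symm (A.eo m d) c, H.oo_d_md,
    H.oo_c_md, H.oo_md_md, H.oo_md_mc, map_zero, smul_zero, zero_add, add_zero, smul_neg,
    neg_eq_zero, smul_eq_zero, hΔ, or_false] at hmd
  simp only [map_add, map_smul, A.oo_symm (A.eo m c) d, A.oo_symm (A.eo m c) c, H.symm.oo_d_md,
    H.symm.oo_md_md, H.symm.oo_md_mc, map_zero, smul_zero, add_zero,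
    smul_eq_zero, hΔ, or_false] at hmc
  ext i
  fin_cases i <;> simp [hd, hc, hmd, hmc]

end IsKdR

/-! ### Comparison with the presented algebra -/

/-- The generators of the Kähler-de Rham superalgebra. -/
def kdrGen (x : KdRGenerator) (i : ZMod 2) (hx : x.parity = i) :
    quotPart KdRGenerator.parity KdRGenerator.relators i :=
  ⟨Submodule.Quotient.mk x.gen, Submodule.subset_span ⟨.of x, hx, rfl⟩⟩

theorem isKdR_kahlerDeRham : kahlerDeRham.IsKdR (kdrGen .L 0 rfl) (kdrGen .Lam 0 rfl)
    (kdrGen .H 0 rfl) (kdrGen .d 1 rfl) (kdrGen .dc 1 rfl) := by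
  have key : ∀ r ∈ KdRGenerator.relators, (Submodule.Quotient.mk r :
      _ ⧸ relIdeal KdRGenerator.parity KdRGenerator.relators) = 0 := fun r hr =>
    (Submodule.Quotient.mk_eq_zero _).2 (relIdeal_of_relator _ _ (.rel hr))
  constructor <;> refine Subtype.ext ?_
  · exact sub_eq_zero.1 (key _ (by simp [KdRGenerator.relators]))
  · exact sub_eq_zero.1 (key (KdRGenerator.gen .H * KdRGenerator.gen .L -
      (2 : ℂ) • KdRGenerator.gen .L) (by simp [KdRGenerator.relators]))
  · exact eq_neg_of_add_eq_zero_left (key (KdRGenerator.gen .H * KdRGenerator.gen .Lam +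
      (2 : ℂ) • KdRGenerator.gen .Lam) (by simp [KdRGenerator.relators]))
  · exact sub_eq_zero.1 (key (KdRGenerator.gen .H * KdRGenerator.gen .d -
      KdRGenerator.gen .d) (by simp [KdRGenerator.relators]))
  · exact sub_eq_zero.1 (key (KdRGenerator.gen .H * KdRGenerator.gen .dc -
      KdRGenerator.gen .dc) (by simp [KdRGenerator.relators]))
  · exact key (KdRGenerator.gen .L * KdRGenerator.gen .d) (by simp [KdRGenerator.relators])
  · exact key (KdRGenerator.gen .L * KdRGenerator.gen .dc) (by simp [KdRGenerator.relators])
  · exact key (KdRGenerator.gen .Lam * (KdRGenerator.gen .Lam * KdRGenerator.gen .d))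
      (by simp [KdRGenerator.relators])
  · exact key (KdRGenerator.gen .Lam * (KdRGenerator.gen .Lam * KdRGenerator.gen .dc))
      (by simp [KdRGenerator.relators])
  · exact key (KdRGenerator.gen .d * KdRGenerator.gen .d) (by simp [KdRGenerator.relators])
  · exact key (KdRGenerator.gen .dc * KdRGenerator.gen .dc) (by simp [KdRGenerator.relators])
  · exact key (KdRGenerator.gen .d * KdRGenerator.gen .dc) (by simp [KdRGenerator.relators])

/-- Submodules of the even and the odd part of a presented Lie superalgebra that contain the
generators and are closed under the supercommutator are everything. -/
theorem presented_eq_top {k : Type*} [CommRing k] {X : Type*} (par : X → ZMod 2)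
    (rels : Set (FreeNonUnitalNonAssocAlgebra k X))
    (V₀ : Submodule k (quotPart par rels 0)) (V₁ : Submodule k (quotPart par rels 1))
    (hee : ∀ a ∈ V₀, ∀ b ∈ V₀, partBracket par rels 0 0 0 rfl a b ∈ V₀)
    (heo : ∀ a ∈ V₀, ∀ x ∈ V₁, partBracket par rels 0 1 1 rfl a x ∈ V₁)
    (hoo : ∀ x ∈ V₁, ∀ y ∈ V₁, partBracket par rels 1 1 0 rfl x y ∈ V₀)
    (hg₀ : ∀ x, par x = 0 → Submodule.Quotient.mk (FreeNonUnitalNonAssocAlgebra.of k x) ∈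
      V₀.map (quotPart par rels 0).subtype)
    (hg₁ : ∀ x, par x = 1 → Submodule.Quotient.mk (FreeNonUnitalNonAssocAlgebra.of k x) ∈
      V₁.map (quotPart par rels 1).subtype) : V₀ = ⊤ ∧ V₁ = ⊤ := by
  have par_cases : ∀ i : ZMod 2, i = 0 ∨ i = 1 := by decide
  -- Induction on formal iterated brackets. In the odd-even case the bracket is first reversed by
  -- skew-symmetry, as only the even-odd bracket is among the closure hypotheses.
  have key : ∀ m : FreeMagma X,
      (parity par m = 0 → (Submodule.Quotient.mk (mono k m) : _ ⧸ relIdeal par rels) ∈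
        V₀.map (quotPart par rels 0).subtype) ∧
      (parity par m = 1 → (Submodule.Quotient.mk (mono k m) : _ ⧸ relIdeal par rels) ∈
        V₁.map (quotPart par rels 1).subtype) := by
    intro m
    induction m with
    | ih1 x => exact ⟨hg₀ x, hg₁ x⟩
    | ih2 a b ha hb =>
      have hm : (Submodule.Quotient.mk (mono k (a * b)) : _ ⧸ relIdeal par rels) =
          quotBracket par rels (Submodule.Quotient.mk (mono k a))
            (Submodule.Quotient.mk (mono k b)) := by rw [quotBracket_mk, mono_mul]
      have hp : parity par (a * b) = parity par a + parity par b := rfl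
      rw [hm, hp]
      rcases par_cases (parity par a) with pa | pa <;> rcases par_cases (parity par b) with pb | pb
      · obtain ⟨u, hu, hu'⟩ := ha.1 pa
        obtain ⟨v, hv, hv'⟩ := hb.1 pb
        rw [pa, pb, ← hu', ← hv']
        exact ⟨fun _ => ⟨_, hee u hu v hv, rfl⟩, fun h => absurd h (by decide)⟩
      · obtain ⟨u, hu, hu'⟩ := ha.1 pa
        obtain ⟨v, hv, hv'⟩ := hb.2 pb
        rw [pa, pb, ← hu', ← hv']
        exact ⟨fun h => absurd h (by decide), fun _ => ⟨_, heo u hu v hv, rfl⟩⟩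
      · obtain ⟨u, hu, hu'⟩ := ha.2 pa
        obtain ⟨v, hv, hv'⟩ := hb.1 pb
        rw [pa, pb, ← hu', ← hv']
        refine ⟨fun h => absurd h (by decide), fun _ => ?_⟩
        rw [Submodule.subtype_apply, Submodule.subtype_apply, quotBracket_skew par rels u.2 v.2]
        simp only [koszul, zero_ne_one, and_false, if_false, one_smul]
        exact neg_mem ⟨_, heo v hv u hu, rfl⟩
      · obtain ⟨u, hu, hu'⟩ := ha.2 pa
        obtain ⟨v, hv, hv'⟩ := hb.2 pb
        rw [pa, pb, ← hu', ← hv']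
        exact ⟨fun _ => ⟨_, hoo u hu v hv, rfl⟩, fun h => absurd h (by decide)⟩
  have span_le : ∀ i (V : Submodule k (quotPart par rels i)),
      (∀ m, parity par m = i → (Submodule.Quotient.mk (mono k m) : _ ⧸ relIdeal par rels) ∈
        V.map (quotPart par rels i).subtype) → V = ⊤ := by
    intro i V h
    rw [eq_top_iff]
    rintro ⟨u, hu⟩ -
    have : u ∈ V.map (quotPart par rels i).subtype := by
      refine Submodule.span_le.2 ?_ hu
      rintro _ ⟨m, hm, rfl⟩
      exact h m hm
    obtain ⟨v, hv, rfl⟩ := this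
    exact hv
  exact ⟨span_le 0 V₀ fun m => (key m).1, span_le 1 V₁ fun m => (key m).2⟩

/-- The presented algebra has dimension at most 4|4. That it is not smaller is only seen later, by
mapping it onto an algebra with non-zero Laplacian. -/
theorem kahlerDeRham_span :
    Submodule.span ℂ (Set.range (IsKdR.evenFamily kahlerDeRham (kdrGen .L 0 rfl)
      (kdrGen .Lam 0 rfl) (kdrGen .H 0 rfl) (kdrGen .d 1 rfl) (kdrGen .dc 1 rfl))) = ⊤ ∧
    Submodule.span ℂ (Set.range (IsKdR.oddFamily kahlerDeRham (kdrGen .Lam 0 rfl)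
      (kdrGen .d 1 rfl) (kdrGen .dc 1 rfl))) = ⊤ := by
  have H := isKdR_kahlerDeRham
  have hv := fun i => Submodule.subset_span (R := ℂ) (Set.mem_range_self
    (f := IsKdR.evenFamily kahlerDeRham (kdrGen .L 0 rfl)
      (kdrGen .Lam 0 rfl) (kdrGen .H 0 rfl) (kdrGen .d 1 rfl) (kdrGen .dc 1 rfl)) i)
  have hw := fun i => Submodule.subset_span (R := ℂ) (Set.mem_range_self
    (f := IsKdR.oddFamily kahlerDeRham (kdrGen .Lam 0 rfl) (kdrGen .d 1 rfl) (kdrGen .dc 1 rfl)) i)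
  refine presented_eq_top _ _ _ _ (fun a ha b hb => H.ee_mem ha hb)
    (fun a ha x hx => H.eo_mem ha hx) (fun x hx y hy => H.oo_mem hx hy) ?_ ?_
  · rintro (_ | _ | _ | _ | _) hx
    · exact ⟨_, hv 0, rfl⟩
    · exact ⟨_, hv 1, rfl⟩
    · exact ⟨_, hv 2, rfl⟩
    all_goals exact absurd hx (by decide)
  · rintro (_ | _ | _ | _ | _) hx
    iterate 3 exact absurd hx (by decide)
    · exact ⟨_, hw 0, rfl⟩
    · exact ⟨_, hw 1, rfl⟩

/-- A Lie superalgebra spanned by elements satisfying the relations of the Kähler-de Rham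
superalgebra, with non-zero Laplacian, is isomorphic to it. -/
theorem IsKdR.nonempty_iso {A : LieSuperalgebra ℂ} {l m h : A.Even} {d c : A.Odd}
    (H : A.IsKdR l m h d c) (hΔ : A.oo d (A.eo m c) ≠ 0)
    (h₀ : Submodule.span ℂ (Set.range (evenFamily A l m h d c)) = ⊤)
    (h₁ : Submodule.span ℂ (Set.range (oddFamily A m d c)) = ⊤) :
    Nonempty (Iso A kahlerDeRham) := by
  let g : KdRGenerator → A.Even × A.Odd
    | .L => (l, 0)
    | .Lam => (m, 0)
    | .H => (h, 0)
    | .d => (0, d)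
    | .dc => (0, c)
  have hg : ∀ x, A.IsHomogeneous (g x) x.parity := by
    rintro (_ | _ | _ | _ | _) <;> simp [g, IsHomogeneous, KdRGenerator.parity]
  have hr : ∀ r ∈ KdRGenerator.relators, A.evalFree g r = 0 := by
    have e : ∀ x : KdRGenerator, A.evalFree g x.gen = g x := A.evalFree_of g
    intro r hr
    simp only [KdRGenerator.relators, Set.mem_insert_iff, Set.mem_singleton_iff] at hr
    rcases hr with rfl | rfl | rfl | rfl | rfl | rfl | rfl | rfl | rfl | rfl | rfl | rfl <;>
      simp [evalFree_mul, e, g, H.lm, H.hl, H.hm, H.hd, H.hc, H.ld, H.lc, H.mmd, H.mmc, H.dd,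
        H.cc, H.dc]
  -- The homomorphism given by the universal property goes from the presented algebra to A; the
  -- required isomorphism is its inverse.
  let Ψ : (FreeNonUnitalNonAssocAlgebra ℂ KdRGenerator ⧸
      relIdeal KdRGenerator.parity KdRGenerator.relators) →ₗ[ℂ] A.Even × A.Odd :=
    (relIdeal KdRGenerator.parity KdRGenerator.relators).liftQ (A.evalFree g)
      (A.relIdeal_le_ker_evalFree hg hr)
  have hΨ : ∀ u v, Ψ (quotBracket _ _ u v) = A.bracket (Ψ u) (Ψ v) := by
    intro u v
    obtain ⟨u, rfl⟩ := Submodule.Quotient.mk_surjective _ u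
    obtain ⟨v, rfl⟩ := Submodule.Quotient.mk_surjective _ v
    rw [quotBracket_mk]
    exact A.evalFree_mul g u v
  have hpart : ∀ i, ∀ u ∈ quotPart KdRGenerator.parity KdRGenerator.relators i,
      A.IsHomogeneous (Ψ u) i := by
    intro i u hu
    have hi : ∀ i : ZMod 2, i = 0 ∨ i = 1 := by decide
    replace hi := hi i
    rcases hi with rfl | rfl
    · refine Or.inl ⟨rfl, ?_⟩
      refine Submodule.span_induction ?_ ?_ ?_ ?_ hu
      · rintro _ ⟨m, hm, rfl⟩
        have := A.isHomogeneous_evalMagma hg m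
        rw [hm] at this
        rcases this with ⟨-, h⟩ | ⟨h, -⟩
        · rw [← A.evalFree_mono] at h; exact h
        · exact absurd h (by decide)
      · simp
      · intro x y _ _ hx hy; simp [hx, hy]
      · intro r x _ hx; simp [hx]
    · refine Or.inr ⟨rfl, ?_⟩
      refine Submodule.span_induction ?_ ?_ ?_ ?_ hu
      · rintro _ ⟨m, hm, rfl⟩
        have := A.isHomogeneous_evalMagma hg m
        rw [hm] at this
        rcases this with ⟨h, -⟩ | ⟨-, h⟩
        · exact absurd h (by decide)
        · rw [← A.evalFree_mono] at h; exact h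
      · simp
      · intro x y _ _ hx hy; simp [hx, hy]
      · intro r x _ hx; simp [hx]
  let Ψ₀ : kahlerDeRham.Even →ₗ[ℂ] A.Even := LinearMap.fst ℂ _ _ ∘ₗ Ψ ∘ₗ
    (quotPart KdRGenerator.parity KdRGenerator.relators 0).subtype
  let Ψ₁ : kahlerDeRham.Odd →ₗ[ℂ] A.Odd := LinearMap.snd ℂ _ _ ∘ₗ Ψ ∘ₗ
    (quotPart KdRGenerator.parity KdRGenerator.relators 1).subtype
  have e₀ : ∀ u : kahlerDeRham.Even, Ψ u.1 = (Ψ₀ u, 0) := fun u => by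
    rcases hpart 0 u.1 u.2 with ⟨-, h⟩ | ⟨h, -⟩
    · exact Prod.ext rfl h
    · exact absurd h (by decide)
  have e₁ : ∀ u : kahlerDeRham.Odd, Ψ u.1 = (0, Ψ₁ u) := fun u => by
    rcases hpart 1 u.1 u.2 with ⟨h, -⟩ | ⟨-, h⟩
    · exact absurd h (by decide)
    · exact Prod.ext h rfl
  have mee : ∀ a b, Ψ₀ (kahlerDeRham.ee a b) = A.ee (Ψ₀ a) (Ψ₀ b) := fun a b => by
    have := hΨ a.1 b.1
    rw [e₀, e₀] at this
    exact (congrArg Prod.fst this).trans (by simp)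
  have meo : ∀ a x, Ψ₁ (kahlerDeRham.eo a x) = A.eo (Ψ₀ a) (Ψ₁ x) := fun a x => by
    have := hΨ a.1 x.1
    rw [e₀, e₁] at this
    exact (congrArg Prod.snd this).trans (by simp)
  have moo : ∀ x y, Ψ₀ (kahlerDeRham.oo x y) = A.oo (Ψ₁ x) (Ψ₁ y) := fun x y => by
    have := hΨ x.1 y.1
    rw [e₁, e₁] at this
    exact (congrArg Prod.fst this).trans (by simp)
  have gl : Ψ₀ (kdrGen .L 0 rfl) = l := congrArg Prod.fst (A.evalFree_of g .L)
  have gm : Ψ₀ (kdrGen .Lam 0 rfl) = m := congrArg Prod.fst (A.evalFree_of g .Lam)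
  have gh : Ψ₀ (kdrGen .H 0 rfl) = h := congrArg Prod.fst (A.evalFree_of g .H)
  have gd : Ψ₁ (kdrGen .d 1 rfl) = d := congrArg Prod.snd (A.evalFree_of g .d)
  have gc : Ψ₁ (kdrGen .dc 1 rfl) = c := congrArg Prod.snd (A.evalFree_of g .dc)
  -- A linear map sending a spanning family to a linearly independent spanning family is bijective;
  -- in particular the source family is then independent too.
  have bij : ∀ {P Q : Type _} [AddCommGroup P] [AddCommGroup Q] [Module ℂ P] [Module ℂ Q]
      (f : P →ₗ[ℂ] Q) (p : Fin 4 → P) (q : Fin 4 → Q), (∀ i, f (p i) = q i) →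
      Submodule.span ℂ (Set.range p) = ⊤ → Submodule.span ℂ (Set.range q) = ⊤ →
      Function.Injective (Fintype.linearCombination ℂ q) → Function.Bijective f := by
    intro P Q _ _ _ _ f p q hpq hp hq hinj
    have hcomp : ∀ w, f (Fintype.linearCombination ℂ p w) = Fintype.linearCombination ℂ q w := by
      intro w; simp [Fintype.linearCombination_apply, hpq]
    rw [← Fintype.range_linearCombination, LinearMap.range_eq_top] at hp hq
    refine ⟨?_, fun y => ?_⟩
    · intro x y hxy
      obtain ⟨v, rfl⟩ := hp x
      obtain ⟨w, rfl⟩ := hp y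
      rw [hcomp, hcomp] at hxy
      rw [hinj hxy]
    · obtain ⟨w, rfl⟩ := hq y
      exact ⟨_, hcomp w⟩
  have b₀ : Function.Bijective Ψ₀ := by
    refine bij Ψ₀ _ _ ?_ kahlerDeRham_span.1 h₀ (H.evenFamily_injective hΔ)
    intro i
    fin_cases i
    · exact gl
    · exact gm
    · exact gh
    · exact (moo _ _).trans (by erw [meo, gm, gd, gc]; rfl)
  have b₁ : Function.Bijective Ψ₁ := by
    refine bij Ψ₁ _ _ ?_ kahlerDeRham_span.2 h₁ (H.oddFamily_injective hΔ)
    intro i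
    fin_cases i
    · exact gd
    · exact gc
    · exact (meo _ _).trans (by rw [gm, gd]; rfl)
    · exact (meo _ _).trans (by rw [gm, gc]; rfl)
  let f₀ := LinearEquiv.ofBijective Ψ₀ b₀
  let f₁ := LinearEquiv.ofBijective Ψ₁ b₁
  refine ⟨⟨f₀.symm, f₁.symm, fun a b => ?_, fun a x => ?_, fun x y => ?_⟩⟩
  · rw [LinearEquiv.symm_apply_eq]
    refine Eq.trans ?_ (mee _ _).symm
    exact congrArg₂ (fun a b => A.ee a b) (f₀.apply_symm_apply a).symm (f₀.apply_symm_apply b).symm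
  · rw [LinearEquiv.symm_apply_eq]
    refine Eq.trans ?_ (meo _ _).symm
    exact congrArg₂ (fun a b => A.eo a b) (f₀.apply_symm_apply a).symm (f₁.apply_symm_apply x).symm
  · rw [LinearEquiv.symm_apply_eq]
    refine Eq.trans ?_ (moo _ _).symm
    exact congrArg₂ (fun a b => A.oo a b) (f₁.apply_symm_apply x).symm (f₁.apply_symm_apply y).symm

/-- Operators satisfying the relations of the Kähler-de Rham superalgebra, with non-zero Laplacian,
generate it. -/
theorem nonempty_iso_generated {B : Type*} [Ring B] [Algebra ℂ B] {l m d c : B}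
    (hl : (l * m - m * l) * l - l * (l * m - m * l) = (2 : ℂ) • l)
    (hm : (l * m - m * l) * m - m * (l * m - m * l) = -((2 : ℂ) • m))
    (hd : (l * m - m * l) * d - d * (l * m - m * l) = d)
    (hc : (l * m - m * l) * c - c * (l * m - m * l) = c)
    (ld : l * d - d * l = 0) (lc : l * c - c * l = 0)
    (mmd : m * (m * d - d * m) - (m * d - d * m) * m = 0)
    (mmc : m * (m * c - c * m) - (m * c - c * m) * m = 0)
    (dd : d * d = 0) (cc : c * c = 0) (dc : d * c + c * d = 0)
    (hΔ : d * (m * c - c * m) + (m * c - c * m) * d ≠ 0) :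
    Nonempty (Iso (generated ℂ {l, m, l * m - m * l} {d, c}) kahlerDeRham) := by
  let A : LieSuperalgebra ℂ := generated ℂ {l, m, l * m - m * l} {d, c}
  have mem₀ : ∀ a ∈ ({l, m, l * m - m * l} : Set B),
      a ∈ genEven ℂ {l, m, l * m - m * l} {d, c} := fun a ha =>
    Submodule.mem_sInf.2 fun S ⟨_, _, h, _⟩ => h ha
  have mem₁ : ∀ a ∈ ({d, c} : Set B), a ∈ genOdd ℂ {l, m, l * m - m * l} {d, c} := fun a ha =>
    Submodule.mem_sInf.2 fun S ⟨_, _, _, h⟩ => h ha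
  let l' : A.Even := ⟨l, mem₀ l (by simp)⟩
  let m' : A.Even := ⟨m, mem₀ m (by simp)⟩
  let h' : A.Even := ⟨l * m - m * l, mem₀ _ (by simp)⟩
  let d' : A.Odd := ⟨d, mem₁ d (by simp)⟩
  let c' : A.Odd := ⟨c, mem₁ c (by simp)⟩
  have H : A.IsKdR l' m' h' d' c' := by
    constructor <;> refine Subtype.ext ?_
    · rfl
    · exact hl
    · exact hm
    · exact hd
    · exact hc
    · exact ld
    · exact lc
    · exact mmd
    · exact mmc
    · exact (congrArg₂ (· + ·) dd dd).trans (add_zero _)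
    · exact (congrArg₂ (· + ·) cc cc).trans (add_zero _)
    · exact dc
  refine H.nonempty_iso (fun h => hΔ (congrArg Subtype.val h)) ?_ ?_
  all_goals
    let V₀ := Submodule.span ℂ (Set.range (IsKdR.evenFamily A l' m' h' d' c'))
    let V₁ := Submodule.span ℂ (Set.range (IsKdR.oddFamily A m' d' c'))
    let W₀ := V₀.map (genEven ℂ {l, m, l * m - m * l} {d, c}).subtype
    let W₁ := V₁.map (genOdd ℂ {l, m, l * m - m * l} {d, c}).subtype
    -- The spans form a closed pair containing the generators, so by minimality they contain all of
    -- `genEven` and `genOdd`.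
    have closed : IsSuperClosed W₀ W₁ := by
      refine ⟨?_, ?_, ?_⟩
      · rintro _ ⟨a, ha, rfl⟩ _ ⟨b, hb, rfl⟩
        exact ⟨_, H.ee_mem ha hb, rfl⟩
      · rintro _ ⟨a, ha, rfl⟩ _ ⟨b, hb, rfl⟩
        exact ⟨_, H.eo_mem ha hb, rfl⟩
      · rintro _ ⟨a, ha, rfl⟩ _ ⟨b, hb, rfl⟩
        exact ⟨_, H.oo_mem ha hb, rfl⟩
    have hv := fun i => Submodule.subset_span (R := ℂ)
      (Set.mem_range_self (f := IsKdR.evenFamily A l' m' h' d' c') i)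
    have hw := fun i => Submodule.subset_span (R := ℂ)
      (Set.mem_range_self (f := IsKdR.oddFamily A m' d' c') i)
    have g₀ : ({l, m, l * m - m * l} : Set B) ⊆ W₀ := by
      rintro _ (rfl | rfl | rfl)
      · exact ⟨l', hv 0, rfl⟩
      · exact ⟨m', hv 1, rfl⟩
      · exact ⟨h', hv 2, rfl⟩
    have g₁ : ({d, c} : Set B) ⊆ W₁ := by
      rintro _ (rfl | rfl)
      · exact ⟨d', hw 0, rfl⟩
      · exact ⟨c', hw 1, rfl⟩
    rw [eq_top_iff]
    rintro ⟨a, ha⟩ -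
  · obtain ⟨b, hb, rfl⟩ := (Submodule.mem_sInf.1 ha) W₀ ⟨W₁, closed, g₀, g₁⟩
    exact hb
  · obtain ⟨b, hb, rfl⟩ := (Submodule.mem_sInf.1 ha) W₁ ⟨W₀, closed, g₀, g₁⟩
    exact hb

end KahlerDeRham
end LieSuperalgebra
end HKT
end

/-! ### Representations of sl(2) with nilpotent lowering operator -/

noncomputable section

namespace HKT

/-- A highest weight vector of weight `1`, for the adjoint action of an `sl(2)`-triple with nilpotent
lowering operator, generates a two-dimensional representation. -/
theorem lie_lie_eq_zero_of_isNilpotent {B : Type*} [Ring B] [Algebra ℂ B] {l m x : B}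
    (hl : (l * m - m * l) * l - l * (l * m - m * l) = (2 : ℂ) • l)
    (hm : (l * m - m * l) * m - m * (l * m - m * l) = -((2 : ℂ) • m))
    (hx : (l * m - m * l) * x - x * (l * m - m * l) = x)
    (lx : l * x - x * l = 0) (hn : IsNilpotent m) :
    m * (m * x - x * m) - (m * x - x * m) * m = 0 := by
  let _ : LieRing B := LieRing.ofAssociativeRing
  by_cases x0 : x = 0
  · simp [x0]
  -- An sl(2)-triple is required to have h ≠ 0, which holds as x is a non-zero eigenvector of ad h
  -- with eigenvalue 1; the case x = 0 was split off for this reason.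
  have h0 : l * m - m * l ≠ 0 := by
    intro h
    rw [h, zero_mul, mul_zero, sub_zero] at hx
    exact x0 hx.symm
  have t : IsSl2Triple (l * m - m * l) l m := by
    refine ⟨h0, rfl, ?_, ?_⟩
    · rw [Ring.lie_def, hl, two_smul, two_nsmul]
    · rw [Ring.lie_def, hm, two_smul, two_nsmul]
  have P : t.HasPrimitiveVectorWith x (1 : ℂ) := by
    refine ⟨x0, ?_, ?_⟩
    · rw [Ring.lie_def, hx, one_smul]
    · rw [Ring.lie_def, lx]
  obtain ⟨N, hN⟩ := LieAlgebra.ad_nilpotent_of_nilpotent (R := ℂ) hn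
  -- For highest weight 1, raising the (n+1)-st lowered vector gives (n+1)(1-n) times the n-th one.
  -- This factor is non-zero for n ≥ 2, so vanishing propagates down from a large power, supplied by
  -- nilpotency of ad m, to the second power.
  have key : ∀ n, 2 ≤ n → (LieModule.toEnd ℂ B B m ^ (n + 1)) x = 0 →
      (LieModule.toEnd ℂ B B m ^ n) x = 0 := by
    intro n hn h
    have := P.lie_e_pow_succ_toEnd_f n
    rw [h, lie_zero] at this
    refine (smul_eq_zero.1 this.symm).resolve_left ?_
    refine mul_ne_zero (by exact_mod_cast n.succ_ne_zero) (sub_ne_zero.2 ?_)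
    exact_mod_cast (show 1 ≠ n by omega)
  have down : ∀ j, (LieModule.toEnd ℂ B B m ^ (2 + j)) x = 0 →
      (LieModule.toEnd ℂ B B m ^ 2) x = 0 := by
    intro j
    induction j with
    | zero => exact id
    | succ j ih => exact fun h => ih (key _ (by omega) h)
  have h2 := down N (by rw [pow_add, show LieModule.toEnd ℂ B B m ^ N = 0 from hN]; simp)
  rw [pow_two] at h2
  exact h2

end HKT
end

noncomputable section

namespace HKT

/-! ## The exterior algebra: operators on complex-valued forms of all degrees -/

section ExteriorOperators

/-- Complex-valued alternating forms of all degrees. -/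
def AltForm (E : Type*) [NormedAddCommGroup E] [NormedSpace ℝ E] : Type _ :=
  ∀ k : ℕ, E [⋀^Fin k]→L[ℝ] ℂ

variable {E : Type*} [NormedAddCommGroup E] [NormedSpace ℝ E]

instance : AddCommGroup (AltForm E) := inferInstanceAs (AddCommGroup (∀ k : ℕ, E [⋀^Fin k]→L[ℝ] ℂ))

instance : Module ℂ (AltForm E) := inferInstanceAs (Module ℂ (∀ k : ℕ, E [⋀^Fin k]→L[ℝ] ℂ))

namespace AltForm

@[simp] theorem add_apply (η ζ : AltForm E) (k : ℕ) : (η + ζ) k = η k + ζ k := rfl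
@[simp] theorem sub_apply (η ζ : AltForm E) (k : ℕ) : (η - ζ) k = η k - ζ k := rfl
@[simp] theorem neg_apply (η : AltForm E) (k : ℕ) : (-η) k = -η k := rfl
@[simp] theorem zero_apply (k : ℕ) : (0 : AltForm E) k = 0 := rfl
@[simp] theorem smul_apply (c : ℂ) (η : AltForm E) (k : ℕ) : (c • η) k = c • η k := rfl

theorem sum_apply {ι : Type*} (s : Finset ι) (η : ι → AltForm E) (k : ℕ) :
    (∑ i ∈ s, η i) k = ∑ i ∈ s, η i k := Finset.sum_apply k s η

@[ext] theorem ext' {η ζ : AltForm E} (h : ∀ k v, η k v = ζ k v) : η = ζ :=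
  funext fun k => ContinuousAlternatingMap.ext (h k)

end AltForm

/-- Contraction with a vector, on forms of a fixed degree. -/
def contrCLM (v : E) (k : ℕ) : (E [⋀^Fin (k + 1)]→L[ℝ] ℂ) →L[ℝ] (E [⋀^Fin k]→L[ℝ] ℂ) :=
  (ContinuousLinearMap.apply ℝ _ v).comp
    (ContinuousAlternatingMap.curryLeftLI (𝕜 := ℝ) (E := E) (F := ℂ)
      (n := k)).toContinuousLinearMap

@[simp]
theorem contrCLM_apply (v : E) (k : ℕ) (α : E [⋀^Fin (k + 1)]→L[ℝ] ℂ) (w : Fin k → E) :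
    contrCLM v k α w = α (Fin.cons v w) := rfl

/-- Exterior multiplication by a covector, on forms of a fixed degree. -/
def extMulCLM (a : E →L[ℝ] ℝ) (k : ℕ) : (E [⋀^Fin k]→L[ℝ] ℂ) →L[ℝ] (E [⋀^Fin (k + 1)]→L[ℝ] ℂ) :=
  (ContinuousAlternatingMap.alternatizeUncurryFinCLM ℝ E ℂ).comp
    (ContinuousLinearMap.smulRightL ℝ E _ a)

theorem extMulCLM_apply (a : E →L[ℝ] ℝ) (k : ℕ) (α : E [⋀^Fin k]→L[ℝ] ℂ) (w : Fin (k + 1) → E) :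
    extMulCLM a k α w = ∑ i, (-1) ^ i.val • (a (w i) • α (i.removeNth w)) := by
  simp [extMulCLM, ContinuousAlternatingMap.alternatizeUncurryFinCLM_apply,
    ContinuousAlternatingMap.alternatizeUncurryFin_apply]

/-- Contraction with a vector. -/
def contr (v : E) : Module.End ℂ (AltForm E) where
  toFun η k := contrCLM v k (η (k + 1))
  map_add' _ _ := rfl
  map_smul' _ _ := rfl

theorem contr_apply (v : E) (η : AltForm E) (k : ℕ) :
    contr v η k = contrCLM v k (η (k + 1)) := rfl

theorem extMulCLM_smul (a : E →L[ℝ] ℝ) (k : ℕ) (c : ℂ) (α : E [⋀^Fin k]→L[ℝ] ℂ) :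
    extMulCLM a k (c • α) = c • extMulCLM a k α := by
  ext w
  simp only [extMulCLM_apply, ContinuousAlternatingMap.smul_apply, Finset.smul_sum]
  exact Finset.sum_congr rfl fun i _ => by rw [smul_comm c, smul_comm c]

/-- Exterior multiplication by a covector, as a map. -/
def extMulFun (a : E →L[ℝ] ℝ) (η : AltForm E) : AltForm E
  | 0 => 0
  | k + 1 => extMulCLM a k (η k)

/-- Exterior multiplication by a covector. -/
def extMul (a : E →L[ℝ] ℝ) : Module.End ℂ (AltForm E) where
  toFun := extMulFun a
  map_add' η ζ := by
    funext k
    cases k with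
    | zero => exact (add_zero (0 : E [⋀^Fin 0]→L[ℝ] ℂ)).symm
    | succ k => exact map_add (extMulCLM a k) _ _
  map_smul' c η := by
    funext k
    cases k with
    | zero => exact (smul_zero (A := E [⋀^Fin 0]→L[ℝ] ℂ) c).symm
    | succ k => exact extMulCLM_smul a k c (η k)

@[simp] theorem extMul_zero_degree (a : E →L[ℝ] ℝ) (η : AltForm E) : extMul a η 0 = 0 := rfl

theorem extMul_succ (a : E →L[ℝ] ℝ) (η : AltForm E) (k : ℕ) :
    extMul a η (k + 1) = extMulCLM a k (η k) := rfl

theorem contr_add (v w : E) : contr (v + w) = contr v + contr w := by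
  ext η k u
  simp [contr_apply, contrCLM, -contrCLM_apply]

theorem contr_smul (r : ℝ) (v : E) : contr (r • v) = (r : ℂ) • contr v := by
  refine LinearMap.ext fun η => funext fun k => ContinuousAlternatingMap.ext fun u => ?_
  refine Eq.trans ?_ (Complex.real_smul (x := r) (z := contr v η k u))
  simp [contr_apply, contrCLM, -contrCLM_apply]

theorem contr_zero : contr (0 : E) = 0 := by
  simpa using contr_smul 0 (0 : E)

theorem contr_sub (v w : E) : contr (v - w) = contr v - contr w := by
  ext η k u
  simp [contr_apply, contrCLM, -contrCLM_apply]

theorem contr_sum {ι : Type*} (s : Finset ι) (v : ι → E) :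
    contr (∑ i ∈ s, v i) = ∑ i ∈ s, contr (v i) := by
  classical
  induction s using Finset.induction_on with
  | empty => simp [contr_zero]
  | insert i s hi ih => rw [Finset.sum_insert hi, Finset.sum_insert hi, contr_add, ih]

theorem extMul_add (a b : E →L[ℝ] ℝ) : extMul (a + b) = extMul a + extMul b := by
  refine LinearMap.ext fun η => funext fun k => ?_
  cases k with
  | zero => exact (add_zero (0 : E [⋀^Fin 0]→L[ℝ] ℂ)).symm
  | succ k =>
    ext w
    simp [extMul_succ, extMulCLM]

theorem extMul_smul (r : ℝ) (a : E →L[ℝ] ℝ) : extMul (r • a) = (r : ℂ) • extMul a := by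
  refine LinearMap.ext fun η => funext fun k => ?_
  cases k with
  | zero => exact (smul_zero (A := E [⋀^Fin 0]→L[ℝ] ℂ) (r : ℂ)).symm
  | succ k =>
    refine ContinuousAlternatingMap.ext fun u => ?_
    refine Eq.trans ?_ (Complex.real_smul (x := r) (z := extMul a η (k + 1) u))
    simp [extMul_succ, extMulCLM]

theorem extMul_zero : extMul (0 : E →L[ℝ] ℝ) = 0 := by
  simpa using extMul_smul 0 (0 : E →L[ℝ] ℝ)

theorem extMul_sum {ι : Type*} (s : Finset ι) (a : ι → E →L[ℝ] ℝ) :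
    extMul (∑ i ∈ s, a i) = ∑ i ∈ s, extMul (a i) := by
  classical
  induction s using Finset.induction_on with
  | empty => simp [extMul_zero]
  | insert i s hi ih => rw [Finset.sum_insert hi, Finset.sum_insert hi, extMul_add, ih]

/-- The canonical anticommutation relation. -/
theorem contr_extMul (v : E) (a : E →L[ℝ] ℝ) :
    contr v * extMul a + extMul a * contr v = (a v : ℂ) • 1 := by
  ext η k w
  simp only [LinearMap.add_apply, Module.End.mul_apply, AltForm.add_apply, contr_apply,
    extMul_succ, LinearMap.smul_apply, Module.End.one_apply, AltForm.smul_apply,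
    ContinuousAlternatingMap.add_apply, ContinuousAlternatingMap.smul_apply, contrCLM_apply,
    extMulCLM_apply, Fin.sum_univ_succ]
  cases k with
  | zero => simp
  | succ k =>
    simp only [extMul_succ, extMulCLM_apply, contr_apply, contrCLM_apply]
    have h : ∀ i : Fin (k + 1), i.succ.removeNth (Fin.cons v w : Fin (k + 2) → E) =
        Fin.cons v (i.removeNth w) := by
      intro i
      funext j
      refine Fin.cases ?_ (fun j => ?_) j <;> simp [Fin.removeNth]
    simp [pow_succ, h]

theorem contr_contr (v w : E) : contr v * contr w = -(contr w * contr v) := by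
  ext η k u
  simp only [Module.End.mul_apply, contr_apply, contrCLM_apply, LinearMap.neg_apply,
    AltForm.neg_apply, ContinuousAlternatingMap.neg_apply]
  have := (η (k + 1 + 1)).map_swap (Fin.cons v (Fin.cons w u)) (i := 0) (j := 1) (by simp)
  refine Eq.trans (congrArg (η (k + 1 + 1)) ?_) this
  funext j
  refine Fin.cases (by simp) (fun j => Fin.cases (by simp) (fun j => ?_) j) j
  rw [Function.comp_apply, Equiv.swap_apply_of_ne_of_ne] <;> simp [Fin.ext_iff]

/-- An operator that commutes or anticommutes with all contractions vanishes as soon as it does not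
produce any scalars. -/
theorem eq_zero_of_contr {X : Module.End ℂ (AltForm E)} (s : ℂ)
    (h : ∀ v, contr v * X = s • (X * contr v)) (h₀ : ∀ η, X η 0 = 0) : X = 0 := by
  have key : ∀ k η, X η k = 0 := by
    intro k
    induction k with
    | zero => exact h₀
    | succ k ih =>
      intro η
      ext w
      -- A value on a non-empty tuple is a value of the contraction with its first vector, which the
      -- hypothesis moves to the right of X, where the induction hypothesis applies.
      rw [← Fin.cons_self_tail w]
      have h₁ := LinearMap.congr_fun (h (w 0)) η
      have h₂ : contrCLM (w 0) k (X η (k + 1)) = 0 := by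
        rw [← contr_apply]
        refine (congrFun h₁ k).trans ?_
        simp only [LinearMap.smul_apply, Module.End.mul_apply, AltForm.smul_apply, ih]
        exact smul_zero (A := E [⋀^Fin k]→L[ℝ] ℂ) s
      simpa using congrArg (fun α => α (Fin.tail w)) h₂
  exact LinearMap.ext fun η => funext fun k => key k η

/-- The derivation of the exterior algebra given by an endomorphism, on forms of a fixed degree. -/
def derCLM (A : E →L[ℝ] E) (k : ℕ) : (E [⋀^Fin k]→L[ℝ] ℂ) →L[ℝ] (E [⋀^Fin k]→L[ℝ] ℂ) :=
  (ContinuousAlternatingMap.fderivCompContinuousLinearMapCLM (𝕜 := ℝ) (ι := Fin k) (G := ℂ)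
    (ContinuousLinearMap.id ℝ E)).flip A

@[simp]
theorem derCLM_apply (A : E →L[ℝ] E) (k : ℕ) (α : E [⋀^Fin k]→L[ℝ] ℂ) (w : Fin k → E) :
    derCLM A k α w = ∑ i, α (Function.update w i (A (w i))) := by
  simp only [derCLM, ContinuousLinearMap.flip_apply,
    ContinuousAlternatingMap.fderivCompContinuousLinearMapCLM_apply,
    ContinuousAlternatingMap.fderivCompContinuousLinearMap_apply]
  refine Finset.sum_congr rfl fun i _ => congrArg α (funext fun j => ?_)
  by_cases h : j = i
  · subst h; simp
  · simp [h]

/-- The derivation `η ↦ ∑ⱼ η(…, A vⱼ, …)` of the exterior algebra given by an endomorphism `A`. -/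
def der (A : E →L[ℝ] E) : Module.End ℂ (AltForm E) where
  toFun η k := derCLM A k (η k)
  map_add' η ζ := funext fun k => map_add (derCLM A k) _ _
  map_smul' c η := funext fun k => by
    refine ContinuousAlternatingMap.ext fun w => ?_
    rw [derCLM_apply]
    refine Eq.trans ?_ (congrArg (c • ·) (derCLM_apply A k (η k) w).symm)
    exact (Finset.smul_sum (r := c)).symm

theorem der_apply (A : E →L[ℝ] E) (η : AltForm E) (k : ℕ) : der A η k = derCLM A k (η k) := rfl

@[simp] theorem der_zero_degree (A : E →L[ℝ] E) (η : AltForm E) : der A η 0 = 0 := by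
  ext w; simp [der_apply]

theorem der_add (A B : E →L[ℝ] E) : der (A + B) = der A + der B := by
  ext η k u
  simp [der_apply, derCLM, -derCLM_apply]

theorem der_smul (r : ℝ) (A : E →L[ℝ] E) : der (r • A) = (r : ℂ) • der A := by
  refine LinearMap.ext fun η => funext fun k => ContinuousAlternatingMap.ext fun u => ?_
  refine Eq.trans ?_ (Complex.real_smul (x := r) (z := der A η k u))
  simp [der_apply, derCLM, -derCLM_apply]

theorem der_zero : der (0 : E →L[ℝ] E) = 0 := by
  simpa using der_smul 0 (0 : E →L[ℝ] E)

theorem der_sub (A B : E →L[ℝ] E) : der (A - B) = der A - der B := by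
  ext η k u
  simp [der_apply, derCLM, -derCLM_apply]

/-- The summand of the derivation in which A hits the inserted vector v is the extra term; the
remaining summands act on the contraction. -/
theorem contr_der (v : E) (A : E →L[ℝ] E) :
    contr v * der A = der A * contr v + contr (A v) := by
  ext η k w
  simp only [Module.End.mul_apply, contr_apply, contrCLM_apply, LinearMap.add_apply,
    AltForm.add_apply, ContinuousAlternatingMap.add_apply, der_apply, derCLM_apply,
    Fin.sum_univ_succ, Fin.cons_zero, Fin.update_cons_zero, Fin.cons_succ, ← Fin.cons_update]
  rw [add_comm]

/-- The difference of both sides anticommutes with contractions and has no component of degree zero,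
so it vanishes by `eq_zero_of_contr`. The later commutation formulas of the exterior algebra are
reduced to contractions in the same way. -/
theorem der_extMul (A : E →L[ℝ] E) (a : E →L[ℝ] ℝ) :
    der A * extMul a = extMul a * der A + extMul (a.comp A) := by
  rw [← sub_eq_zero]
  refine eq_zero_of_contr (-1) (fun v => ?_) (fun η => by simp)
  have h₁ := contr_der v A
  have h₂ := contr_extMul v a
  have h₃ := contr_extMul (A v) a
  have h₄ := contr_extMul v (a.comp A)
  linear_combination (norm := skip) h₁ * extMul a + der A * h₂ - h₂ * der A + h₃ +
    extMul a * h₁ - h₄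
  simp only [ContinuousLinearMap.comp_apply, smul_mul_assoc, mul_smul_comm, one_mul, mul_one,
    neg_smul, one_smul]
  noncomm_ring

theorem extMul_extMul (a b : E →L[ℝ] ℝ) : extMul a * extMul b = -(extMul b * extMul a) := by
  rw [eq_neg_iff_add_eq_zero]
  refine eq_zero_of_contr 1 (fun v => ?_) (fun η => by simp)
  have h₁ := contr_extMul v a
  have h₂ := contr_extMul v b
  linear_combination (norm := skip) h₁ * extMul b - extMul a * h₂ + h₂ * extMul a - extMul b * h₁
  simp only [smul_mul_assoc, mul_smul_comm, one_mul, mul_one, one_smul]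
  noncomm_ring

/-- The order of composition is reversed because endomorphisms of the vector space act
contravariantly on forms. -/
theorem der_der (A B : E →L[ℝ] E) :
    der A * der B = der B * der A + der (B.comp A - A.comp B) := by
  rw [← sub_eq_zero]
  refine eq_zero_of_contr 1 (fun v => ?_) (fun η => by simp)
  have h₁ := contr_der v A
  have h₂ := contr_der v B
  have h₃ := contr_der (A v) B
  have h₄ := contr_der (B v) A
  have h₅ := contr_der v (B.comp A - A.comp B)
  have h₆ : contr ((B.comp A - A.comp B) v) = contr (B (A v)) - contr (A (B v)) := by
    rw [← contr_sub]; rfl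
  linear_combination (norm := skip) h₁ * der B - h₂ * der A + der A * h₂ - der B * h₁ + h₃ - h₄ - h₅ -  h₆
  simp only [one_smul]
  noncomm_ring
end ExteriorOperators
end HKT
end

noncomputable section

namespace HKT

section ExteriorOperators

variable {E : Type*} [NormedAddCommGroup E] [NormedSpace ℝ E]

/-! ### Pullback -/

/-- Pullback of forms by a linear map. -/
def pull (f : E →L[ℝ] E) : Module.End ℂ (AltForm E) where
  toFun η k := (η k).compContinuousLinearMap f
  map_add' _ _ := rfl
  map_smul' _ _ := rfl

theorem pull_apply (f : E →L[ℝ] E) (η : AltForm E) (k : ℕ) :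
    pull f η k = (η k).compContinuousLinearMap f := rfl

theorem pull_mul_pull (f g : E →L[ℝ] E) : pull f * pull g = pull (g.comp f) := rfl

theorem pull_id : pull (ContinuousLinearMap.id ℝ E) = 1 := rfl

theorem contr_pull (v : E) (f : E →L[ℝ] E) : contr v * pull f = pull f * contr (f v) := by
  ext η k w
  simp only [Module.End.mul_apply, contr_apply, contrCLM_apply, pull_apply,
    ContinuousAlternatingMap.compContinuousLinearMap_apply]
  refine congrArg (η (k + 1)) (funext fun j => ?_)
  refine Fin.cases ?_ (fun j => ?_) j <;> simp

theorem pull_extMul (f : E →L[ℝ] E) (a : E →L[ℝ] ℝ) :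
    pull f * extMul a = extMul (a.comp f) * pull f := by
  refine LinearMap.ext fun η => funext fun k => ?_
  cases k with
  | zero => rfl
  | succ k =>
    ext w
    simp only [Module.End.mul_apply, pull_apply, extMul_succ, extMulCLM_apply,
      ContinuousAlternatingMap.compContinuousLinearMap_apply]
    rfl

theorem pull_der {f A A' : E →L[ℝ] E} (h : f.comp A' = A.comp f) :
    pull f * der A = der A' * pull f := by
  ext η k w
  simp only [Module.End.mul_apply, pull_apply, der_apply, derCLM_apply,
    ContinuousAlternatingMap.compContinuousLinearMap_apply]
  refine Finset.sum_congr rfl fun i _ => congrArg (η k) (funext fun j => ?_)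
  by_cases hj : j = i
  · subst hj
    simpa using (DFunLike.congr_fun h (w j)).symm
  · simp [hj]

theorem der_id_apply (η : AltForm E) (k : ℕ) :
    der (ContinuousLinearMap.id ℝ E) η k = (k : ℂ) • η k := by
  ext w
  simp [der_apply]

/-! ### Sums over a basis -/

variable [FiniteDimensional ℝ E] {ι : Type*} (b : Module.Basis ι ℝ E)

/-- The dual basis, consisting of continuous linear functionals. -/
def dual (i : ι) : E →L[ℝ] ℝ := LinearMap.toContinuousLinearMap (b.coord i)

theorem dual_apply (i : ι) (v : E) : dual b i v = b.repr v i := rfl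

variable [Fintype ι]

theorem sum_dual_smul (v : E) : ∑ i, dual b i v • b i = v := b.sum_repr v

theorem sum_dual_comp (a : E →L[ℝ] ℝ) : ∑ i, a (b i) • dual b i = a := by
  ext v
  conv_rhs => rw [← sum_dual_smul b v]
  simp [mul_comm]

theorem sum_dual_contr (v : E) : ∑ i, (dual b i v : ℂ) • contr (b i) = contr v := by
  conv_rhs => rw [← sum_dual_smul b v]
  simp only [contr_sum, contr_smul]

/-- The derivation given by an endomorphism in terms of a basis. -/
theorem der_eq_sum (A : E →L[ℝ] E) : der A = ∑ i, extMul (dual b i) * contr (A (b i)) := by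
  rw [← sub_eq_zero]
  refine eq_zero_of_contr 1 (fun v => ?_) (fun η => ?_)
  · have h : ∀ i, contr v * (extMul (dual b i) * contr (A (b i))) =
        (dual b i v : ℂ) • contr (A (b i)) + extMul (dual b i) * contr (A (b i)) * contr v := by
      intro i
      have h₁ := contr_extMul v (dual b i)
      have h₂ := contr_contr v (A (b i))
      linear_combination (norm := skip) h₁ * contr (A (b i)) - extMul (dual b i) * h₂
      simp only [smul_mul_assoc, one_mul]
      noncomm_ring
    have h₃ : ∑ i, (dual b i v : ℂ) • contr (A (b i)) = contr (A v) := by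
      conv_rhs => rw [← sum_dual_smul b v]
      simp only [map_sum, map_smul, contr_sum, contr_smul]
    rw [mul_sub, contr_der, Finset.mul_sum, Finset.sum_congr rfl fun i _ => h i,
      Finset.sum_add_distrib, h₃, ← Finset.sum_mul, one_smul]
    noncomm_ring
  · simp [AltForm.sum_apply]

/-- The operator depends only on the antisymmetric part of T. This is how symmetry of `nijTensor`,
that is the vanishing of the Nijenhuis tensor, enters the commutation formulas for d. -/
theorem sum_extMul_der_eq_zero (T : E →L[ℝ] E →L[ℝ] E) (hT : ∀ u v, T u v = T v u) :
    ∑ i, extMul (dual b i) * der (T (b i)) = 0 := by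
  refine eq_zero_of_contr (-1) (fun v => ?_) (fun η => by simp [AltForm.sum_apply])
  have h : ∀ i, contr v * (extMul (dual b i) * der (T (b i))) =
      (dual b i v : ℂ) • der (T (b i)) - extMul (dual b i) * contr (T v (b i)) -
        extMul (dual b i) * der (T (b i)) * contr v := by
    intro i
    have h₁ := contr_extMul v (dual b i)
    have h₂ := contr_der v (T (b i))
    rw [hT] at h₂
    linear_combination (norm := skip) h₁ * der (T (b i)) - extMul (dual b i) * h₂
    simp only [smul_mul_assoc, one_mul]
    noncomm_ring
  have h₃ : ∑ i, (dual b i v : ℂ) • der (T (b i)) = der (T v) := by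
    conv_rhs => rw [← sum_dual_smul b v]
    simp only [map_sum, map_smul]
    classical
    induction (Finset.univ : Finset ι) using Finset.induction_on with
    | empty => simp [der_zero]
    | insert i s hi ih => rw [Finset.sum_insert hi, Finset.sum_insert hi, der_add, ih, der_smul]
  rw [Finset.mul_sum, Finset.sum_congr rfl fun i _ => h i, Finset.sum_sub_distrib,
    Finset.sum_sub_distrib, h₃, ← Finset.sum_mul, ← der_eq_sum b (T v), neg_smul, one_smul]
  simp

/-- A sum over the basis dual to `b` of terms depending linearly on `b`, composed with an
endomorphism. -/
theorem sum_extMul_comp (A : E →L[ℝ] E) (X : E → AltForm E)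
    (hX : ∀ v, X v = ∑ i, (dual b i v : ℂ) • X (b i)) :
    ∑ i, extMul ((dual b i).comp A) (X (b i)) = ∑ i, extMul (dual b i) (X (A (b i))) := by
  have h : ∀ i, extMul ((dual b i).comp A) =
      ∑ j, (dual b i (A (b j)) : ℂ) • extMul (dual b j) := by
    intro i
    rw [← sum_dual_comp b ((dual b i).comp A), extMul_sum]
    simp only [extMul_smul]
    rfl
  simp only [h, LinearMap.sum_apply, LinearMap.smul_apply, hX (A _), map_sum, map_smul]
  rw [Finset.sum_comm]

end ExteriorOperators
end HKT
end

noncomputable section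

namespace HKT

/-! ### Weights of a complex structure -/

section Weights

/-- A strictly positive scalar plus a sum of commuting idempotents is injective. -/
theorem eq_zero_of_add_sum_idempotent {V ι : Type*} [AddCommGroup V] [Module ℂ V]
    (Q : ι → Module.End ℂ V) (hQ : ∀ i, Q i * Q i = Q i) (hc : ∀ i j, Q i * Q j = Q j * Q i)
    (s : Finset ι) (n : ℕ) (x : V) (h : ((n : ℂ) + 1) • x + ∑ i ∈ s, Q i x = 0) : x = 0 := by
  classical
  induction s using Finset.induction_on generalizing n x with
  | empty =>
    rw [Finset.sum_empty, add_zero] at h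
    exact (smul_eq_zero.1 h).resolve_left (by exact_mod_cast n.succ_ne_zero)
  | insert j s hj ih =>
    rw [Finset.sum_insert hj] at h
    -- Applying the idempotent to the relation gives the same relation for Q_j x without the index j
    -- and with n + 1 in place of n, so the induction hypothesis kills Q_j x.
    have h₁ : Q j x = 0 := by
      refine ih (n + 1) (Q j x) ?_
      have h₂ := congrArg (Q j) h
      simp only [map_add, map_smul, map_sum, map_zero] at h₂
      rw [← h₂, ← Module.End.mul_apply, hQ]
      have h₃ : ∀ i, Q i (Q j x) = Q j (Q i x) := fun i => LinearMap.congr_fun (hc i j) x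
      simp only [h₃]
      push_cast
      module
    rw [h₁, zero_add] at h
    exact ih n x h

/-- Apply Q_j to the relation: Q_j x plus the sum of the other Q_i (Q_j x) vanishes, and the
preceding lemma with n = 0 applies. -/
theorem eq_zero_of_sum_idempotent {V ι : Type*} [AddCommGroup V] [Module ℂ V] [Fintype ι]
    (Q : ι → Module.End ℂ V) (hQ : ∀ i, Q i * Q i = Q i) (hc : ∀ i j, Q i * Q j = Q j * Q i)
    (x : V) (h : ∑ i, Q i x = 0) (j : ι) : Q j x = 0 := by
  classical
  refine eq_zero_of_add_sum_idempotent Q hQ hc (Finset.univ.erase j) 0 _ ?_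
  have h₁ := congrArg (Q j) h
  rw [← Finset.add_sum_erase _ _ (Finset.mem_univ j)] at h₁
  simp only [map_add, map_sum, map_zero, ← Module.End.mul_apply, hQ] at h₁
  simp only [← Module.End.mul_apply, hc _ j]
  simpa using h₁

variable {E : Type*} [NormedAddCommGroup E] [NormedSpace ℝ E]

/-- Insertion of an endomorphism in one argument of a multilinear map. -/
def slot (I : E →L[ℝ] E) {k : ℕ} (j : Fin k) :
    Module.End ℂ (MultilinearMap ℝ (fun _ : Fin k => E) ℂ) where
  toFun f := f.compLinearMap (Function.update (fun _ => LinearMap.id) j I.toLinearMap)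
  map_add' _ _ := rfl
  map_smul' _ _ := rfl

theorem slot_apply (I : E →L[ℝ] E) {k : ℕ} (j : Fin k)
    (f : MultilinearMap ℝ (fun _ : Fin k => E) ℂ) (w : Fin k → E) :
    slot I j f w = f (Function.update w j (I (w j))) := by
  refine congrArg f (funext fun i => ?_)
  by_cases h : i = j
  · subst h; simp
  · simp [h]

theorem slot_mul_self {I : E →L[ℝ] E} (hI : ∀ v, I (I v) = -v) {k : ℕ} (j : Fin k) :
    slot I j * slot I j = -1 := by
  refine LinearMap.ext fun f => MultilinearMap.ext fun w => ?_
  simp only [Module.End.mul_apply, slot_apply, Function.update_self, Function.update_idem, hI]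
  rw [← neg_one_smul ℝ, f.map_update_smul]
  simp

theorem slot_comm (I : E →L[ℝ] E) {k : ℕ} (i j : Fin k) :
    slot I i * slot I j = slot I j * slot I i := by
  by_cases h : i = j
  · rw [h]
  refine LinearMap.ext fun f => MultilinearMap.ext fun w => ?_
  simp only [Module.End.mul_apply, slot_apply, Function.update_of_ne h,
    Function.update_of_ne (Ne.symm h)]
  rw [Function.update_comm h]

theorem derCLM_of_isHolomorphicType {I : E →L[ℝ] E} {k : ℕ} {α : E [⋀^Fin k]→L[ℝ] ℂ}
    (h : IsHolomorphicType I α) : derCLM I k α = (k * Complex.I) • α := by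
  ext w
  simp only [derCLM_apply, h w, Finset.sum_const, Finset.card_univ, Fintype.card_fin, nsmul_eq_mul,
    ContinuousAlternatingMap.smul_apply, smul_eq_mul, mul_assoc]

/-- The forms of type `(k, 0)` are the `k`-forms of weight `k`. -/
theorem isHolomorphicType_of_derCLM {I : E →L[ℝ] E} (hI : ∀ v, I (I v) = -v) {k : ℕ}
    {α : E [⋀^Fin k]→L[ℝ] ℂ} (h : derCLM I k α = (k * Complex.I) • α) :
    IsHolomorphicType I α := by
  intro w j
  -- Inserting I in a single argument destroys alternation, so the argument takes place among
  -- multilinear maps. The insertions commute and square to -1, so ½(1 + √-1 I_j) are commuting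
  -- idempotents; maximal weight says that their sum kills f, hence each of them does.
  let f : MultilinearMap ℝ (fun _ : Fin k => E) ℂ := α.toMultilinearMap
  let Q : Fin k → Module.End ℂ (MultilinearMap ℝ (fun _ : Fin k => E) ℂ) := fun j =>
    (2⁻¹ : ℂ) • (1 + Complex.I • slot I j)
  have hQ : ∀ j, Q j * Q j = Q j := by
    intro j
    have h₁ := slot_mul_self hI j
    simp only [Q, smul_mul_smul_comm, add_mul, mul_add, one_mul, mul_one, h₁]
    simp only [Complex.I_mul_I]
    module
  have hc : ∀ i j, Q i * Q j = Q j * Q i := by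
    intro i j
    simp only [Q, smul_mul_smul_comm, add_mul, mul_add, one_mul, mul_one, slot_comm I i j]
    module
  have hs : ∑ j, Q j f = 0 := by
    refine MultilinearMap.ext fun w => ?_
    have h₁ := congrArg (fun α => α w) h
    simp only [derCLM_apply, ContinuousAlternatingMap.smul_apply, smul_eq_mul] at h₁
    rw [sum_apply]
    have h₂ : ∀ j, (Q j f) w = 2⁻¹ * (α w + Complex.I * α (Function.update w j (I (w j)))) := by
      intro j
      have h₃ : slot I j f w = α (Function.update w j (I (w j))) := slot_apply I j f w
      rw [← h₃]
      rfl
    simp only [h₂, ← Finset.mul_sum, Finset.sum_add_distrib, h₁]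
    simp only [Finset.sum_const, Finset.card_univ, Fintype.card_fin, nsmul_eq_mul]
    change _ = (0 : ℂ)
    linear_combination 2⁻¹ * (k : ℂ) * α w * Complex.I_mul_I
  have h₁ := congrArg (fun g => g w) (eq_zero_of_sum_idempotent Q hQ hc f hs j)
  have h₂ : (2⁻¹ : ℂ) * (α w + Complex.I * α (Function.update w j (I (w j)))) = 0 := by
    have h₃ : slot I j f w = α (Function.update w j (I (w j))) := slot_apply I j f w
    rw [← h₃]
    exact h₁
  have h₃ := (mul_eq_zero.1 h₂).resolve_left (by norm_num)
  linear_combination (-Complex.I) * h₃ + α (Function.update w j (I (w j))) * Complex.I_mul_I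

theorem rot_zero (I : E →L[ℝ] E) : rot I 0 = ContinuousLinearMap.id ℝ E := by
  simp [rot]

/-- The rotations of a complex structure act on forms of weight `m` through the character of
weight `m`. -/
theorem comp_rot_of_derCLM {I : E →L[ℝ] E} (hI : ∀ v, I (I v) = -v) {k : ℕ}
    {α : E [⋀^Fin k]→L[ℝ] ℂ} {m : ℂ} (h : derCLM I k α = (m * Complex.I) • α) (θ : ℝ) :
    α.compContinuousLinearMap (rot I θ) = Complex.exp (m * θ * Complex.I) • α := by
  ext w
  -- This function is constant: the t-derivative of the rotation is I times the rotation, so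
  -- differentiating the form brings out the derivation by I, which is multiplication by m√-1.
  let f : ℝ → ℂ := fun t => Complex.exp (-(m * t * Complex.I)) * α (fun j => rot I t (w j))
  have hrot : ∀ t, HasDerivAt (fun t => fun j => rot I t (w j)) (fun j => I (rot I t (w j))) t := by
    intro t
    rw [hasDerivAt_pi]
    intro j
    have h₁ := ((Real.hasDerivAt_cos t).smul_const (w j)).add
      ((Real.hasDerivAt_sin t).smul_const (I (w j)))
    refine (h₁.congr_deriv ?_)
    simp only [rot, add_apply, smul_apply, map_add, map_smul,
      hI, ContinuousLinearMap.id_apply]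
    module
  have hα : ∀ t, HasDerivAt (fun t => α (fun j => rot I t (w j)))
      (m * Complex.I * α (fun j => rot I t (w j))) t := by
    intro t
    have h₁ := (α.toContinuousMultilinearMap.hasFDerivAt (fun j => rot I t (w j))).comp_hasDerivAt
      t (hrot t)
    refine h₁.congr_deriv ?_
    rw [ContinuousMultilinearMap.linearDeriv_apply]
    have h₂ := congrArg (fun α => α (fun j => rot I t (w j))) h
    simpa using h₂
  have hf : ∀ t, HasDerivAt f 0 t := by
    intro t
    have h₁ : HasDerivAt (fun t : ℝ => Complex.exp (-(m * t * Complex.I)))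
        (Complex.exp (-(m * t * Complex.I)) * (-(m * Complex.I))) t := by
      refine HasDerivAt.cexp ?_
      have h₂ := ((hasDerivAt_id t).ofReal_comp.const_mul m).mul_const Complex.I
      exact h₂.neg.congr_deriv (by simp)
    refine (h₁.mul (hα t)).congr_deriv ?_
    ring
  have hconst := is_const_of_deriv_eq_zero (fun t => (hf t).differentiableAt)
    (fun t => (hf t).deriv) θ 0
  simp only [f, rot_zero] at hconst
  simp only [ContinuousAlternatingMap.compContinuousLinearMap_apply,
    ContinuousAlternatingMap.smul_apply, smul_eq_mul]
  have h₁ : Complex.exp (m * θ * Complex.I) * Complex.exp (-(m * θ * Complex.I)) = 1 := by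
    rw [← Complex.exp_add, add_neg_cancel, Complex.exp_zero]
  simp at hconst
  rw [← hconst, ← mul_assoc, h₁, one_mul]
  rfl

/-- On a form of weight m the average is a normalised geometric sum of powers of a (2k+1)-st root of
unity of exponent m - (p - q). The bound on this difference excludes its non-zero multiples of 2k+1,
so the sum vanishes unless the weights agree. -/
theorem hodgeComponent_of_derCLM {I : E →L[ℝ] E} (hI : ∀ v, I (I v) = -v) {k : ℕ}
    {α : E [⋀^Fin k]→L[ℝ] ℂ} {m : ℤ} (h : derCLM I k α = (m * Complex.I) • α) (p q : ℕ)
    (hm : |m - (p - q)| < 2 * k + 1) :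
    hodgeComponent I p q α = if m = p - q then α else 0 := by
  have hN : (2 * k + 1 : ℂ) ≠ 0 := by exact_mod_cast (2 * k).succ_ne_zero
  let ζ : ℂ := Complex.exp (2 * Real.pi * Complex.I * ((m - (p - q) : ℤ) / ((2 * k + 1 : ℕ) : ℂ)))
  have hterm : ∀ j : ℕ, Complex.exp (-(((p : ℂ) - q) * (2 * Real.pi * j / (2 * k + 1)) *
      Complex.I)) • α.compContinuousLinearMap (rot I (2 * Real.pi * j / (2 * k + 1))) =
      ζ ^ j • α := by
    intro j
    rw [comp_rot_of_derCLM hI h, smul_smul, ← Complex.exp_add, ← Complex.exp_nat_mul]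
    congr 2
    push_cast
    field_simp
    ring
  rw [hodgeComponent, Finset.sum_congr rfl fun j _ => hterm j, ← Finset.sum_smul]
  split_ifs with hpq
  · have : ζ = 1 := by simp [ζ, hpq]
    simp only [this, one_pow, Finset.sum_const, Finset.card_range, nsmul_eq_mul, mul_one, smul_smul]
    push_cast
    rw [inv_mul_cancel₀ hN, one_smul]
  · have h1 : ζ ≠ 1 := by
      intro h1
      obtain ⟨n, hn⟩ := Complex.exp_eq_one_iff.1 h1
      have hn' : ((m - (p - q) : ℤ) : ℂ) = n * (2 * k + 1 : ℕ) := by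
        have hN' : ((2 * k + 1 : ℕ) : ℂ) ≠ 0 := by exact_mod_cast (2 * k).succ_ne_zero
        rw [mul_comm] at hn
        have h2 := mul_right_cancel₀ Complex.two_pi_I_ne_zero hn
        rwa [div_eq_iff hN'] at h2
      have hn'' : m - (p - q) = n * (2 * k + 1) := by exact_mod_cast hn'
      have hn0 : n ≠ 0 := by
        rintro rfl
        apply hpq
        linarith
      rw [hn'', abs_mul, abs_of_nonneg (show (0 : ℤ) ≤ 2 * k + 1 by positivity)] at hm
      have := Int.one_le_abs hn0
      nlinarith
    have hpow : ζ ^ (2 * k + 1) = 1 := by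
      rw [← Complex.exp_nat_mul, Complex.exp_eq_one_iff]
      refine ⟨m - (p - q), ?_⟩
      push_cast
      field_simp
    rw [geom_sum_eq h1, hpow]
    simp

end Weights
end HKT
end

noncomputable section

namespace HKT

/-! ### Exterior multiplication by a two-form -/

section WedgeTwo

variable {E : Type*}

/-- The alternating sum of a function of several variables. -/
def altSum {n : ℕ} (F : (Fin n → E) → ℂ) (w : Fin n → E) : ℂ :=
  ∑ σ : Equiv.Perm (Fin n), ((Equiv.Perm.sign σ : ℤ) : ℂ) * F (w ∘ σ)

theorem altSum_comp {n : ℕ} (F : (Fin n → E) → ℂ) (τ : Equiv.Perm (Fin n)) (w : Fin n → E) :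
    altSum (fun w => F (w ∘ τ)) w = ((Equiv.Perm.sign τ : ℤ) : ℂ) * altSum F w := by
  rw [altSum, altSum, Finset.mul_sum]
  refine Fintype.sum_equiv (Equiv.mulRight τ) _ _ fun σ => ?_
  have h : ((Equiv.Perm.sign τ : ℤ) : ℂ) * ((Equiv.Perm.sign τ : ℤ) : ℂ) = 1 := by
    rw [← Int.cast_mul, ← Units.val_mul, Int.units_mul_self]; simp
  simp only [Equiv.coe_mulRight, Equiv.Perm.sign_mul, Units.val_mul, Int.cast_mul]
  rw [show w ∘ (σ * τ : Equiv.Perm (Fin n)) = (w ∘ σ) ∘ τ from rfl]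
  linear_combination (-((Equiv.Perm.sign σ : ℤ) : ℂ) * F ((w ∘ σ) ∘ τ)) * h

theorem altSum_sum {n : ℕ} {κ : Type*} (s : Finset κ) (c : κ → ℂ) (F : κ → (Fin n → E) → ℂ)
    (w : Fin n → E) :
    altSum (fun w => ∑ i ∈ s, c i * F i w) w = ∑ i ∈ s, c i * altSum (F i) w := by
  simp only [altSum, Finset.mul_sum]
  rw [Finset.sum_comm]
  exact Finset.sum_congr rfl fun i _ => Finset.sum_congr rfl fun σ _ => by ring

theorem neg_one_pow_mul_sign_cycleRange {n : ℕ} (i : Fin n) :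
    (-1 : ℂ) ^ (i : ℕ) * ((Equiv.Perm.sign i.cycleRange.symm : ℤ) : ℂ) = 1 := by
  rw [Equiv.Perm.sign_symm, Fin.sign_cycleRange]
  push_cast
  rw [← mul_pow]
  simp

/-- The i-th summand is the 0-th one composed with the cycle moving the i-th argument to the front.
Its sign is (-1)^i, so after alternation all n + 1 summands agree. -/
theorem altSum_cons_sum {n : ℕ} (a : E → ℂ) (G : (Fin n → E) → ℂ) (w : Fin (n + 1) → E) :
    altSum (fun w => ∑ i : Fin (n + 1), (-1) ^ (i : ℕ) * (a (w i) * G (i.removeNth w))) w =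
      (n + 1) * altSum (fun w => a (w 0) * G (Fin.tail w)) w := by
  rw [altSum_sum Finset.univ (fun i : Fin (n + 1) => (-1) ^ (i : ℕ))
    (fun i w => a (w i) * G (i.removeNth w))]
  have h : ∀ i : Fin (n + 1), altSum (fun w => a (w i) * G (i.removeNth w)) w =
      ((Equiv.Perm.sign i.cycleRange.symm : ℤ) : ℂ) *
        altSum (fun w => a (w 0) * G (Fin.tail w)) w := by
    intro i
    rw [← altSum_comp]
    congr 1
    funext w
    rw [← Fin.cons_removeNth_eq_comp_cycleRange_symm]
    simp
  rw [Finset.sum_congr rfl fun i _ => by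
    rw [h i, ← mul_assoc, neg_one_pow_mul_sign_cycleRange, one_mul]]
  simp

theorem altSum_cons_comp {n : ℕ} (a : E → ℂ) (G : (Fin n → E) → ℂ) (τ : Equiv.Perm (Fin n))
    (w : Fin (n + 1) → E) :
    altSum (fun w => a (w 0) * G (Fin.tail w ∘ τ)) w =
      ((Equiv.Perm.sign τ : ℤ) : ℂ) * altSum (fun w => a (w 0) * G (Fin.tail w)) w := by
  have h : Equiv.Perm.sign (Equiv.Perm.decomposeFin.symm (0, τ)) = Equiv.Perm.sign τ := by
    simp
  rw [← h, ← altSum_comp]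
  congr 1

/-- The same count for the remaining arguments, with permutations that fix the first one. -/
theorem altSum_cons_cons_sum {n : ℕ} (a b : E → ℂ) (G : (Fin n → E) → ℂ) (w : Fin (n + 2) → E) :
    altSum (fun w => a (w 0) * ∑ i : Fin (n + 1), (-1) ^ (i : ℕ) *
      (b (Fin.tail w i) * G (i.removeNth (Fin.tail w)))) w =
      (n + 1) * altSum (fun w => a (w 0) * (b (w 1) * G (Fin.tail (Fin.tail w)))) w := by
  have h₀ : (fun w : Fin (n + 2) → E => a (w 0) * ∑ i : Fin (n + 1), (-1) ^ (i : ℕ) *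
      (b (Fin.tail w i) * G (i.removeNth (Fin.tail w)))) = fun w => ∑ i : Fin (n + 1),
        (-1) ^ (i : ℕ) * (a (w 0) * (b (Fin.tail w i) * G (i.removeNth (Fin.tail w)))) := by
    funext w
    rw [Finset.mul_sum]
    exact Finset.sum_congr rfl fun i _ => by ring
  rw [h₀, altSum_sum Finset.univ (fun i : Fin (n + 1) => (-1) ^ (i : ℕ))
    (fun i w => a (w 0) * (b (Fin.tail w i) * G (i.removeNth (Fin.tail w))))]
  have h : ∀ i : Fin (n + 1),
      altSum (fun w => a (w 0) * (b (Fin.tail w i) * G (i.removeNth (Fin.tail w)))) w =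
      ((Equiv.Perm.sign i.cycleRange.symm : ℤ) : ℂ) *
        altSum (fun w => a (w 0) * (b (w 1) * G (Fin.tail (Fin.tail w)))) w := by
    intro i
    have h₁ := altSum_cons_comp a (fun u : Fin (n + 1) → E => b (u 0) * G (Fin.tail u))
      i.cycleRange.symm w
    refine Eq.trans ?_ h₁
    congr 1
    funext w
    rw [← Fin.cons_removeNth_eq_comp_cycleRange_symm]
    simp
  rw [Finset.sum_congr rfl fun i _ => by
    rw [h i, ← mul_assoc, neg_one_pow_mul_sign_cycleRange, one_mul]]
  simp

variable [NormedAddCommGroup E] [NormedSpace ℝ E]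

theorem altSum_alternating {n : ℕ} (α : E [⋀^Fin n]→L[ℝ] ℂ) (w : Fin n → E) :
    altSum α w = n.factorial * α w := by
  have h : ∀ σ : Equiv.Perm (Fin n), ((Equiv.Perm.sign σ : ℤ) : ℂ) * α (w ∘ σ) = α w := by
    intro σ
    have h₁ : α (w ∘ σ) = Equiv.Perm.sign σ • α w := α.toAlternatingMap.map_perm w σ
    rw [h₁, Units.smul_def, zsmul_eq_mul, ← mul_assoc, ← Int.cast_mul, ← Units.val_mul,
      Int.units_mul_self]
    simp
  simp [altSum, h, Fintype.card_perm]

/-- Alternation of a product of two covectors and a form. -/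
theorem altSum_extMul_extMul (a b : E →L[ℝ] ℝ) {k : ℕ} (η : E [⋀^Fin k]→L[ℝ] ℂ)
    (w : Fin (k + 2) → E) :
    altSum (fun w => (a (w 0) : ℂ) * ((b (w 1) : ℂ) * η (Fin.tail (Fin.tail w)))) w =
      k.factorial * extMulCLM a (k + 1) (extMulCLM b k η) w := by
  -- Alternating the alternating form a ∧ (b ∧ η) multiplies it by (k+2)!, while expanding both
  -- products first gives (k+2)(k+1) times the alternation in question. Cancelling leaves k!.
  have h₁ := altSum_alternating (extMulCLM a (k + 1) (extMulCLM b k η)) w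
  have h₂ : ⇑(extMulCLM a (k + 1) (extMulCLM b k η)) = fun w => ∑ i : Fin (k + 2),
      (-1 : ℂ) ^ (i : ℕ) * ((a (w i) : ℂ) * extMulCLM b k η (i.removeNth w)) := by
    funext w
    rw [extMulCLM_apply]
    simp
  have h₃ : ⇑(extMulCLM b k η) = fun w => ∑ i : Fin (k + 1),
      (-1 : ℂ) ^ (i : ℕ) * ((b (w i) : ℂ) * η (i.removeNth w)) := by
    funext w
    rw [extMulCLM_apply]
    simp
  nth_rw 1 [h₂] at h₁
  rw [altSum_cons_sum (fun v => (a v : ℂ)), h₃,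
    altSum_cons_cons_sum (fun v => (a v : ℂ)) (fun v => (b v : ℂ))] at h₁
  have h₄ : (k : ℂ) + 1 ≠ 0 := by exact_mod_cast k.succ_ne_zero
  have h₅ : (k : ℂ) + 2 ≠ 0 := by exact_mod_cast (k + 1).succ_ne_zero
  rw [Nat.factorial_succ, Nat.factorial_succ] at h₁
  push_cast at h₁
  refine mul_left_cancel₀ (mul_ne_zero h₅ h₄) ?_
  linear_combination h₁

theorem twoForm_apply (β : E [⋀^Fin 2]→L[ℝ] ℂ) (u v : E) :
    β ![u, v] = (β.curryLeft u).curryLeft v ![] := rfl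

variable [FiniteDimensional ℝ E] {ι : Type*} [Fintype ι] (b : Module.Basis ι ℝ E)

theorem twoForm_expand (β : E [⋀^Fin 2]→L[ℝ] ℂ) (u v : E) :
    β ![u, v] = ∑ i, ∑ j, β ![b i, b j] * (dual b i u * dual b j v) := by
  have h : β ![u, v] = β ![∑ i, dual b i u • b i, ∑ j, dual b j v • b j] := by
    rw [sum_dual_smul, sum_dual_smul]
  have h₁ : ∀ (a : ι → ℝ) (x : E), (β.curryLeft (∑ i, a i • b i)).curryLeft x ![] =
      ∑ i, a i • (β.curryLeft (b i)).curryLeft x ![] := by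
    intro a x
    have : β.curryLeft (∑ i, a i • b i) = ∑ i, a i • β.curryLeft (b i) := by
      rw [map_sum]; simp only [map_smul]
    rw [this]
    simp
  have h₂ : ∀ i (a : ι → ℝ), (β.curryLeft (b i)).curryLeft (∑ j, a j • b j) ![] =
      ∑ j, a j • (β.curryLeft (b i)).curryLeft (b j) ![] := by
    intro i a
    have : (β.curryLeft (b i)).curryLeft (∑ j, a j • b j) =
        ∑ j, a j • (β.curryLeft (b i)).curryLeft (b j) := by
      rw [map_sum]; simp only [map_smul]
    rw [this]
    simp
  rw [h, twoForm_apply, h₁]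
  refine Finset.sum_congr rfl fun i _ => ?_
  rw [h₂, Finset.smul_sum]
  refine Finset.sum_congr rfl fun j _ => ?_
  rw [twoForm_apply]
  simp only [Complex.real_smul]
  ring

/-- Exterior multiplication by a two-form, in terms of a basis. -/
def wedgeTwo (β : E [⋀^Fin 2]→L[ℝ] ℂ) : Module.End ℂ (AltForm E) :=
  (2⁻¹ : ℂ) • ∑ i, ∑ j, β ![b i, b j] • (extMul (dual b i) * extMul (dual b j))

theorem wedge_eq_wedgeTwo (β : E [⋀^Fin 2]→L[ℝ] ℂ) (η : AltForm E) (k : ℕ) :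
    wedge (Nat.add_comm 2 k) β (η k) = wedgeTwo b β η (k + 2) := by
  ext w
  have h₁ : ∀ w : Fin (k + 2) → E, tensorForm (Nat.add_comm 2 k) β (η k) w =
      ∑ p : ι × ι, β ![b p.1, b p.2] *
        ((dual b p.1 (w 0) : ℂ) * ((dual b p.2 (w 1) : ℂ) * η k (Fin.tail (Fin.tail w)))) := by
    intro w
    have h₂ : tensorForm (Nat.add_comm 2 k) β (η k) w =
        β ![w 0, w 1] * η k (Fin.tail (Fin.tail w)) := by
      change β _ * η k _ = _
      congr 2
      · funext i
        fin_cases i <;> rfl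
      · funext i
        simp only [Fin.tail]
        congr 1
        ext
        simp
    rw [h₂, twoForm_expand b, Fintype.sum_prod_type, Finset.sum_mul]
    refine Finset.sum_congr rfl fun i _ => ?_
    rw [Finset.sum_mul]
    exact Finset.sum_congr rfl fun j _ => by ring
  have h₃ : ContinuousMultilinearMap.alternatization (tensorForm (Nat.add_comm 2 k) β (η k)) w =
      altSum (fun w => ∑ p : ι × ι, β ![b p.1, b p.2] * ((dual b p.1 (w 0) : ℂ) *
        ((dual b p.2 (w 1) : ℂ) * η k (Fin.tail (Fin.tail w))))) w := by
    rw [ContinuousMultilinearMap.alternatization_apply_apply, altSum]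
    refine Finset.sum_congr rfl fun σ _ => ?_
    rw [h₁, Units.smul_def, zsmul_eq_mul]
  have hk : (k.factorial : ℂ) ≠ 0 := by exact_mod_cast k.factorial_ne_zero
  have h₄ : wedgeTwo b β η (k + 2) w = 2⁻¹ * ∑ p : ι × ι, β ![b p.1, b p.2] *
      extMulCLM (dual b p.1) (k + 1) (extMulCLM (dual b p.2) k (η k)) w := by
    rw [Fintype.sum_prod_type]
    simp only [wedgeTwo, LinearMap.smul_apply, LinearMap.sum_apply, AltForm.smul_apply,
      AltForm.sum_apply, ContinuousAlternatingMap.smul_apply, ContinuousAlternatingMap.sum_apply,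
      smul_eq_mul, Module.End.mul_apply]
    rfl
  rw [wedge, ContinuousAlternatingMap.smul_apply, h₃, altSum_sum, h₄]
  simp only [altSum_extMul_extMul, smul_eq_mul, Finset.mul_sum]
  refine Finset.sum_congr rfl fun p _ => ?_
  -- The factor k! from the alternation cancels against the normalisation 1/(2! k!) of `wedge` and
  -- leaves the ½ of `wedgeTwo`.
  rw [Nat.factorial_two]
  push_cast
  field_simp

end WedgeTwo
end HKT
end

noncomputable section

namespace HKT

/-! ### Linear algebra of two-forms -/

section TwoForms

variable {E : Type*} [NormedAddCommGroup E] [NormedSpace ℝ E]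

/-- An operator intertwining contractions vanishes as soon as it does not produce any scalars. -/
theorem eq_zero_of_contr_comp {X : Module.End ℂ (AltForm E)} (f : E → E)
    (h : ∀ v, contr v * X = X * contr (f v)) (h₀ : ∀ η, X η 0 = 0) : X = 0 := by
  have key : ∀ k η, X η k = 0 := by
    intro k
    induction k with
    | zero => exact h₀
    | succ k ih =>
      intro η
      ext w
      rw [← Fin.cons_self_tail w]
      have h₁ := LinearMap.congr_fun (h (w 0)) η
      have h₂ : contrCLM (w 0) k (X η (k + 1)) = 0 := by
        rw [← contr_apply]
        exact (congrFun h₁ k).trans (ih _)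
      simpa using congrArg (fun α => α (Fin.tail w)) h₂
  exact LinearMap.ext fun η => funext fun k => key k η

theorem twoForm_swap (β : E [⋀^Fin 2]→L[ℝ] ℂ) (u v : E) : β ![u, v] = -β ![v, u] := by
  have h := β.map_swap ![v, u] (i := 0) (j := 1) (by simp)
  refine Eq.trans (congrArg β (funext fun i => ?_)) h
  fin_cases i <;> simp

/-- The form of degree `0` equal to `1`. -/
def oneForm : AltForm E
  | 0 => ContinuousAlternatingMap.constOfIsEmpty ℝ E (Fin 0) (1 : ℂ)
  | _ + 1 => 0

theorem contr_oneForm (v : E) : contr v (oneForm : AltForm E) = 0 := by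
  ext k w
  rfl

theorem contr_extMul_oneForm (v : E) (a : E →L[ℝ] ℝ) :
    contr v (extMul a oneForm) = (a v : ℂ) • oneForm := by
  have h := LinearMap.congr_fun (contr_extMul v a) oneForm
  simpa only [LinearMap.add_apply, Module.End.mul_apply, contr_oneForm, map_zero, add_zero,
    LinearMap.smul_apply, Module.End.one_apply] using h

variable [FiniteDimensional ℝ E] {ι : Type*} [Fintype ι] (b : Module.Basis ι ℝ E)

theorem extMul_comp_eq_sum (a : E →L[ℝ] ℝ) :
    extMul a = ∑ i, (a (b i) : ℂ) • extMul (dual b i) := by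
  conv_lhs => rw [← sum_dual_comp b a]
  simp only [extMul_sum, extMul_smul]

theorem twoForm_sum_right (β : E [⋀^Fin 2]→L[ℝ] ℂ) (u v : E) :
    β ![u, v] = ∑ j, (dual b j v : ℂ) * β ![u, b j] := by
  have h : (β.curryLeft u).curryLeft v =
      ∑ j, dual b j v • (β.curryLeft u).curryLeft (b j) := by
    conv_lhs => rw [← sum_dual_smul b v]
    rw [map_sum]; simp only [map_smul]
  rw [twoForm_apply, h]
  simp only [ContinuousAlternatingMap.sum_apply]
  exact Finset.sum_congr rfl fun j _ => Complex.real_smul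

theorem twoForm_sum_left (β : E [⋀^Fin 2]→L[ℝ] ℂ) (u v : E) :
    β ![u, v] = ∑ j, (dual b j u : ℂ) * β ![b j, v] := by
  rw [twoForm_swap, twoForm_sum_right b, ← Finset.sum_neg_distrib]
  exact Finset.sum_congr rfl fun j _ => by rw [twoForm_swap β (b j) v]; ring

theorem wedgeTwo_smul (c : ℂ) (β : E [⋀^Fin 2]→L[ℝ] ℂ) :
    wedgeTwo b (c • β) = c • wedgeTwo b β := by
  simp only [wedgeTwo, ContinuousAlternatingMap.smul_apply, smul_assoc, ← Finset.smul_sum]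
  rw [smul_comm]

/-- Contraction of a two-form, as an operator of exterior multiplication. -/
def extContr (β : E [⋀^Fin 2]→L[ℝ] ℂ) (v : E) : Module.End ℂ (AltForm E) :=
  ∑ j, β ![v, b j] • extMul (dual b j)

/-- Contraction is an antiderivation; the two terms in which v meets one of the covectors are equal
by antisymmetry of β, which removes the factor ½. -/
theorem contr_wedgeTwo (v : E) (β : E [⋀^Fin 2]→L[ℝ] ℂ) :
    contr v * wedgeTwo b β = wedgeTwo b β * contr v + extContr b β v := by
  have h : ∀ i j, contr v * (extMul (dual b i) * extMul (dual b j)) =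
      extMul (dual b i) * extMul (dual b j) * contr v + ((dual b i v : ℂ) • extMul (dual b j) -
        (dual b j v : ℂ) • extMul (dual b i)) := by
    intro i j
    have h₁ := contr_extMul v (dual b i)
    have h₂ := contr_extMul v (dual b j)
    linear_combination (norm := skip) h₁ * extMul (dual b j) - extMul (dual b i) * h₂
    simp only [smul_mul_assoc, mul_smul_comm, one_mul, mul_one]
    noncomm_ring
  have h₁ : ∑ i, ∑ j, β ![b i, b j] • ((dual b i v : ℂ) • extMul (dual b j)) =
      extContr b β v := by
    rw [Finset.sum_comm, extContr]
    refine Finset.sum_congr rfl fun j _ => ?_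
    rw [twoForm_sum_left b, Finset.sum_smul]
    exact Finset.sum_congr rfl fun i _ => by rw [smul_smul, mul_comm]
  have h₂ : ∑ i, ∑ j, β ![b i, b j] • ((dual b j v : ℂ) • extMul (dual b i)) =
      -extContr b β v := by
    rw [extContr, ← Finset.sum_neg_distrib]
    refine Finset.sum_congr rfl fun i _ => ?_
    rw [twoForm_swap, twoForm_sum_right b, ← neg_smul, neg_neg, Finset.sum_smul]
    exact Finset.sum_congr rfl fun j _ => by rw [smul_smul, mul_comm]
  simp only [wedgeTwo, mul_smul_comm, smul_mul_assoc, Finset.mul_sum, Finset.sum_mul, h, smul_add,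
    smul_sub, Finset.sum_add_distrib, Finset.sum_sub_distrib]
  simp only [h₁, h₂]
  rw [add_right_inj, smul_neg, sub_neg_eq_add, ← add_smul]
  norm_num

theorem der_wedgeTwo (A : E →L[ℝ] E) (β : E [⋀^Fin 2]→L[ℝ] ℂ) :
    der A * wedgeTwo b β = wedgeTwo b β * der A + wedgeTwo b (derCLM A 2 β) := by
  have h : ∀ i j, der A * (extMul (dual b i) * extMul (dual b j)) =
      extMul (dual b i) * extMul (dual b j) * der A +
        (extMul ((dual b i).comp A) * extMul (dual b j) +
          extMul (dual b i) * extMul ((dual b j).comp A)) := by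
    intro i j
    have h₁ := der_extMul A (dual b i)
    have h₂ := der_extMul A (dual b j)
    linear_combination (norm := skip) h₁ * extMul (dual b j) + extMul (dual b i) * h₂
    noncomm_ring
  have h₀ : ∀ u v, derCLM A 2 β ![u, v] = β ![A u, v] + β ![u, A v] := by
    intro u v
    rw [derCLM_apply, Fin.sum_univ_two]
    congr 1 <;> refine congrArg β (funext fun i => ?_) <;> fin_cases i <;> simp
  have hA : ∀ i, extMul ((dual b i).comp A) =
      ∑ j, (dual b i (A (b j)) : ℂ) • extMul (dual b j) := fun i =>
    extMul_comp_eq_sum b ((dual b i).comp A)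
  have h₁ : ∑ i, ∑ j, β ![b i, b j] • (extMul ((dual b i).comp A) * extMul (dual b j)) =
      ∑ i, ∑ j, β ![A (b i), b j] • (extMul (dual b i) * extMul (dual b j)) := by
    simp only [hA, Finset.sum_mul, Finset.smul_sum]
    rw [Finset.sum_comm, Finset.sum_comm (s := Finset.univ (α := ι)) (t := Finset.univ)
      (f := fun i j => β ![A (b i), b j] • (extMul (dual b i) * extMul (dual b j)))]
    refine Finset.sum_congr rfl fun j _ => ?_
    rw [Finset.sum_comm]
    refine Finset.sum_congr rfl fun i _ => ?_
    rw [twoForm_sum_left b β (A (b i)), Finset.sum_smul]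
    exact Finset.sum_congr rfl fun l _ => by rw [smul_mul_assoc, smul_smul, mul_comm]
  have h₂ : ∑ i, ∑ j, β ![b i, b j] • (extMul (dual b i) * extMul ((dual b j).comp A)) =
      ∑ i, ∑ j, β ![b i, A (b j)] • (extMul (dual b i) * extMul (dual b j)) := by
    simp only [hA, Finset.mul_sum, Finset.smul_sum]
    refine Finset.sum_congr rfl fun i _ => ?_
    rw [Finset.sum_comm]
    refine Finset.sum_congr rfl fun j _ => ?_
    rw [twoForm_sum_right b β _ (A (b j)), Finset.sum_smul]
    exact Finset.sum_congr rfl fun l _ => by rw [mul_smul_comm, smul_smul, mul_comm]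
  simp only [wedgeTwo, mul_smul_comm, smul_mul_assoc, Finset.mul_sum, Finset.sum_mul, h, smul_add,
    Finset.sum_add_distrib, h₀, add_smul]
  simp only [h₁, h₂]

theorem extMul_wedgeTwo (a : E →L[ℝ] ℝ) (β : E [⋀^Fin 2]→L[ℝ] ℂ) :
    extMul a * wedgeTwo b β = wedgeTwo b β * extMul a := by
  simp only [wedgeTwo, mul_smul_comm, smul_mul_assoc, Finset.mul_sum, Finset.sum_mul]
  congr 1
  refine Finset.sum_congr rfl fun i _ => Finset.sum_congr rfl fun j _ => ?_
  congr 1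
  have h₁ := extMul_extMul a (dual b i)
  have h₂ := extMul_extMul a (dual b j)
  linear_combination (norm := skip) h₁ * extMul (dual b j) - extMul (dual b i) * h₂
  noncomm_ring

theorem wedgeTwo_zero_degree (β : E [⋀^Fin 2]→L[ℝ] ℂ) (η : AltForm E) : wedgeTwo b β η 0 = 0 := by
  refine ContinuousAlternatingMap.ext fun w => ?_
  simp [wedgeTwo, AltForm.sum_apply, ContinuousAlternatingMap.sum_apply]

theorem wedgeTwo_one_degree (β : E [⋀^Fin 2]→L[ℝ] ℂ) (η : AltForm E) : wedgeTwo b β η 1 = 0 := by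
  refine ContinuousAlternatingMap.ext fun w => ?_
  simp [wedgeTwo, AltForm.sum_apply, ContinuousAlternatingMap.sum_apply, extMul_succ]

/-- Both sides have the same commutation rule with contractions up to applying f to the vector, and
neither produces scalars; f need not be invertible. -/
theorem pull_wedgeTwo (f : E →L[ℝ] E) (β : E [⋀^Fin 2]→L[ℝ] ℂ) :
    pull f * wedgeTwo b β = wedgeTwo b (β.compContinuousLinearMap f) * pull f := by
  have h₀ : ∀ u v, β.compContinuousLinearMap f ![u, v] = β ![f u, f v] := by
    intro u v
    rw [ContinuousAlternatingMap.compContinuousLinearMap_apply]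
    refine congrArg β (funext fun i => ?_)
    fin_cases i <;> simp
  rw [← sub_eq_zero]
  refine eq_zero_of_contr_comp f (fun v => ?_) (fun η => ?_)
  · have h : pull f * extContr b β (f v) =
        extContr b (β.compContinuousLinearMap f) v * pull f := by
      simp only [extContr, Finset.mul_sum, mul_smul_comm, pull_extMul, ← smul_mul_assoc,
        ← Finset.sum_mul]
      congr 1
      simp only [extMul_comp_eq_sum b ((dual b _).comp f), Finset.smul_sum]
      rw [Finset.sum_comm]
      refine Finset.sum_congr rfl fun j _ => ?_
      rw [h₀, twoForm_sum_right b, Finset.sum_smul]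
      exact Finset.sum_congr rfl fun i _ => by
        rw [smul_smul, mul_comm, ContinuousLinearMap.comp_apply]
    have h₁ := contr_pull v f
    have h₂ := contr_wedgeTwo b (f v) β
    have h₃ := contr_wedgeTwo b v (β.compContinuousLinearMap f)
    linear_combination (norm := skip) h₁ * wedgeTwo b β + pull f * h₂ + h - h₃ * pull f -
      wedgeTwo b (β.compContinuousLinearMap f) * h₁
    noncomm_ring
  · simp only [LinearMap.sub_apply, Module.End.mul_apply, AltForm.sub_apply, pull_apply,
      wedgeTwo_zero_degree, sub_zero]
    rfl

theorem contr_contr_wedgeTwo_oneForm (u v : E) (β : E [⋀^Fin 2]→L[ℝ] ℂ) :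
    contr v (contr u (wedgeTwo b β oneForm)) = β ![u, v] • oneForm := by
  have h := LinearMap.congr_fun (contr_wedgeTwo b u β) oneForm
  simp only [LinearMap.add_apply, Module.End.mul_apply, contr_oneForm, map_zero, zero_add] at h
  rw [h, extContr]
  simp only [LinearMap.sum_apply, LinearMap.smul_apply, map_sum, map_smul, contr_extMul_oneForm,
    smul_smul]
  rw [← Finset.sum_smul, twoForm_sum_right b]
  congr 1
  exact Finset.sum_congr rfl fun j _ => mul_comm _ _

theorem wedgeTwo_oneForm (β : E [⋀^Fin 2]→L[ℝ] ℂ) : wedgeTwo b β oneForm 2 = β := by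
  ext w
  have h := congrArg (fun η : AltForm E => η 0 ![])
    (contr_contr_wedgeTwo_oneForm b (w 0) (w 1) β)
  have hw : w = ![w 0, w 1] := by
    funext i
    fin_cases i <;> rfl
  rw [hw]
  refine Eq.trans ?_ (h.trans ?_)
  · rfl
  · change β _ * 1 = _
    rw [mul_one]

end TwoForms
end HKT
end

noncomputable section

namespace HKT

/-! ### Quaternionic Hermitian vector spaces -/

/-- A quaternionic Hermitian structure on a vector space, with its standard `(2, 0)`-form. -/
structure QuatHermitian (E : Type*) [NormedAddCommGroup E] [NormedSpace ℝ E] where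
  g : E →L[ℝ] E →L[ℝ] ℝ
  I : E →L[ℝ] E
  J : E →L[ℝ] E
  K : E →L[ℝ] E
  Om : E [⋀^Fin 2]→L[ℝ] ℂ
  symm : ∀ u v, g u v = g v u
  pos : ∀ v, v ≠ 0 → 0 < g v v
  II : ∀ v, I (I v) = -v
  JJ : ∀ v, J (J v) = -v
  IJ : ∀ v, I (J v) = K v
  JI : ∀ v, J (I v) = -K v
  gI : ∀ u v, g (I u) (I v) = g u v
  gJ : ∀ u v, g (J u) (J v) = g u v
  Om_apply : ∀ u v, Om ![u, v] = 2⁻¹ * ((g u (J v) : ℂ) + Complex.I * (g u (K v) : ℂ))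

set_option linter.unusedSectionVars false

namespace QuatHermitian

variable {E : Type*} [NormedAddCommGroup E] [NormedSpace ℝ E] (Q : QuatHermitian E)

theorem KJ (v : E) : Q.K (Q.J v) = -Q.I v := by
  rw [← Q.IJ, Q.JJ, map_neg]

theorem JK (v : E) : Q.J (Q.K v) = Q.I v := by
  rw [← Q.IJ, Q.JI, Q.KJ, neg_neg]

theorem g_J_left (u v : E) : Q.g (Q.J u) v = -Q.g u (Q.J v) := by
  have h := Q.gJ u (Q.J v)
  rw [Q.JJ, map_neg] at h
  linarith

theorem g_I_left (u v : E) : Q.g (Q.I u) v = -Q.g u (Q.I v) := by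
  have h := Q.gI u (Q.I v)
  rw [Q.II, map_neg] at h
  linarith

theorem g_I_self (v : E) : Q.g v (Q.I v) = 0 := by
  have h := Q.g_I_left v v
  rw [Q.symm] at h
  linarith

/-- On the standard form, J acts as complex conjugation. This makes the HKT condition imply ∂_J Ω =
0 as well. -/
theorem pull_J_Om (u v : E) :
    Q.Om ![Q.J u, Q.J v] = starRingEnd ℂ (Q.Om ![u, v]) := by
  rw [Q.Om_apply, Q.Om_apply, Q.KJ, Q.JJ]
  simp only [map_neg, Q.g_J_left, ← Q.JK, Q.JJ]
  simp [Complex.conj_ofNat]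

theorem Om_I (u v : E) : Q.Om ![u, Q.I v] = Complex.I * Q.Om ![u, v] := by
  rw [Q.Om_apply, Q.Om_apply, Q.JI]
  have h : Q.K (Q.I v) = Q.J v := by
    rw [← Q.IJ, Q.JI, map_neg, ← Q.IJ, Q.II, neg_neg]
  rw [h, map_neg]
  push_cast
  linear_combination (-(1 / 2) * (Q.g u (Q.K v) : ℂ)) * Complex.I_sq

theorem derCLM_I_Om : derCLM Q.I 2 Q.Om = (2 * Complex.I) • Q.Om := by
  ext w
  have hw : w = ![w 0, w 1] := by funext i; fin_cases i <;> rfl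
  have h₀ : Function.update w 0 (Q.I (w 0)) = ![Q.I (w 0), w 1] := by
    funext i; fin_cases i <;> simp
  have h₁ : Function.update w 1 (Q.I (w 1)) = ![w 0, Q.I (w 1)] := by
    funext i; fin_cases i <;> simp
  rw [derCLM_apply, Fin.sum_univ_two, h₀, h₁, twoForm_swap, Q.Om_I, Q.Om_I,
    twoForm_swap _ (w 1), ContinuousAlternatingMap.smul_apply]
  conv_rhs => rw [hw]
  rw [smul_eq_mul]
  ring

variable [FiniteDimensional ℝ E]

/-- Orthonormality of a basis. -/
def IsON {ι : Type*} [DecidableEq ι] (e : Module.Basis ι ℝ E) : Prop :=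
  ∀ i j, Q.g (e i) (e j) = if i = j then 1 else 0

theorem exists_isON : ∃ e : Module.Basis (Fin (Module.finrank ℝ E)) ℝ E, Q.IsON e := by
  let B : LinearMap.BilinForm ℝ E :=
    LinearMap.mk₂ ℝ (fun u v => Q.g u v) (by simp) (by simp) (by simp) (by simp)
  have hB : LinearMap.IsSymm B := ⟨fun u v => Q.symm u v⟩
  obtain ⟨v, hv⟩ := LinearMap.BilinForm.exists_orthogonal_basis hB
  have hpos : ∀ i, 0 < Q.g (v i) (v i) := fun i => Q.pos _ (v.ne_zero i)
  have hne : ∀ i, (Real.sqrt (Q.g (v i) (v i)))⁻¹ ≠ 0 := fun i =>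
    inv_ne_zero (Real.sqrt_pos.2 (hpos i)).ne'
  refine ⟨v.unitsSMul fun i => Units.mk0 _ (hne i), fun i j => ?_⟩
  simp only [Module.Basis.unitsSMul_apply, Units.smul_def, Units.val_mk0, map_smul,
    smul_apply, smul_eq_mul]
  split_ifs with h
  · subst h
    have h₁ := Real.mul_self_sqrt (hpos i).le
    have h₂ := (Real.sqrt_pos.2 (hpos i)).ne'
    field_simp
    rw [sq, h₁]
  · have h₁ : Q.g (v i) (v j) = 0 := hv h
    rw [h₁]
    simp

variable {Q} {ι : Type*} [Fintype ι] [DecidableEq ι] {e : Module.Basis ι ℝ E}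

theorem IsON.dual_eq (he : Q.IsON e) (i : ι) : dual e i = Q.g (e i) := by
  ext v
  conv_rhs => rw [← sum_dual_smul e v]
  simp [he i]

theorem IsON.sum_contr (he : Q.IsON e) (v : E) : ∑ i, (Q.g (e i) v : ℂ) • contr (e i) = contr v := by
  rw [← sum_dual_contr e v]
  simp only [he.dual_eq]

variable (Q)

theorem g_bijective : Function.Bijective Q.g := by
  have h : Function.Injective Q.g := by
    refine (injective_iff_map_eq_zero _).2 fun v hv => ?_
    by_contra hne
    have := Q.pos v hne
    rw [hv] at this
    simp at this
  refine ⟨h, ?_⟩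
  have h₂ : Module.finrank ℝ E = Module.finrank ℝ (E →L[ℝ] ℝ) := by
    rw [← (LinearMap.toContinuousLinearMap (𝕜 := ℝ) (E := E) (F' := ℝ)).finrank_eq,
      Subspace.dual_finrank_eq]
  exact (LinearMap.injective_iff_surjective_of_finrank_eq_finrank h₂
    (f := (Q.g : E →ₗ[ℝ] (E →L[ℝ] ℝ)))).1 h

/-- The identification of the dual space with the space given by the metric. -/
def musical : E ≃L[ℝ] (E →L[ℝ] ℝ) :=
  ContinuousLinearEquiv.ofBijective Q.g (LinearMap.ker_eq_bot.2 Q.g_bijective.1)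
    (LinearMap.range_eq_top.2 Q.g_bijective.2)

theorem musical_apply (v : E) : Q.musical v = Q.g v := rfl

theorem musical_symm_g (v : E) : Q.musical.symm (Q.g v) = v := Q.musical.symm_apply_apply v

/-- The adjoint of the multiplication by the standard `(2, 0)`-form, in terms of a basis. -/
def lam (b : Module.Basis ι ℝ E) : Module.End ℂ (AltForm E) :=
  -((2⁻¹ : ℂ) • ∑ i, contr (Q.J (Q.musical.symm (dual b i))) * contr (b i))

/-- The sum over a basis and its metrically dual basis is invariant. Hence Λ can be computed in an
orthonormal frame at each point, while its smoothness is checked with one fixed basis of the model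
space. -/
theorem lam_eq {κ : Type*} [Fintype κ] (b : Module.Basis ι ℝ E) (c : Module.Basis κ ℝ E) :
    Q.lam b = Q.lam c := by
  have h : ∀ j, contr (Q.J (Q.musical.symm (dual c j))) =
      ∑ i, (dual c j (b i) : ℂ) • contr (Q.J (Q.musical.symm (dual b i))) := by
    intro j
    conv_lhs => rw [← sum_dual_comp b (dual c j)]
    simp only [map_sum, map_smul, contr_sum, contr_smul]
  have h₂ : ∀ i, contr (b i) = ∑ j, (dual c j (b i) : ℂ) • contr (c j) := fun i =>
    (sum_dual_contr c (b i)).symm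
  rw [lam, lam]
  congr 2
  conv_lhs => enter [2, i]; rw [h₂ i]
  simp only [h, Finset.mul_sum, Finset.sum_mul, mul_smul_comm, smul_mul_assoc]
  rw [Finset.sum_comm]

variable {Q}

theorem IsON.lam_eq (he : Q.IsON e) :
    Q.lam e = -((2⁻¹ : ℂ) • ∑ i, contr (Q.J (e i)) * contr (e i)) := by
  simp only [lam, he.dual_eq, musical_symm_g]

theorem wedgeTwo_eq {κ : Type*} [Fintype κ] (b : Module.Basis ι ℝ E) (c : Module.Basis κ ℝ E)
    (β : E [⋀^Fin 2]→L[ℝ] ℂ) : wedgeTwo b β = wedgeTwo c β := by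
  refine LinearMap.ext fun η => funext fun k => ?_
  match k with
  | 0 => rw [wedgeTwo_zero_degree, wedgeTwo_zero_degree]
  | 1 => rw [wedgeTwo_one_degree, wedgeTwo_one_degree]
  | k + 2 => rw [← wedge_eq_wedgeTwo, ← wedge_eq_wedgeTwo]

theorem IsON.sum_extMul_comp_contr (he : Q.IsON e) (A : E →L[ℝ] E) :
    ∑ i, extMul ((Q.g (e i)).comp A) * contr (e i) = der A := by
  have h₁ : ∀ i, contr (A (e i)) = ∑ k, (Q.g (e k) (A (e i)) : ℂ) • contr (e k) := fun i =>
    (he.sum_contr (A (e i))).symm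
  have h₂ : ∀ i, extMul ((Q.g (e i)).comp A) =
      ∑ k, (Q.g (e i) (A (e k)) : ℂ) • extMul (dual e k) := fun i =>
    extMul_comp_eq_sum e ((Q.g (e i)).comp A)
  rw [der_eq_sum e]
  simp only [h₁, h₂, Finset.mul_sum, Finset.sum_mul, mul_smul_comm, smul_mul_assoc]
  rw [Finset.sum_comm]

/-- Contracting Ω with Jv gives half the (1,0)-part, up to normalisation, of the covector dual to v;
summed over a frame it yields the projection of the degree operator to the holomorphic indices. -/
theorem extContr_J (e : Module.Basis ι ℝ E) (v : E) : extContr e Q.Om (Q.J v) =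
    (2⁻¹ : ℂ) • (extMul (Q.g v) - Complex.I • extMul ((Q.g v).comp Q.I)) := by
  rw [extMul_comp_eq_sum e (Q.g v), extMul_comp_eq_sum e ((Q.g v).comp Q.I), extContr,
    Finset.smul_sum, ← Finset.sum_sub_distrib, Finset.smul_sum]
  refine Finset.sum_congr rfl fun j _ => ?_
  rw [Q.Om_apply, Q.gJ, Q.g_J_left, Q.JK, smul_smul, ← sub_smul, smul_smul,
    ContinuousLinearMap.comp_apply]
  congr 1
  push_cast
  ring

theorem IsON.extContr_eq_sum (he : Q.IsON e) (v : E) :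
    extContr e Q.Om v = ∑ i, (Q.g (e i) v : ℂ) • extContr e Q.Om (e i) := by
  simp only [extContr, Finset.smul_sum, smul_smul]
  rw [Finset.sum_comm]
  refine Finset.sum_congr rfl fun j _ => ?_
  rw [← Finset.sum_smul, twoForm_sum_left e]
  simp only [he.dual_eq]

/-- J is skew for the metric, so moving it from one index of the summed pair to the other changes
the sign. -/
theorem IsON.sum_extContr_contr_J (he : Q.IsON e) :
    ∑ i, extContr e Q.Om (e i) * contr (Q.J (e i)) =
      -∑ i, extContr e Q.Om (Q.J (e i)) * contr (e i) := by
  have h₁ : ∀ i, contr (Q.J (e i)) = ∑ k, (Q.g (e k) (Q.J (e i)) : ℂ) • contr (e k) := fun i =>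
    (he.sum_contr (Q.J (e i))).symm
  rw [Finset.sum_congr rfl fun i _ => by rw [h₁ i], ← Finset.sum_neg_distrib]
  simp only [Finset.mul_sum, mul_smul_comm]
  rw [Finset.sum_comm]
  refine Finset.sum_congr rfl fun k _ => ?_
  rw [he.extContr_eq_sum (Q.J (e k)), Finset.sum_mul, ← Finset.sum_neg_distrib]
  refine Finset.sum_congr rfl fun i _ => ?_
  rw [smul_mul_assoc, ← neg_smul, Q.symm (e i), Q.g_J_left]
  push_cast
  rw [neg_neg]

/-- The Lefschetz commutator. -/
theorem IsON.wedgeTwo_lam (he : Q.IsON e) :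
    wedgeTwo e Q.Om * Q.lam e - Q.lam e * wedgeTwo e Q.Om =
      (2⁻¹ : ℂ) • (der (ContinuousLinearMap.id ℝ E) - Complex.I • der Q.I) -
        ((Fintype.card ι : ℂ) / 4) • 1 := by
  -- Moving Ω past the two contractions produces two contraction terms of Ω and the scalar Ω(e_i,
  -- Je_i) = -½. After summation the contraction terms coincide by skewness of J and the scalars add
  -- up to half the dimension.
  have h : ∀ i, wedgeTwo e Q.Om * (contr (Q.J (e i)) * contr (e i)) -
      contr (Q.J (e i)) * contr (e i) * wedgeTwo e Q.Om =
      (2⁻¹ : ℂ) • 1 + extContr e Q.Om (e i) * contr (Q.J (e i)) -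
        extContr e Q.Om (Q.J (e i)) * contr (e i) := by
    intro i
    have h₁ := contr_wedgeTwo e (e i) Q.Om
    have h₂ := contr_wedgeTwo e (Q.J (e i)) Q.Om
    have h₃ : contr (Q.J (e i)) * extContr e Q.Om (e i) +
        extContr e Q.Om (e i) * contr (Q.J (e i)) = Q.Om ![e i, Q.J (e i)] • 1 := by
      simp only [extContr, Finset.mul_sum, Finset.sum_mul, mul_smul_comm, smul_mul_assoc]
      rw [← Finset.sum_add_distrib, twoForm_sum_right e, Finset.sum_smul]
      refine Finset.sum_congr rfl fun j _ => ?_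
      rw [← smul_add, contr_extMul, smul_smul, mul_comm]
    have h₄ : Q.Om ![e i, Q.J (e i)] = -2⁻¹ := by
      rw [Q.Om_apply, Q.JJ, Q.KJ]
      simp [Q.g_I_self, he i]
    rw [h₄] at h₃
    linear_combination (norm := skip) -h₂ * contr (e i) - contr (Q.J (e i)) * h₁ - h₃
    rw [neg_smul]
    noncomm_ring
  have hs : ∑ i, extContr e Q.Om (Q.J (e i)) * contr (e i) =
      (2⁻¹ : ℂ) • (der (ContinuousLinearMap.id ℝ E) - Complex.I • der Q.I) := by
    rw [← he.sum_extMul_comp_contr Q.I, ← he.sum_extMul_comp_contr (ContinuousLinearMap.id ℝ E),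
      Finset.smul_sum, ← Finset.sum_sub_distrib, Finset.smul_sum]
    refine Finset.sum_congr rfl fun i _ => ?_
    rw [extContr_J, smul_mul_assoc, sub_mul, smul_mul_assoc, ContinuousLinearMap.comp_id]
  have hsum : wedgeTwo e Q.Om * (∑ i, contr (Q.J (e i)) * contr (e i)) -
      (∑ i, contr (Q.J (e i)) * contr (e i)) * wedgeTwo e Q.Om =
      ((Fintype.card ι : ℂ) * 2⁻¹) • 1 -
        (2 : ℂ) • (2⁻¹ : ℂ) • (der (ContinuousLinearMap.id ℝ E) - Complex.I • der Q.I) := by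
    rw [Finset.mul_sum, Finset.sum_mul, ← Finset.sum_sub_distrib,
      Finset.sum_congr rfl fun i _ => h i, Finset.sum_sub_distrib, Finset.sum_add_distrib,
      he.sum_extContr_contr_J, hs, Finset.sum_const, Finset.card_univ, two_smul,
      ← Nat.cast_smul_eq_nsmul ℂ, smul_smul]
    abel
  rw [he.lam_eq]
  have e₁ : wedgeTwo e Q.Om * -((2⁻¹ : ℂ) • ∑ i, contr (Q.J (e i)) * contr (e i)) -
      -((2⁻¹ : ℂ) • ∑ i, contr (Q.J (e i)) * contr (e i)) * wedgeTwo e Q.Om =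
      -((2⁻¹ : ℂ) • (wedgeTwo e Q.Om * (∑ i, contr (Q.J (e i)) * contr (e i)) -
      (∑ i, contr (Q.J (e i)) * contr (e i)) * wedgeTwo e Q.Om)) := by
    rw [mul_neg, mul_smul_comm, neg_mul, smul_mul_assoc, smul_sub]
    abel
  rw [e₁, hsum]
  module

/-- Contraction of forms of type `(k, 0)` is complex linear. -/
theorem contr_I {η : AltForm E} (hη : ∀ k, IsHolomorphicType Q.I (η k)) (v : E) :
    contr (Q.I v) η = Complex.I • contr v η := by
  ext k w
  have h := hη (k + 1) (Fin.cons v w) 0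
  rw [Fin.cons_zero, Fin.update_cons_zero] at h
  exact h

theorem isHolomorphicType_contr {η : AltForm E} (hη : ∀ k, IsHolomorphicType Q.I (η k)) (v : E)
    (k : ℕ) : IsHolomorphicType Q.I (contr v η k) := by
  intro w j
  have h := hη (k + 1) (Fin.cons v w) j.succ
  rw [Fin.cons_succ, ← Fin.cons_update] at h
  exact h

/-- Type (k, 0) is the condition of maximal weight under I. In this linear form it can be checked
for an operator from its commutators with I and with the degree operator. -/
theorem isHolomorphicType_iff {η : AltForm E} : (∀ k, IsHolomorphicType Q.I (η k)) ↔
    der Q.I η = Complex.I • der (ContinuousLinearMap.id ℝ E) η := by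
  constructor
  · intro h
    funext k
    rw [der_apply, derCLM_of_isHolomorphicType (h k), AltForm.smul_apply, der_id_apply, smul_smul,
      mul_comm]
  · intro h k
    refine isHolomorphicType_of_derCLM Q.II ?_
    have h₁ := congrFun h k
    rw [AltForm.smul_apply, der_id_apply, smul_smul, mul_comm] at h₁
    exact h₁

theorem lam_degree_eq_zero (b : Module.Basis ι ℝ E) {η : AltForm E} {k : ℕ} (h : η (k + 2) = 0) :
    Q.lam b η k = 0 := by
  simp only [lam, LinearMap.neg_apply, LinearMap.smul_apply, LinearMap.sum_apply,
    Module.End.mul_apply, AltForm.neg_apply, AltForm.smul_apply, AltForm.sum_apply, contr_apply, h,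
    map_zero, Finset.sum_const_zero]
  exact (congrArg Neg.neg (smul_zero (A := E [⋀^Fin k]→L[ℝ] ℂ) (2⁻¹ : ℂ))).trans neg_zero

theorem isHolomorphicType_lam (b : Module.Basis ι ℝ E) {η : AltForm E}
    (hη : ∀ k, IsHolomorphicType Q.I (η k)) (k : ℕ) : IsHolomorphicType Q.I (Q.lam b η k) := by
  revert k
  rw [isHolomorphicType_iff]
  have h : ∀ u v, der Q.I (contr u (contr v η)) =
      Complex.I • der (ContinuousLinearMap.id ℝ E) (contr u (contr v η)) := fun u v =>
    isHolomorphicType_iff.1 (isHolomorphicType_contr (isHolomorphicType_contr hη v) u)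
  simp only [lam, LinearMap.neg_apply, LinearMap.smul_apply, LinearMap.sum_apply,
    Module.End.mul_apply, map_neg, map_smul, map_sum, h, smul_neg, Finset.smul_sum]
  simp only [smul_comm Complex.I]

end QuatHermitian
end HKT
end

/-! ### Pointwise adjointness of multiplication by Ω and of its contraction operator -/

noncomputable section

namespace HKT

section Adjoint

variable {E : Type*} [NormedAddCommGroup E] [NormedSpace ℝ E]

theorem apply_insertNth {k : ℕ} (α : E [⋀^Fin (k + 1)]→L[ℝ] ℂ) (j : Fin (k + 1)) (v : E)
    (w : Fin k → E) : α (j.insertNth v w) = (-1) ^ (j : ℕ) * α (Fin.cons v w) := by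
  have h := α.toAlternatingMap.map_insertNth j v w
  refine h.trans ?_
  rw [zsmul_eq_mul]
  push_cast
  rfl

theorem eq_zero_of_finrank_lt [FiniteDimensional ℝ E] {k : ℕ} (hk : Module.finrank ℝ E < k)
    (α : E [⋀^Fin k]→L[ℝ] ℂ) : α = 0 := by
  ext w
  refine α.toAlternatingMap.map_linearDependent w fun h => ?_
  have := h.fintype_card_le_finrank
  rw [Fintype.card_fin] at this
  omega

variable {ι : Type*} [Fintype ι]

theorem formInner_add_left {k : ℕ} (e : ι → E) (α α' β : E [⋀^Fin k]→L[ℝ] ℂ) :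
    formInner e (α + α') β = formInner e α β + formInner e α' β := by
  simp only [formInner, ContinuousAlternatingMap.add_apply, add_mul, Finset.sum_add_distrib,
    mul_add]

theorem formInner_add_right {k : ℕ} (e : ι → E) (α β β' : E [⋀^Fin k]→L[ℝ] ℂ) :
    formInner e α (β + β') = formInner e α β + formInner e α β' := by
  simp only [formInner, ContinuousAlternatingMap.add_apply, map_add, mul_add,
    Finset.sum_add_distrib]

theorem formInner_smul_left {k : ℕ} (e : ι → E) (c : ℂ) (α β : E [⋀^Fin k]→L[ℝ] ℂ) :
    formInner e (c • α) β = c * formInner e α β := by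
  simp only [formInner, ContinuousAlternatingMap.smul_apply, smul_eq_mul, Finset.mul_sum]
  exact Finset.sum_congr rfl fun i _ => by ring

theorem formInner_smul_right {k : ℕ} (e : ι → E) (c : ℂ) (α β : E [⋀^Fin k]→L[ℝ] ℂ) :
    formInner e α (c • β) = starRingEnd ℂ c * formInner e α β := by
  simp only [formInner, ContinuousAlternatingMap.smul_apply, smul_eq_mul, map_mul, Finset.mul_sum]
  exact Finset.sum_congr rfl fun i _ => by ring

theorem formInner_zero_left {k : ℕ} (e : ι → E) (β : E [⋀^Fin k]→L[ℝ] ℂ) :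
    formInner e 0 β = 0 := by simp [formInner]

theorem formInner_zero_right {k : ℕ} (e : ι → E) (β : E [⋀^Fin k]→L[ℝ] ℂ) :
    formInner e β 0 = 0 := by simp [formInner]

theorem formInner_sum_left {k : ℕ} {κ : Type*} (s : Finset κ) (e : ι → E)
    (α : κ → E [⋀^Fin k]→L[ℝ] ℂ) (β : E [⋀^Fin k]→L[ℝ] ℂ) :
    formInner e (∑ i ∈ s, α i) β = ∑ i ∈ s, formInner e (α i) β := by
  classical
  induction s using Finset.induction_on with
  | empty => simp [formInner_zero_left]
  | insert i s hi ih => rw [Finset.sum_insert hi, Finset.sum_insert hi, formInner_add_left, ih]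

theorem formInner_sum_right {k : ℕ} {κ : Type*} (s : Finset κ) (e : ι → E)
    (α : E [⋀^Fin k]→L[ℝ] ℂ) (β : κ → E [⋀^Fin k]→L[ℝ] ℂ) :
    formInner e α (∑ i ∈ s, β i) = ∑ i ∈ s, formInner e α (β i) := by
  classical
  induction s using Finset.induction_on with
  | empty => simp [formInner_zero_right]
  | insert i s hi ih => rw [Finset.sum_insert hi, Finset.sum_insert hi, formInner_add_right, ih]

variable [FiniteDimensional ℝ E]

/-- Contraction with a vector of the basis is adjoint to multiplication by the corresponding
covector of the dual basis. -/
theorem formInner_extMulCLM [DecidableEq ι] (e : Module.Basis ι ℝ E) (a : ι) {k : ℕ}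
    (α : E [⋀^Fin k]→L[ℝ] ℂ) (β : E [⋀^Fin (k + 1)]→L[ℝ] ℂ) :
    formInner e (extMulCLM (dual e a) k α) β = formInner e α (contrCLM (e a) k β) := by
  have h : ∀ j : Fin (k + 1), ∑ i : Fin (k + 1) → ι,
      (-1 : ℂ) ^ (j : ℕ) * (((dual e a (e (i j)) : ℝ) : ℂ) * α (e ∘ j.removeNth i)) *
        starRingEnd ℂ (β (e ∘ i)) =
      ∑ i : Fin k → ι, α (e ∘ i) * starRingEnd ℂ (contrCLM (e a) k β (e ∘ i)) := by
    intro j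
    -- Split the multi-index into its j-th entry and the rest. Only the entry a survives, and moving
    -- it to the front of β gives a sign (-1)^j that cancels the one from the exterior product.
    rw [← (Fin.insertNthEquiv (fun _ => ι) j).sum_comp, Fintype.sum_prod_type,
      Finset.sum_eq_single a]
    · refine Finset.sum_congr rfl fun i _ => ?_
      have h₁ : ⇑e ∘ (j.insertNth a i : Fin (k + 1) → ι) = j.insertNth (e a) (e ∘ i) := by
        funext l
        refine Fin.succAboveCases j ?_ (fun l => ?_) l <;> simp
      have h₂ : (-1 : ℂ) ^ (j : ℕ) * (-1) ^ (j : ℕ) = 1 := by rw [← mul_pow]; simp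
      simp only [Fin.insertNthEquiv, Equiv.coe_fn_mk, Fin.insertNth_apply_same,
        Fin.removeNth_insertNth, h₁, apply_insertNth, contrCLM_apply, dual_apply, map_mul, map_pow,
        map_neg, map_one]
      simp only [Module.Basis.repr_self, Finsupp.single_eq_same, Complex.ofReal_one, one_mul]
      linear_combination (α (e ∘ i) * starRingEnd ℂ (β (Fin.cons (e a) (e ∘ i)))) * h₂
    · intro c _ hc
      refine Finset.sum_eq_zero fun i _ => ?_
      simp [Fin.insertNthEquiv, dual_apply, Finsupp.single_eq_of_ne, hc.symm]
    · simp
  have h₁ : ∀ i : Fin (k + 1) → ι, extMulCLM (dual e a) k α (e ∘ i) * starRingEnd ℂ (β (e ∘ i)) =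
      ∑ j : Fin (k + 1), (-1 : ℂ) ^ (j : ℕ) * (((dual e a (e (i j)) : ℝ) : ℂ) *
        α (e ∘ j.removeNth i)) * starRingEnd ℂ (β (e ∘ i)) := by
    intro i
    rw [extMulCLM_apply, Finset.sum_mul]
    refine Finset.sum_congr rfl fun j _ => ?_
    congr 1
    simp only [zsmul_eq_mul, Complex.real_smul]
    push_cast
    rfl
  have hk : ((k : ℂ) + 1) ≠ 0 := by exact_mod_cast k.succ_ne_zero
  have hk' : (k.factorial : ℂ) ≠ 0 := by exact_mod_cast k.factorial_ne_zero
  -- The k + 1 positions j contribute equally, which turns 1/(k+1)! into 1/k!.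
  rw [formInner, formInner, Finset.sum_congr rfl fun i _ => h₁ i, Finset.sum_comm,
    Finset.sum_congr rfl fun j _ => h j, Finset.sum_const, Finset.card_univ, Fintype.card_fin,
    Nat.factorial_succ, nsmul_eq_mul]
  push_cast
  field_simp

namespace QuatHermitian

variable {Q : QuatHermitian E} [DecidableEq ι] {e : Module.Basis ι ℝ E}

/-- The right-hand side is the formal adjoint of multiplication by Ω. On forms of type (k, 0)
contraction with Kv = IJv is √-1 times contraction with Jv, so the two halves of the conjugate of Ω
add up to a single contraction with Je_j. -/
theorem IsON.lam_apply_eq (he : Q.IsON e) {ζ : AltForm E} (hζ : ∀ k, IsHolomorphicType Q.I (ζ k)) :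
    Q.lam e ζ = (2⁻¹ : ℂ) • ∑ i, ∑ j, starRingEnd ℂ (Q.Om ![e i, e j]) •
      contr (e j) (contr (e i) ζ) := by
  have h : ∀ j, ∑ i, starRingEnd ℂ (Q.Om ![e i, e j]) • contr (e i) ζ = contr (Q.J (e j)) ζ := by
    intro j
    have h₁ := LinearMap.congr_fun (he.sum_contr (Q.J (e j))) ζ
    have h₂ := LinearMap.congr_fun (he.sum_contr (Q.K (e j))) ζ
    rw [← Q.IJ, contr_I hζ] at h₂
    simp only [LinearMap.sum_apply, LinearMap.smul_apply] at h₁ h₂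
    have h₃ : ∀ i, starRingEnd ℂ (Q.Om ![e i, e j]) • contr (e i) ζ =
        (2⁻¹ : ℂ) • (Q.g (e i) (Q.J (e j)) : ℂ) • contr (e i) ζ -
        ((2⁻¹ : ℂ) * Complex.I) • (Q.g (e i) (Q.I (Q.J (e j))) : ℂ) • contr (e i) ζ := by
      intro i
      rw [smul_smul, smul_smul, ← sub_smul, Q.Om_apply, ← Q.IJ]
      congr 1
      simp [Complex.conj_ofNat]
      ring
    rw [Finset.sum_congr rfl fun i _ => h₃ i, Finset.sum_sub_distrib, ← Finset.smul_sum,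
      ← Finset.smul_sum, h₁, h₂, smul_smul, mul_assoc, Complex.I_mul_I]
    module
  have h₄ : ∀ j, contr (Q.J (e j)) (contr (e j) ζ) = -contr (e j) (contr (Q.J (e j)) ζ) :=
    fun j => LinearMap.congr_fun (contr_contr (Q.J (e j)) (e j)) ζ
  rw [he.lam_eq, Finset.sum_comm]
  simp only [LinearMap.neg_apply, LinearMap.smul_apply, LinearMap.sum_apply, Module.End.mul_apply,
    h₄, Finset.sum_neg_distrib, smul_neg, neg_neg]
  congr 1
  refine Finset.sum_congr rfl fun j _ => ?_
  rw [← h j, map_sum]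
  simp only [map_smul]

/-- `Q.lam` is adjoint to the multiplication by the standard form. -/
theorem IsON.formInner_wedgeTwo (he : Q.IsON e) (η : AltForm E) {ζ : AltForm E}
    (hζ : ∀ k, IsHolomorphicType Q.I (ζ k)) (k : ℕ) :
    formInner e (wedgeTwo e Q.Om η (k + 2)) (ζ (k + 2)) =
      formInner e (η k) (Q.lam e ζ k) := by
  rw [he.lam_apply_eq hζ, wedgeTwo]
  simp only [LinearMap.smul_apply, LinearMap.sum_apply, Module.End.mul_apply, AltForm.smul_apply,
    AltForm.sum_apply, formInner_smul_left, formInner_smul_right, formInner_sum_left,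
    formInner_sum_right, extMul_succ, formInner_extMulCLM, Complex.conj_conj, contr_apply]
  simp [Complex.conj_ofNat]

theorem IsON.sum_formInner_wedgeTwo (he : Q.IsON e) (η : AltForm E) {ζ : AltForm E}
    (hζ : ∀ k, IsHolomorphicType Q.I (ζ k)) :
    ∑ k ∈ Finset.range (Module.finrank ℝ E + 1), formInner e (wedgeTwo e Q.Om η k) (ζ k) =
      ∑ k ∈ Finset.range (Module.finrank ℝ E + 1), formInner e (η k) (Q.lam e ζ k) := by
  set n := Module.finrank ℝ E
  have h₁ : ∀ k, n < k → formInner e (wedgeTwo e Q.Om η k) (ζ k) = 0 := by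
    intro k hk
    rw [eq_zero_of_finrank_lt hk (ζ k), formInner_zero_right]
  simp only [← he.formInner_wedgeTwo η hζ]
  -- After the adjunction the two sums differ by a shift of the degree by two: multiplication by Ω
  -- has no components in degrees 0 and 1, and ζ vanishes in degrees n + 1 and n + 2.
  have h₂ := Finset.sum_range_succ (fun k => formInner e (wedgeTwo e Q.Om η k) (ζ k)) (n + 1)
  have h₃ := Finset.sum_range_succ (fun k => formInner e (wedgeTwo e Q.Om η k) (ζ k)) (n + 2)
  have h₄ := Finset.sum_range_succ' (fun k => formInner e (wedgeTwo e Q.Om η k) (ζ k)) (n + 2)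
  have h₅ := Finset.sum_range_succ' (fun k => formInner e (wedgeTwo e Q.Om η (k + 1)) (ζ (k + 1)))
    (n + 1)
  rw [h₁ _ (by omega)] at h₂ h₃
  rw [wedgeTwo_zero_degree, formInner_zero_left] at h₄
  rw [zero_add, wedgeTwo_one_degree, formInner_zero_left] at h₅
  linear_combination -h₂ - h₃ + h₄ + h₅

end QuatHermitian

end Adjoint

/-! ### Operators of multiplication by three-forms -/

section Cubic

variable {E : Type*} [NormedAddCommGroup E] [NormedSpace ℝ E]

variable (E) in
/-- The span of the products of three operators of exterior multiplication. -/
def cubic : Submodule ℂ (Module.End ℂ (AltForm E)) :=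
  Submodule.span ℂ {X | ∃ a b c : E →L[ℝ] ℝ, X = extMul a * extMul b * extMul c}

theorem extMul_mem_cubic (a b c : E →L[ℝ] ℝ) : extMul a * extMul b * extMul c ∈ cubic E :=
  Submodule.subset_span ⟨a, b, c, rfl⟩

theorem extMul_mul_wedgeTwo_mem_cubic [FiniteDimensional ℝ E] {ι : Type*} [Fintype ι]
    (b : Module.Basis ι ℝ E) (a : E →L[ℝ] ℝ) (β : E [⋀^Fin 2]→L[ℝ] ℂ) :
    extMul a * wedgeTwo b β ∈ cubic E := by
  simp only [wedgeTwo, mul_smul_comm, Finset.mul_sum]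
  refine Submodule.smul_mem _ _ (Submodule.sum_mem _ fun i _ => Submodule.sum_mem _ fun j _ =>
    Submodule.smul_mem _ _ ?_)
  rw [← mul_assoc]
  exact extMul_mem_cubic _ _ _

/-- The bracket with a derivation differentiates the three covectors in turn. -/
theorem der_mem_cubic {X : Module.End ℂ (AltForm E)} (hX : X ∈ cubic E) (A : E →L[ℝ] E) :
    der A * X - X * der A ∈ cubic E := by
  refine Submodule.span_induction (p := fun X _ => der A * X - X * der A ∈ cubic E)
    ?_ ?_ ?_ ?_ hX
  · rintro _ ⟨a, b, c, rfl⟩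
    have h : der A * (extMul a * extMul b * extMul c) - extMul a * extMul b * extMul c * der A =
        extMul (a.comp A) * extMul b * extMul c + extMul a * extMul (b.comp A) * extMul c +
          extMul a * extMul b * extMul (c.comp A) := by
      have h₁ := der_extMul A a
      have h₂ := der_extMul A b
      have h₃ := der_extMul A c
      linear_combination (norm := skip) h₁ * extMul b * extMul c + extMul a * h₂ * extMul c +
        extMul a * extMul b * h₃
      noncomm_ring
    rw [h]
    exact add_mem (add_mem (extMul_mem_cubic _ _ _) (extMul_mem_cubic _ _ _))
      (extMul_mem_cubic _ _ _)
  · simp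
  · intro X Y _ _ h h'
    convert add_mem h h' using 1
    noncomm_ring
  · intro r X _ h
    convert Submodule.smul_mem _ r h using 1
    rw [mul_smul_comm, smul_mul_assoc, smul_sub]

theorem extMul_mul_of_mem_cubic {X : Module.End ℂ (AltForm E)} (hX : X ∈ cubic E)
    (a : E →L[ℝ] ℝ) : X * extMul a = -(extMul a * X) := by
  refine Submodule.span_induction (p := fun X _ => X * extMul a = -(extMul a * X)) ?_ ?_ ?_ ?_ hX
  · rintro _ ⟨b, c, d, rfl⟩
    have h₁ := extMul_extMul a b
    have h₂ := extMul_extMul a c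
    have h₃ := extMul_extMul a d
    linear_combination (norm := skip) extMul b * extMul c * h₃ - extMul b * h₂ * extMul d +
      h₁ * extMul c * extMul d
    noncomm_ring
  · simp
  · intro X Y _ _ h h'
    rw [add_mul, h, h']; noncomm_ring
  · intro r X _ h
    rw [smul_mul_assoc, h, mul_smul_comm, smul_neg]

theorem smul_zero_form {k : ℕ} (c : ℂ) : c • (0 : E [⋀^Fin k]→L[ℝ] ℂ) = 0 :=
  smul_zero (A := E [⋀^Fin k]→L[ℝ] ℂ) c

theorem degree_of_mem_cubic {X : Module.End ℂ (AltForm E)} (hX : X ∈ cubic E) :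
    (∀ η, X η 0 = 0 ∧ X η 1 = 0 ∧ X η 2 = 0) ∧
      ∀ (η ζ : AltForm E) (k : ℕ), η k = ζ k → X η (k + 3) = X ζ (k + 3) := by
  refine Submodule.span_induction (p := fun X _ => (∀ η, X η 0 = 0 ∧ X η 1 = 0 ∧ X η 2 = 0) ∧
      ∀ (η ζ : AltForm E) (k : ℕ), η k = ζ k → X η (k + 3) = X ζ (k + 3)) ?_ ?_ ?_ ?_ hX
  · rintro _ ⟨a, b, c, rfl⟩
    refine ⟨fun η => ⟨rfl, ?_, ?_⟩, fun η ζ k h => ?_⟩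
    · simp [Module.End.mul_apply, extMul_succ]
    · simp [Module.End.mul_apply, extMul_succ]
    · simp [Module.End.mul_apply, extMul_succ, h]
  · exact ⟨fun η => ⟨rfl, rfl, rfl⟩, fun η ζ k _ => rfl⟩
  · intro X Y _ _ h h'
    refine ⟨fun η => ?_, fun η ζ k hk => ?_⟩
    · simp [h.1 η, h'.1 η]
    · simp [h.2 η ζ k hk, h'.2 η ζ k hk]
  · intro r X _ h
    refine ⟨fun η => ?_, fun η ζ k hk => ?_⟩
    · simp only [LinearMap.smul_apply, AltForm.smul_apply, h.1 η]
      exact ⟨smul_zero_form r, smul_zero_form r, smul_zero_form r⟩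
    · simp [h.2 η ζ k hk]

/-- An operator of multiplication by a three-form is determined by the three-form. -/
theorem eq_zero_of_mem_cubic [FiniteDimensional ℝ E] {X : Module.End ℂ (AltForm E)}
    (hX : X ∈ cubic E) (h₁ : X oneForm = 0) : X = 0 := by
  obtain ⟨hlow, hdeg⟩ := degree_of_mem_cubic hX
  have key : ∀ k η, X η (k + 3) = 0 := by
    intro k
    induction k with
    | zero =>
      intro η
      -- A form of degree zero is a constant, so X on it is a multiple of the value on 1.
      have h : η 0 = (η 0 ![] • oneForm : AltForm E) 0 := by
        ext w
        rw [AltForm.smul_apply]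
        refine Eq.trans ?_ (mul_one _).symm
        exact congrArg (η 0) (Subsingleton.elim _ _)
      rw [hdeg η _ 0 h, map_smul, h₁, smul_zero]
      rfl
    | succ k ih =>
      intro η
      let b := Module.finBasis ℝ E
      -- By the Euler identity (k+1)η is the sum of e^i ∧ ι_{e_i} η in degree k + 1. As X
      -- anticommutes with covectors, its value there is determined by its values in degree k.
      have h := der_eq_sum b (ContinuousLinearMap.id ℝ E)
      have h₂ : η (k + 1) = (((k : ℂ) + 1)⁻¹ • der (ContinuousLinearMap.id ℝ E) η) (k + 1) := by
        have hk : ((k : ℂ) + 1) ≠ 0 := by exact_mod_cast k.succ_ne_zero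
        rw [AltForm.smul_apply, der_id_apply, smul_smul]
        push_cast
        rw [inv_mul_cancel₀ hk, one_smul]
      rw [show k + 1 + 3 = (k + 1) + 3 from rfl, hdeg η _ (k + 1) h₂, map_smul, h]
      have h₃ : ∀ i, X (extMul (dual b i) (contr (b i) η)) =
          -extMul (dual b i) (X (contr (b i) η)) := fun i =>
        LinearMap.congr_fun (extMul_mul_of_mem_cubic hX (dual b i)) (contr (b i) η)
      have h₄ : X ((∑ i, extMul (dual b i) * contr (ContinuousLinearMap.id ℝ E (b i))) η)
          (k + 1 + 3) = 0 := by
        simp only [LinearMap.sum_apply, Module.End.mul_apply, ContinuousLinearMap.id_apply, map_sum,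
          h₃, AltForm.sum_apply, AltForm.neg_apply]
        refine Finset.sum_eq_zero fun i _ => ?_
        rw [show k + 1 + 3 = (k + 3) + 1 from rfl, extMul_succ, ih, map_zero, neg_zero]
      rw [AltForm.smul_apply, h₄]
      exact smul_zero_form _
  refine LinearMap.ext fun η => funext fun k => ?_
  match k with
  | 0 => exact (hlow η).1
  | 1 => exact (hlow η).2.1
  | 2 => exact (hlow η).2.2
  | k + 3 => exact key k η

end Cubic

end HKT
end

noncomputable section

namespace HKT

/-! ## Local calculus of differential forms -/

section LocalCalculus

set_option linter.unusedSectionVars false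

variable {E : Type*} [NormedAddCommGroup E] [NormedSpace ℝ E] [FiniteDimensional ℝ E]

/-- The Euler identity lets statements on families of forms be proved by induction on the degree: a
form is recovered linearly from its contractions with a basis. -/
theorem sum_extMulCLM_contrCLM {ι : Type*} [Fintype ι] (b : Module.Basis ι ℝ E) {k : ℕ}
    (α : E [⋀^Fin (k + 1)]→L[ℝ] ℂ) :
    α = ((k : ℝ) + 1)⁻¹ • ∑ i, extMulCLM (dual b i) k (contrCLM (b i) k α) := by
  have hk : ((k : ℝ) + 1) ≠ 0 := by exact_mod_cast k.succ_ne_zero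
  -- The form is placed in its degree and extended by zero, so that the identity between operators
  -- on forms of all degrees applies.
  let η : AltForm E := Function.update 0 (k + 1) α
  have hη : η (k + 1) = α := Function.update_self (k + 1) α (0 : ∀ k : ℕ, E [⋀^Fin k]→L[ℝ] ℂ)
  have h := congrFun (LinearMap.congr_fun (der_eq_sum b (ContinuousLinearMap.id ℝ E)) η) (k + 1)
  rw [der_id_apply, hη, LinearMap.sum_apply, AltForm.sum_apply] at h
  simp only [Module.End.mul_apply, extMul_succ, contr_apply, hη, ContinuousLinearMap.id_apply] at h
  rw [← h]
  ext w
  simp only [ContinuousAlternatingMap.smul_apply, smul_eq_mul, Complex.real_smul]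
  push_cast
  rw [inv_mul_cancel_left₀]
  exact_mod_cast hk

variable {n : WithTop ℕ∞}

/-- A family of forms is smooth if all its values are. -/
theorem contDiffAt_form {k : ℕ} {F : E → E [⋀^Fin k]→L[ℝ] ℂ} {z : E}
    (h : ∀ w, ContDiffAt ℝ n (fun y => F y w) z) : ContDiffAt ℝ n F z := by
  induction k with
  | zero =>
    have hF : F = fun y => ContinuousAlternatingMap.constOfIsEmptyLIE ℝ E ℂ (Fin 0) (F y ![]) := by
      funext y
      ext w
      exact congrArg (F y) (Subsingleton.elim _ _)
    rw [hF]
    exact (ContinuousAlternatingMap.constOfIsEmptyLIE ℝ E ℂ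
      (Fin 0)).toContinuousLinearEquiv.contDiff.contDiffAt.comp z (h ![])
  | succ k ih =>
    let b := Module.finBasis ℝ E
    have hF : F = fun y => ((k : ℝ) + 1)⁻¹ • ∑ i, extMulCLM (dual b i) k (contrCLM (b i) k (F y)) :=
      funext fun y => sum_extMulCLM_contrCLM b (F y)
    rw [hF]
    refine ContDiffAt.const_smul _ (ContDiffAt.sum fun i _ => ?_)
    refine (extMulCLM (dual b i) k).contDiff.contDiffAt.comp z (ih fun w => ?_)
    exact h _

/-- The values of a smooth family of forms on smooth vectors are smooth. -/
theorem contDiffAt_form_apply {k : ℕ} {F : E → E [⋀^Fin k]→L[ℝ] ℂ} {w : E → Fin k → E} {z : E}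
    (hF : ContDiffAt ℝ n F z) (hw : ∀ j, ContDiffAt ℝ n (fun y => w y j) z) :
    ContDiffAt ℝ n (fun y => F y (w y)) z := by
  induction k with
  | zero =>
    have h : (fun y => F y (w y)) = fun y =>
        (ContinuousAlternatingMap.constOfIsEmptyLIE ℝ E ℂ (Fin 0)).symm (F y) := by
      funext y
      rw [LinearIsometryEquiv.eq_symm_apply]
      ext v
      exact congrArg (F y) (Subsingleton.elim _ _)
    rw [h]
    exact (ContinuousAlternatingMap.constOfIsEmptyLIE ℝ E ℂ
      (Fin 0)).symm.toContinuousLinearEquiv.contDiff.contDiffAt.comp z hF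
  | succ k ih =>
    let b := Module.finBasis ℝ E
    have h : (fun y => F y (w y)) = fun y => ∑ i, dual b i (w y 0) •
        contrCLM (b i) k (F y) (Fin.tail (w y)) := by
      funext y
      have h₁ : ∑ i, dual b i (w y 0) • contrCLM (b i) k (F y) = contrCLM (w y 0) k (F y) := by
        have h₂ : (F y).curryLeft (w y 0) =
            ∑ i, dual b i (w y 0) • (F y).curryLeft (b i) := by
          conv_lhs => rw [← sum_dual_smul b (w y 0)]
          rw [map_sum]; simp only [map_smul]
        exact h₂.symm
      have h₃ := congrArg (fun α => α (Fin.tail (w y))) h₁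
      simp only [ContinuousAlternatingMap.sum_apply, ContinuousAlternatingMap.smul_apply,
        contrCLM_apply, Fin.cons_self_tail] at h₃
      exact h₃.symm
    rw [h]
    refine ContDiffAt.sum fun i _ => ContDiffAt.fun_smul ?_ ?_
    · exact (dual b i).contDiff.contDiffAt.comp z (hw 0)
    · exact ih ((contrCLM (b i) k).contDiff.contDiffAt.comp z hF) fun j => hw j.succ

theorem contDiffAt_form_comp {k : ℕ} {F : E → E [⋀^Fin k]→L[ℝ] ℂ} {f : E → E →L[ℝ] E} {z : E}
    (hF : ContDiffAt ℝ n F z) (hf : ContDiffAt ℝ n f z) :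
    ContDiffAt ℝ n (fun y => (F y).compContinuousLinearMap (f y)) z :=
  contDiffAt_form fun w => contDiffAt_form_apply (w := fun y j => f y (w j)) hF fun _ =>
    hf.clm_apply contDiffAt_const

/-- A family of continuous linear maps is smooth if all its values are. -/
theorem contDiffAt_clm {G : Type*} [NormedAddCommGroup G] [NormedSpace ℝ G] {f : E → E →L[ℝ] G}
    {z : E} (h : ∀ v, ContDiffAt ℝ n (fun y => f y v) z) : ContDiffAt ℝ n f z := by
  let b := Module.finBasis ℝ E
  have hf : f = fun y => ∑ i, ContinuousLinearMap.smulRightL ℝ E G (dual b i) (f y (b i)) := by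
    funext y
    ext v
    conv_lhs => rw [← sum_dual_smul b v]
    simp
  rw [hf]
  exact ContDiffAt.sum fun i _ =>
    (ContinuousLinearMap.smulRightL ℝ E G (dual b i)).contDiff.contDiffAt.comp z (h (b i))

/-- Smoothness at a point of a family of forms. -/
def SmoothAt (F : E → AltForm E) (z : E) : Prop := ∀ k, ContDiffAt ℝ ∞ (fun y => F y k) z

namespace SmoothAt

variable {F G : E → AltForm E} {z : E}

theorem congr (hF : SmoothAt F z) (h : ∀ᶠ y in nhds z, G y = F y) : SmoothAt G z := fun k =>
  (hF k).congr_of_eventuallyEq (h.mono fun _ hy => congrFun hy k)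

theorem add (hF : SmoothAt F z) (hG : SmoothAt G z) : SmoothAt (fun y => F y + G y) z :=
  fun k => (hF k).add (hG k)

theorem const_smul (hF : SmoothAt F z) (c : ℂ) : SmoothAt (fun y => c • F y) z :=
  fun k => (hF k).const_smul c

theorem neg (hF : SmoothAt F z) : SmoothAt (fun y => -F y) z := fun k => (hF k).neg

theorem smul (hF : SmoothAt F z) {c : E → ℂ} (hc : ContDiffAt ℝ ∞ c z) :
    SmoothAt (fun y => c y • F y) z := fun k => hc.smul (hF k)

theorem sum {κ : Type*} {s : Finset κ} {F : κ → E → AltForm E}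
    (hF : ∀ i ∈ s, SmoothAt (F i) z) : SmoothAt (fun y => ∑ i ∈ s, F i y) z := by
  intro k
  simp only [AltForm.sum_apply]
  exact ContDiffAt.sum fun i hi => hF i hi k

theorem contr (hF : SmoothAt F z) {v : E → E} (hv : ContDiffAt ℝ ∞ v z) :
    SmoothAt (fun y => contr (v y) (F y)) z := by
  refine fun k => contDiffAt_form fun w => ?_
  refine contDiffAt_form_apply (w := fun y => Fin.cons (v y) w) (hF (k + 1)) fun j => ?_
  refine Fin.cases ?_ (fun j => ?_) j
  · simpa using hv
  · simpa using contDiffAt_const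

theorem extMul (hF : SmoothAt F z) (a : E →L[ℝ] ℝ) : SmoothAt (fun y => extMul a (F y)) z := by
  intro k
  cases k with
  | zero => exact contDiffAt_const
  | succ k => exact (extMulCLM a k).contDiff.contDiffAt.comp z (hF k)

theorem der (hF : SmoothAt F z) {A : E → E →L[ℝ] E} (hA : ContDiffAt ℝ ∞ A z) :
    SmoothAt (fun y => der (A y) (F y)) z := by
  refine fun k => contDiffAt_form fun w => ?_
  simp only [der_apply, derCLM_apply]
  refine ContDiffAt.sum fun i _ => contDiffAt_form_apply (hF k) fun j => ?_
  by_cases h : j = i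
  · subst h
    simpa using hA.clm_apply contDiffAt_const
  · simpa [h] using contDiffAt_const

theorem pull (hF : SmoothAt F z) {f : E → E →L[ℝ] E} (hf : ContDiffAt ℝ ∞ f z) :
    SmoothAt (fun y => pull (f y) (F y)) z := fun k => contDiffAt_form_comp (hF k) hf

theorem wedgeTwo {ι : Type*} [Fintype ι] (b : Module.Basis ι ℝ E) (hF : SmoothAt F z)
    {β : E → E [⋀^Fin 2]→L[ℝ] ℂ} (hβ : ContDiffAt ℝ ∞ β z) :
    SmoothAt (fun y => wedgeTwo b (β y) (F y)) z := by
  simp only [HKT.wedgeTwo, LinearMap.smul_apply, LinearMap.sum_apply, Module.End.mul_apply]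
  refine (SmoothAt.sum fun i _ => SmoothAt.sum fun j _ => ?_).const_smul _
  exact ((hF.extMul _).extMul _).smul (contDiffAt_form_apply hβ fun _ => contDiffAt_const)

end SmoothAt

/-- Differentiability at a point of a family of forms. -/
def DiffAt (F : E → AltForm E) (z : E) : Prop := ∀ k, DifferentiableAt ℝ (fun y => F y k) z

theorem SmoothAt.diffAt {F : E → AltForm E} {z : E} (h : SmoothAt F z) : DiffAt F z := fun k =>
  (h k).differentiableAt (by simp)

/-- The derivative of a family of forms in the direction of a vector. -/
def pd (F : E → AltForm E) (z v : E) : AltForm E := fun k => fderiv ℝ (fun y => F y k) z v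

/-- The exterior derivative of a family of forms. -/
def dLoc (F : E → AltForm E) (z : E) : AltForm E
  | 0 => 0
  | k + 1 => extDeriv (fun y => F y k) z

theorem SmoothAt.dLoc {F : E → AltForm E} {z : E} (hF : SmoothAt F z) : SmoothAt (dLoc F) z := by
  intro k
  cases k with
  | zero => exact contDiffAt_const
  | succ k =>
    exact (ContinuousAlternatingMap.alternatizeUncurryFinCLM ℝ E ℂ).contDiff.contDiffAt.comp z
      ((hF k).fderiv_right (m := ∞) (by simp))

theorem dLoc_congr {F G : E → AltForm E} {z : E} (h : ∀ᶠ y in nhds z, F y = G y) :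
    dLoc F z = dLoc G z := by
  funext k
  cases k with
  | zero => rfl
  | succ k => exact Filter.EventuallyEq.extDeriv_eq (h.mono fun _ hy => congrFun hy k)

theorem dLoc_dLoc {F : E → AltForm E} {z : E} (hF : SmoothAt F z) : dLoc (dLoc F) z = 0 := by
  funext k
  match k with
  | 0 => rfl
  | 1 =>
    change extDeriv (fun _ => (0 : E [⋀^Fin 0]→L[ℝ] ℂ)) z = 0
    rw [extDeriv, fderiv_const_apply]
    exact map_zero (ContinuousAlternatingMap.alternatizeUncurryFinCLM ℝ E ℂ)
  | k + 2 =>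
    exact extDeriv_extDeriv_apply (hF k) (by
      rw [minSmoothness_of_isRCLikeNormedField]
      exact WithTop.coe_le_coe.2 le_top)

variable {ι : Type*} [Fintype ι] (b : Module.Basis ι ℝ E)

theorem dLoc_eq (F : E → AltForm E) (z : E) :
    dLoc F z = ∑ l, extMul (dual b l) (pd F z (b l)) := by
  funext k
  rw [AltForm.sum_apply]
  cases k with
  | zero => simp [dLoc]
  | succ k =>
    have h : fderiv ℝ (fun y => F y k) z = ∑ l, ContinuousLinearMap.smulRightL ℝ E _ (dual b l)
        (fderiv ℝ (fun y => F y k) z (b l)) := by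
      ext1 v
      conv_lhs => rw [← sum_dual_smul b v]
      simp
    change ContinuousAlternatingMap.alternatizeUncurryFinCLM ℝ E ℂ (fderiv ℝ (fun y => F y k) z) = _
    rw [h, map_sum]
    rfl

end LocalCalculus
end HKT
end

/-! ### Derivatives of families of forms and the two identities expressing integrability -/

noncomputable section

namespace HKT

section LocalIdentities

set_option linter.unusedSectionVars false

variable {E : Type*} [NormedAddCommGroup E] [NormedSpace ℝ E] [FiniteDimensional ℝ E]
  {F : E → AltForm E} {z : E} {A : E → E →L[ℝ] E}

/-- The derivation is a continuous bilinear expression B in the form and the endomorphism, so this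
is the product rule. -/
theorem hasFDerivAt_der (hA : DifferentiableAt ℝ A z) (hF : DiffAt F z) (k : ℕ) :
    HasFDerivAt (fun y => der (A y) (F y) k)
      ((derCLM (A z) k).comp (fderiv ℝ (fun y => F y k) z) +
        ((ContinuousAlternatingMap.fderivCompContinuousLinearMapCLM (𝕜 := ℝ) (ι := Fin k) (G := ℂ)
          (ContinuousLinearMap.id ℝ E)) (F z k)).comp (fderiv ℝ A z)) z := by
  let B : (E [⋀^Fin k]→L[ℝ] ℂ) →L[ℝ] (E →L[ℝ] E) →L[ℝ] (E [⋀^Fin k]→L[ℝ] ℂ) :=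
    ContinuousAlternatingMap.fderivCompContinuousLinearMapCLM ℂ (ContinuousLinearMap.id ℝ E)
  have hB : HasFDerivAt (𝕜 := ℝ) (E := E [⋀^Fin k]→L[ℝ] ℂ)
      (F := (E →L[ℝ] E) →L[ℝ] (E [⋀^Fin k]→L[ℝ] ℂ)) B B (F z k) :=
    ContinuousLinearMap.hasFDerivAt (𝕜 := ℝ) (E := E [⋀^Fin k]→L[ℝ] ℂ)
      (F := (E →L[ℝ] E) →L[ℝ] (E [⋀^Fin k]→L[ℝ] ℂ)) B
  have h₁ : HasFDerivAt (fun y => B (F y k)) (B.comp (fderiv ℝ (fun y => F y k) z)) z :=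
    HasFDerivAt.comp (g := B) z hB (hF k).hasFDerivAt
  have h₂ := h₁.clm_apply hA.hasFDerivAt
  refine h₂.congr_fderiv ?_
  ext1 v
  simp only [add_apply, ContinuousLinearMap.comp_apply, ContinuousLinearMap.flip_apply]
  rw [add_comm]
  rfl

theorem diffAt_der (hA : DifferentiableAt ℝ A z) (hF : DiffAt F z) :
    DiffAt (fun y => der (A y) (F y)) z := fun k => (hasFDerivAt_der hA hF k).differentiableAt

theorem pd_der (hA : DifferentiableAt ℝ A z) (hF : DiffAt F z) (v : E) :
    pd (fun y => der (A y) (F y)) z v = der (A z) (pd F z v) + der (fderiv ℝ A z v) (F z) := by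
  funext k
  change fderiv ℝ (fun y => der (A y) (F y) k) z v = _
  rw [(hasFDerivAt_der hA hF k).fderiv]
  rfl

theorem pd_smul {c : E → ℂ} (hc : DifferentiableAt ℝ c z) (hF : DiffAt F z) (v : E) :
    pd (fun y => c y • F y) z v = fderiv ℝ c z v • F z + c z • pd F z v := by
  funext k
  have h := (hc.hasFDerivAt.fun_smul (hF k).hasFDerivAt).fderiv
  change fderiv ℝ (fun y => c y • F y k) z v = _
  rw [h, add_comm]
  rfl

theorem pd_extMul (hF : DiffAt F z) (a : E →L[ℝ] ℝ) (v : E) :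
    pd (fun y => extMul a (F y)) z v = extMul a (pd F z v) := by
  funext k
  cases k with
  | zero =>
    change fderiv ℝ (fun _ => (0 : E [⋀^Fin 0]→L[ℝ] ℂ)) z v = 0
    rw [fderiv_const_apply]
    rfl
  | succ k =>
    have h := ((extMulCLM a k).hasFDerivAt.comp z (hF k).hasFDerivAt).fderiv
    change fderiv ℝ (fun y => extMulCLM a k (F y k)) z v = _
    exact congrArg (fun L => L v) h

theorem diffAt_extMul (hF : DiffAt F z) (a : E →L[ℝ] ℝ) : DiffAt (fun y => extMul a (F y)) z := by
  intro k
  cases k with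
  | zero => exact differentiableAt_const _
  | succ k => exact ((extMulCLM a k).hasFDerivAt.comp z (hF k).hasFDerivAt).differentiableAt

theorem diffAt_smul {c : E → ℂ} (hc : DifferentiableAt ℝ c z) (hF : DiffAt F z) :
    DiffAt (fun y => c y • F y) z := fun k => hc.fun_smul (hF k)

theorem pd_sum {κ : Type*} {s : Finset κ} {F : κ → E → AltForm E} (hF : ∀ i ∈ s, DiffAt (F i) z)
    (v : E) : pd (fun y => ∑ i ∈ s, F i y) z v = ∑ i ∈ s, pd (F i) z v := by
  funext k
  have h := fderiv_fun_sum (𝕜 := ℝ) (fun i hi => hF i hi k)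
  have h₁ : (fun y => (∑ i ∈ s, F i y) k) = fun y => ∑ i ∈ s, F i y k := by
    funext y
    rw [AltForm.sum_apply]
  change fderiv ℝ (fun y => (∑ i ∈ s, F i y) k) z v = _
  rw [h₁, h, AltForm.sum_apply, sum_apply]
  rfl

theorem diffAt_sum {κ : Type*} {s : Finset κ} {F : κ → E → AltForm E}
    (hF : ∀ i ∈ s, DiffAt (F i) z) : DiffAt (fun y => ∑ i ∈ s, F i y) z := by
  intro k
  simp only [AltForm.sum_apply]
  exact DifferentiableAt.fun_sum fun i hi => hF i hi k

variable {ι : Type*} [Fintype ι] (b : Module.Basis ι ℝ E)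

theorem pd_wedgeTwo {β : E → E [⋀^Fin 2]→L[ℝ] ℂ} (hβ : DifferentiableAt ℝ β z) (hF : DiffAt F z)
    (v : E) : pd (fun y => wedgeTwo b (β y) (F y)) z v =
      wedgeTwo b (fderiv ℝ β z v) (F z) + wedgeTwo b (β z) (pd F z v) := by
  have hc : ∀ i j, HasFDerivAt (fun y => β y ![b i, b j])
      ((ContinuousAlternatingMap.apply ℝ E ℂ ![b i, b j]).comp (fderiv ℝ β z)) z := fun i j =>
    (ContinuousAlternatingMap.apply ℝ E ℂ ![b i, b j]).hasFDerivAt.comp z hβ.hasFDerivAt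
  have h₂ : ∀ i j, DiffAt (fun y => extMul (dual b i) (extMul (dual b j) (F y))) z := fun i j =>
    diffAt_extMul (diffAt_extMul hF _) _
  have h₃ : ∀ i j, DiffAt (fun y => β y ![b i, b j] •
      extMul (dual b i) (extMul (dual b j) (F y))) z := fun i j =>
    diffAt_smul (hc i j).differentiableAt (h₂ i j)
  simp only [wedgeTwo, LinearMap.smul_apply, LinearMap.sum_apply, Module.End.mul_apply]
  rw [pd_smul (c := fun _ => (2⁻¹ : ℂ)) (differentiableAt_const _)
    (diffAt_sum fun i _ => diffAt_sum fun j _ => h₃ i j), fderiv_const_apply, zero_apply, zero_smul,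
    zero_add, pd_sum fun i _ => diffAt_sum fun j _ => h₃ i j, ← smul_add,
    ← Finset.sum_add_distrib]
  congr 1
  refine Finset.sum_congr rfl fun i _ => ?_
  rw [pd_sum fun j _ => h₃ i j, ← Finset.sum_add_distrib]
  refine Finset.sum_congr rfl fun j _ => ?_
  rw [pd_smul (hc i j).differentiableAt (h₂ i j), (hc i j).fderiv,
    pd_extMul (diffAt_extMul hF _), pd_extMul hF]
  rfl

/-- The Leibniz rule for functions. -/
theorem dLoc_smul {f : E → ℝ} (hf : DifferentiableAt ℝ f z) (hF : DiffAt F z) :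
    dLoc (fun y => (f y : ℂ) • F y) z = extMul (fderiv ℝ f z) (F z) + (f z : ℂ) • dLoc F z := by
  have hc : HasFDerivAt (fun y => (f y : ℂ)) (Complex.ofRealCLM.comp (fderiv ℝ f z)) z :=
    Complex.ofRealCLM.hasFDerivAt.comp z hf.hasFDerivAt
  let b := Module.finBasis ℝ E
  rw [dLoc_eq b, dLoc_eq b F, extMul_comp_eq_sum b (fderiv ℝ f z), Finset.smul_sum,
    LinearMap.sum_apply, ← Finset.sum_add_distrib]
  refine Finset.sum_congr rfl fun l _ => ?_
  rw [pd_smul hc.differentiableAt hF, hc.fderiv, map_add, map_smul, map_smul]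
  rfl

/-- The commutator of the exterior derivative and the multiplication by a two-form. -/
theorem dLoc_wedgeTwo {β : E → E [⋀^Fin 2]→L[ℝ] ℂ} (hβ : DifferentiableAt ℝ β z)
    (hF : DiffAt F z) : dLoc (fun y => wedgeTwo b (β y) (F y)) z =
      (∑ l, extMul (dual b l) * wedgeTwo b (fderiv ℝ β z (b l))) (F z) +
        wedgeTwo b (β z) (dLoc F z) := by
  rw [dLoc_eq b, dLoc_eq b F, map_sum, LinearMap.sum_apply, ← Finset.sum_add_distrib]
  refine Finset.sum_congr rfl fun l _ => ?_
  have h := LinearMap.congr_fun (extMul_wedgeTwo b (dual b l) (β z)) (pd F z (b l))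
  rw [pd_wedgeTwo b hβ hF, map_add]
  exact congrArg₂ (· + ·) rfl h

variable (A z) in
/-- The tensor whose antisymmetrization is the Nijenhuis tensor. -/
def nijTensor : E →L[ℝ] E →L[ℝ] E :=
  (fderiv ℝ A z).comp (A z) - (ContinuousLinearMap.compL ℝ E E E (A z)).comp (fderiv ℝ A z)

theorem nijTensor_apply (u v : E) :
    nijTensor z A u v = fderiv ℝ A z (A z u) v - A z (fderiv ℝ A z u v) := rfl

/-- Differentiate A² = -1. -/
theorem fderiv_anticomm (hA : DifferentiableAt ℝ A z)
    (hAA : ∀ᶠ y in nhds z, ∀ v, A y (A y v) = -v) (u v : E) :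
    fderiv ℝ A z u (A z v) = -A z (fderiv ℝ A z u v) := by
  have h₁ := hA.hasFDerivAt.clm_comp hA.hasFDerivAt
  have h₂ : (fun y => (A y).comp (A y)) =ᶠ[nhds z] fun _ => -ContinuousLinearMap.id ℝ E :=
    hAA.mono fun y hy => ContinuousLinearMap.ext hy
  have h₃ := h₂.fderiv_eq (𝕜 := ℝ)
  rw [h₁.fderiv, fderiv_const_apply] at h₃
  have h₄ := congrArg (fun L : E →L[ℝ] E →L[ℝ] E => L u v) h₃
  simp only [add_apply, ContinuousLinearMap.comp_apply, ContinuousLinearMap.compL_apply,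
    ContinuousLinearMap.flip_apply, zero_apply] at h₄
  rw [eq_neg_iff_add_eq_zero, add_comm]
  exact h₄

theorem der_fderiv_sum (v : E) : der (fderiv ℝ A z v) =
    ∑ i, (dual b i v : ℂ) • der (fderiv ℝ A z (b i)) := by
  conv_lhs => rw [← sum_dual_smul b v]
  simp only [map_sum, map_smul]
  classical
  induction (Finset.univ : Finset ι) using Finset.induction_on with
  | empty => simp [der_zero]
  | insert i s hi ih => rw [Finset.sum_insert hi, Finset.sum_insert hi, der_add, ih, der_smul]

theorem sum_extMul_comp_der (f : AltForm E) :
    ∑ l, extMul ((dual b l).comp (A z)) (der (fderiv ℝ A z (b l)) f) =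
      ∑ l, extMul (dual b l) (der (fderiv ℝ A z (A z (b l))) f) :=
  sum_extMul_comp b (A z) (fun v => der (fderiv ℝ A z v) f) fun v => by
    rw [der_fderiv_sum b v]
    simp only [LinearMap.sum_apply, LinearMap.smul_apply]

/-- For an integrable complex structure, the double commutator with the exterior derivative is
minus the exterior derivative. -/
theorem der_der_dLoc (hA : DifferentiableAt ℝ A z) (hF : DiffAt F z)
    (hAA : ∀ᶠ y in nhds z, ∀ v, A y (A y v) = -v)
    (hN : ∀ u v, nijTensor z A u v = nijTensor z A v u) :
    der (A z) (der (A z) (dLoc F z)) - (2 : ℂ) • der (A z) (dLoc (fun y => der (A y) (F y)) z) +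
      dLoc (fun y => der (A y) (der (A y) (F y))) z = -dLoc F z := by
  let b := Module.finBasis ℝ E
  have hd := diffAt_der hA hF
  have hz := hAA.self_of_nhds
  have hT := sum_extMul_der_eq_zero b (nijTensor z A) hN
  -- With d = Σ b^l ∧ ∂_l, the part involving derivatives of F is -d because b^l∘A∘A = -b^l. The
  -- rest is of order zero in F and contains only first derivatives of A; those cancel against each
  -- other after summation by integrability.
  have key : ∀ l, der (A z) (der (A z) (extMul (dual b l) (pd F z (b l)))) - (2 : ℂ) •
      der (A z) (extMul (dual b l) (der (A z) (pd F z (b l)) + der (fderiv ℝ A z (b l)) (F z))) +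
      extMul (dual b l) (der (A z) (der (A z) (pd F z (b l)) + der (fderiv ℝ A z (b l)) (F z)) +
        der (fderiv ℝ A z (b l)) (der (A z) (F z))) =
      -extMul (dual b l) (pd F z (b l)) +
        ((2 : ℂ) • extMul (dual b l) (der ((A z).comp (fderiv ℝ A z (b l))) (F z)) -
          (2 : ℂ) • extMul ((dual b l).comp (A z)) (der (fderiv ℝ A z (b l)) (F z))) := by
    intro l
    have h₁ := der_extMul (A z) (dual b l)
    have h₂ := der_extMul (A z) ((dual b l).comp (A z))
    have h₃ : extMul (((dual b l).comp (A z)).comp (A z)) = -extMul (dual b l) := by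
      have : ((dual b l).comp (A z)).comp (A z) = (-1 : ℝ) • dual b l := by
        ext v
        simp [hz]
      rw [this, extMul_smul]
      simp
    rw [h₃] at h₂
    have h₄ := der_der (fderiv ℝ A z (b l)) (A z)
    have h₅ : (A z).comp (fderiv ℝ A z (b l)) - (fderiv ℝ A z (b l)).comp (A z) =
        (2 : ℝ) • (A z).comp (fderiv ℝ A z (b l)) := by
      ext v
      simp only [sub_apply, ContinuousLinearMap.comp_apply, smul_apply,
        fderiv_anticomm hA hAA (b l) v]
      rw [sub_neg_eq_add, two_smul]
    rw [h₅, der_smul] at h₄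
    have e₁ : der (A z) * der (A z) * extMul (dual b l) -
        (2 : ℂ) • (der (A z) * extMul (dual b l) * der (A z)) +
        extMul (dual b l) * der (A z) * der (A z) = -extMul (dual b l) := by
      linear_combination (norm := skip) der (A z) * h₁ - h₁ * der (A z) + h₂
      rw [two_smul]
      noncomm_ring
    have e₂ : -((2 : ℂ) • (der (A z) * extMul (dual b l) * der (fderiv ℝ A z (b l)))) +
        extMul (dual b l) * (der (A z) * der (fderiv ℝ A z (b l)) +
          der (fderiv ℝ A z (b l)) * der (A z)) =
        (2 : ℂ) • (extMul (dual b l) * der ((A z).comp (fderiv ℝ A z (b l)))) -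
          (2 : ℂ) • (extMul ((dual b l).comp (A z)) * der (fderiv ℝ A z (b l))) := by
      linear_combination (norm := skip) -(h₁ * der (fderiv ℝ A z (b l))) -
        h₁ * der (fderiv ℝ A z (b l)) + extMul (dual b l) * h₄
      push_cast
      simp only [two_smul, mul_add]
      noncomm_ring
    have e₃ := LinearMap.congr_fun e₁ (pd F z (b l))
    have e₄ := LinearMap.congr_fun e₂ (F z)
    simp only [LinearMap.add_apply, LinearMap.sub_apply, LinearMap.neg_apply, LinearMap.smul_apply,
      Module.End.mul_apply, map_add] at e₃ e₄
    simp only [map_add, smul_add]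
    rw [← e₃, ← e₄]
    abel
  have hs := sum_extMul_comp_der b (A := A) (z := z) (F z)
  rw [dLoc_eq b F, dLoc_eq b, dLoc_eq b]
  simp only [pd_der hA hF, pd_der hA hd, map_sum, Finset.smul_sum]
  rw [← Finset.sum_sub_distrib, ← Finset.sum_add_distrib, Finset.sum_congr rfl fun l _ => key l,
    Finset.sum_add_distrib, Finset.sum_sub_distrib, ← Finset.smul_sum, ← Finset.smul_sum, hs,
    Finset.sum_neg_distrib, add_eq_left, ← smul_sub, ← Finset.sum_sub_distrib]
  have hT' := LinearMap.congr_fun hT (F z)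
  rw [LinearMap.sum_apply] at hT'
  -- The zeroth-order remainder is assembled from b^l ∧ der(`nijTensor` b_l), whose sum vanishes as
  -- the tensor is symmetric.
  have : ∀ l, extMul (dual b l) (der ((A z).comp (fderiv ℝ A z (b l))) (F z)) -
      extMul (dual b l) (der (fderiv ℝ A z (A z (b l))) (F z)) =
      -(extMul (dual b l) * der (nijTensor z A (b l))) (F z) := by
    intro l
    have : nijTensor z A (b l) = fderiv ℝ A z (A z (b l)) - (A z).comp (fderiv ℝ A z (b l)) := rfl
    rw [this, der_sub, Module.End.mul_apply, LinearMap.sub_apply, map_sub]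
    abel
  rw [Finset.sum_congr rfl fun l _ => this l, Finset.sum_neg_distrib, hT']
  simp

/-- Since B = -(BA)A, varying A in the direction B amounts to a derivation by -BA followed by
pullback. -/
theorem fderivCompContinuousLinearMap_eq (hz : ∀ v, A z (A z v) = -v) (B : E →L[ℝ] E) {k : ℕ}
    (α : E [⋀^Fin k]→L[ℝ] ℂ) : α.fderivCompContinuousLinearMap (A z) B =
      -(derCLM (B.comp (A z)) k α).compContinuousLinearMap (A z) := by
  ext w
  rw [ContinuousAlternatingMap.fderivCompContinuousLinearMap_apply,
    ContinuousAlternatingMap.neg_apply, ContinuousAlternatingMap.compContinuousLinearMap_apply,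
    derCLM_apply, ← Finset.sum_neg_distrib]
  refine Finset.sum_congr rfl fun i _ => ?_
  have h : (fun j => Function.update (fun _ => A z) i B j (w j)) =
      Function.update (A z ∘ w) i (B (w i)) := by
    funext j
    by_cases hj : j = i
    · subst hj; simp
    · simp [hj]
  rw [h]
  simp only [Function.comp_apply, ContinuousLinearMap.comp_apply, hz, map_neg]
  rw [← neg_one_smul ℝ (B (w i)), α.map_update_smul]
  simp

theorem pd_pull (hA : DifferentiableAt ℝ A z) (hF : DiffAt F z)
    (hz : ∀ v, A z (A z v) = -v) (v : E) : pd (fun y => pull (A y) (F y)) z v =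
      pull (A z) (pd F z v - der ((fderiv ℝ A z v).comp (A z)) (F z)) := by
  funext k
  have h := (HasFDerivAt.continuousAlternatingMapCompContinuousLinearMap (hF k).hasFDerivAt
    hA.hasFDerivAt).fderiv
  change fderiv ℝ (fun y => (F y k).compContinuousLinearMap (A y)) z v = _
  rw [h, add_apply, ContinuousLinearMap.comp_apply, ContinuousLinearMap.comp_apply,
    fderivCompContinuousLinearMap_eq hz, map_sub, sub_eq_add_neg]
  rfl

/-- For an integrable complex structure, conjugation by it turns the exterior derivative into
a commutator. -/
theorem pull_dLoc_pull (hA : DifferentiableAt ℝ A z) (hF : DiffAt F z)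
    (hAA : ∀ᶠ y in nhds z, ∀ v, A y (A y v) = -v)
    (hN : ∀ u v, nijTensor z A u v = nijTensor z A v u) :
    pull (-A z) (dLoc (fun y => pull (A y) (F y)) z) =
      dLoc (fun y => der (A y) (F y)) z - der (A z) (dLoc F z) := by
  let b := Module.finBasis ℝ E
  have hz := hAA.self_of_nhds
  -- Here the symmetric tensor is A∘`nijTensor`, which sends u to A(∂_{Au}A) + ∂_u A; these are the
  -- terms by which the two sides differ.
  have hT := sum_extMul_der_eq_zero b
    ((ContinuousLinearMap.compL ℝ E E E (A z)).comp (nijTensor z A)) fun u v =>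
      congrArg (A z) (hN u v)
  have hp : pull (-A z) * pull (A z) = 1 := by
    rw [pull_mul_pull, ← pull_id]
    congr 1
    ext v
    simp [hz]
  have key : ∀ l, pull (-A z) (extMul (dual b l)
      (pull (A z) (pd F z (b l) - der ((fderiv ℝ A z (b l)).comp (A z)) (F z)))) =
      -extMul ((dual b l).comp (A z)) (pd F z (b l)) -
        extMul ((dual b l).comp (A z)) (der ((A z).comp (fderiv ℝ A z (b l))) (F z)) := by
    intro l
    have h₁ := pull_extMul (-A z) (dual b l)
    have h₂ : extMul ((dual b l).comp (-A z)) = -extMul ((dual b l).comp (A z)) := by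
      have : (dual b l).comp (-A z) = (-1 : ℝ) • (dual b l).comp (A z) := by
        ext v; simp
      rw [this, extMul_smul]; simp
    have h₃ : (fderiv ℝ A z (b l)).comp (A z) = (-1 : ℝ) • (A z).comp (fderiv ℝ A z (b l)) := by
      ext v
      simp [fderiv_anticomm hA hAA]
    have h₄ : pull (-A z) * extMul (dual b l) * pull (A z) =
        -extMul ((dual b l).comp (A z)) := by
      rw [h₁, mul_assoc, hp, h₂, mul_one]
    refine (LinearMap.congr_fun h₄ _).trans ?_
    rw [h₃, der_smul, LinearMap.neg_apply, map_sub, LinearMap.smul_apply, map_smul]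
    push_cast
    module
  have hs : ∑ l, extMul ((dual b l).comp (A z)) (der ((A z).comp (fderiv ℝ A z (b l))) (F z)) =
      ∑ l, extMul (dual b l) (der ((A z).comp (fderiv ℝ A z (A z (b l)))) (F z)) := by
    refine sum_extMul_comp b (A z) (fun v => der ((A z).comp (fderiv ℝ A z v)) (F z)) fun v => ?_
    have h : (A z).comp (fderiv ℝ A z v) = ∑ i, dual b i v • (A z).comp (fderiv ℝ A z (b i)) := by
      conv_lhs => rw [← sum_dual_smul b v]
      ext w
      simp
    change der _ _ = _
    rw [h]
    have h' : ∀ s : Finset (Fin (Module.finrank ℝ E)),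
        der (∑ i ∈ s, dual b i v • (A z).comp (fderiv ℝ A z (b i))) =
        ∑ i ∈ s, (dual b i v : ℂ) • der ((A z).comp (fderiv ℝ A z (b i))) := by
      classical
      intro s
      induction s using Finset.induction_on with
      | empty => simp [der_zero]
      | insert i s hi ih =>
        rw [Finset.sum_insert hi, Finset.sum_insert hi, der_add, ih, der_smul]
    rw [h', LinearMap.sum_apply]
    rfl
  have key₂ : ∀ l, extMul (dual b l) (der (A z) (pd F z (b l)) + der (fderiv ℝ A z (b l)) (F z)) -
      der (A z) (extMul (dual b l) (pd F z (b l))) =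
      -extMul ((dual b l).comp (A z)) (pd F z (b l)) +
        extMul (dual b l) (der (fderiv ℝ A z (b l)) (F z)) := by
    intro l
    have h := LinearMap.congr_fun (der_extMul (A z) (dual b l)) (pd F z (b l))
    simp only [Module.End.mul_apply, LinearMap.add_apply] at h
    rw [h, map_add]
    abel
  rw [dLoc_eq b F, dLoc_eq b, dLoc_eq b]
  simp only [pd_der hA hF, pd_pull hA hF hz, map_sum]
  rw [← Finset.sum_sub_distrib, Finset.sum_congr rfl fun l _ => key l,
    Finset.sum_congr rfl fun l _ => key₂ l, Finset.sum_sub_distrib, Finset.sum_add_distrib, hs,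
    sub_eq_add_neg, add_right_inj, eq_comm, ← sub_eq_zero, sub_neg_eq_add,
    ← Finset.sum_add_distrib]
  have hT' := LinearMap.congr_fun hT (F z)
  rw [LinearMap.sum_apply, LinearMap.zero_apply] at hT'
  rw [← hT']
  refine Finset.sum_congr rfl fun l _ => ?_
  have : (ContinuousLinearMap.compL ℝ E E E (A z)).comp (nijTensor z A) (b l) =
      (A z).comp (fderiv ℝ A z (A z (b l))) + fderiv ℝ A z (b l) := by
    ext v
    simp [nijTensor_apply, hz]
  rw [this, der_add, Module.End.mul_apply, LinearMap.add_apply, map_add, add_comm]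

end LocalIdentities
end HKT
end

noncomputable section

namespace HKT

/-! ## Differential forms in charts -/

section Charts

set_option linter.unusedSectionVars false

variable {E : Type*} [NormedAddCommGroup E] [NormedSpace ℝ E] [FiniteDimensional ℝ E]
  {M : Type*} [TopologicalSpace M] [ChartedSpace E M] [IsManifold 𝓘(ℝ, E) ∞ M]

/-- The derivative of the chart around `x₀`. -/
def dChart (x₀ x : M) : E →L[ℝ] E := mfderiv 𝓘(ℝ, E) 𝓘(ℝ, E) (extChartAt 𝓘(ℝ, E) x₀) x

/-- The derivative of the inverse of the chart around `x₀`. -/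
def dSymm (x₀ : M) (y : E) : E →L[ℝ] E :=
  mfderiv 𝓘(ℝ, E) 𝓘(ℝ, E) (extChartAt 𝓘(ℝ, E) x₀).symm y

theorem dChart_dSymm {x₀ : M} {y : E} (hy : y ∈ (extChartAt 𝓘(ℝ, E) x₀).target) (v : E) :
    dChart x₀ ((extChartAt 𝓘(ℝ, E) x₀).symm y) (dSymm x₀ y v) = v := by
  have h := mfderiv_extChartAt_comp_mfderivWithin_extChartAt_symm (I := 𝓘(ℝ, E)) hy
  rw [modelWithCornersSelf_coe, Set.range_id, mfderivWithin_univ] at h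
  exact congrArg (fun L : E →L[ℝ] E => L v) h

theorem dSymm_dChart {x₀ : M} {y : E} (hy : y ∈ (extChartAt 𝓘(ℝ, E) x₀).target) (v : E) :
    dSymm x₀ y (dChart x₀ ((extChartAt 𝓘(ℝ, E) x₀).symm y) v) = v := by
  have h := mfderivWithin_extChartAt_symm_comp_mfderiv_extChartAt (I := 𝓘(ℝ, E)) hy
  rw [modelWithCornersSelf_coe, Set.range_id, mfderivWithin_univ] at h
  exact congrArg (fun L : E →L[ℝ] E => L v) h

theorem dChart_self (x : M) : dChart x x = ContinuousLinearMap.id ℝ E := by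
  have h := mfderiv_chartAt_eq_tangentCoordChange (I := 𝓘(ℝ, E)) (mem_chart_source E x)
  ext v
  have h₁ := tangentCoordChange_self (I := 𝓘(ℝ, E)) (x := x) (z := x) (v := v)
    (mem_extChartAt_source x)
  refine Eq.trans ?_ h₁
  rw [← h]
  rfl

theorem dSymm_self (x : M) : dSymm x (extChartAt 𝓘(ℝ, E) x x) = ContinuousLinearMap.id ℝ E := by
  ext v
  have h := dChart_dSymm (mem_extChartAt_target (I := 𝓘(ℝ, E)) x) v
  rwa [extChartAt_to_inv, dChart_self] at h

variable (E) in
/-- The transition map from the chart around `x` to the chart around `x₀`. -/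
def transition (x x₀ : M) (y : E) : E :=
  extChartAt 𝓘(ℝ, E) x₀ ((extChartAt 𝓘(ℝ, E) x).symm y)

theorem isOpen_target (x : M) : IsOpen (extChartAt 𝓘(ℝ, E) x).target :=
  isOpen_extChartAt_target x

theorem contDiffAt_transition {x x₀ : M} {y : E} (hy : y ∈ (extChartAt 𝓘(ℝ, E) x).target)
    (hx : (extChartAt 𝓘(ℝ, E) x).symm y ∈ (extChartAt 𝓘(ℝ, E) x₀).source) :
    ContDiffAt ℝ ∞ (transition E x x₀) y := by
  rw [extChartAt_source] at hx
  have h₁ : ContMDiffAt 𝓘(ℝ, E) 𝓘(ℝ, E) ∞ (extChartAt 𝓘(ℝ, E) x).symm y :=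
    (contMDiffOn_extChartAt_symm x).contMDiffAt ((isOpen_target x).mem_nhds hy)
  have h₂ := (contMDiffAt_extChartAt' (I := 𝓘(ℝ, E)) (n := ∞) hx).comp y h₁
  exact h₂.contDiffAt

theorem fderiv_transition {x x₀ : M} {y : E} (hy : y ∈ (extChartAt 𝓘(ℝ, E) x).target)
    (hx : (extChartAt 𝓘(ℝ, E) x).symm y ∈ (extChartAt 𝓘(ℝ, E) x₀).source) :
    fderiv ℝ (transition E x x₀) y =
      (dChart x₀ ((extChartAt 𝓘(ℝ, E) x).symm y)).comp (dSymm x y) := by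
  rw [extChartAt_source] at hx
  have h₁ : MDifferentiableAt 𝓘(ℝ, E) 𝓘(ℝ, E) (extChartAt 𝓘(ℝ, E) x).symm y :=
    ((contMDiffOn_extChartAt_symm (n := ∞) x).contMDiffAt
      ((isOpen_target x).mem_nhds hy)).mdifferentiableAt (by simp)
  have h₂ := mdifferentiableAt_extChartAt (I := 𝓘(ℝ, E)) hx
  rw [← mfderiv_eq_fderiv]
  exact mfderiv_comp y h₂ h₁

theorem eventually_symm_mem {x x₀ : M} {y : E} (hy : y ∈ (extChartAt 𝓘(ℝ, E) x).target)
    (hx : (extChartAt 𝓘(ℝ, E) x).symm y ∈ (extChartAt 𝓘(ℝ, E) x₀).source) :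
    ∀ᶠ y' in nhds y, y' ∈ (extChartAt 𝓘(ℝ, E) x).target ∧
      (extChartAt 𝓘(ℝ, E) x).symm y' ∈ (extChartAt 𝓘(ℝ, E) x₀).source := by
  have h := (continuousOn_extChartAt_symm (I := 𝓘(ℝ, E)) x).continuousAt
    ((isOpen_target x).mem_nhds hy)
  exact ((isOpen_target x).eventually_mem hy).and
    (h.eventually ((isOpen_extChartAt_source x₀).eventually_mem hx))

/-- The value of a form at a point. -/
def fib (η : TotalForm E M) (x : M) : AltForm E := fun k => η k x

/-- The expression of a form in a chart. -/
def loc (x₀ : M) (η : TotalForm E M) (y : E) : AltForm E := fun k => (η k).inChart x₀ y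

theorem loc_eq (x₀ : M) (η : TotalForm E M) (y : E) :
    loc x₀ η y = pull (dSymm x₀ y) (fib η ((extChartAt 𝓘(ℝ, E) x₀).symm y)) := rfl

theorem fib_ext {η ζ : TotalForm E M} (h : ∀ x, fib η x = fib ζ x) : η = ζ :=
  funext fun k => funext fun x => congrFun (h x) k

theorem loc_self (η : TotalForm E M) (x : M) : loc x η (extChartAt 𝓘(ℝ, E) x x) = fib η x := by
  rw [loc_eq, dSymm_self, extChartAt_to_inv, pull_id]
  rfl

theorem fib_symm (η : TotalForm E M) {x₀ : M} {y : E} (hy : y ∈ (extChartAt 𝓘(ℝ, E) x₀).target) :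
    fib η ((extChartAt 𝓘(ℝ, E) x₀).symm y) =
      pull (dChart x₀ ((extChartAt 𝓘(ℝ, E) x₀).symm y)) (loc x₀ η y) := by
  rw [loc_eq, ← Module.End.mul_apply, pull_mul_pull]
  have : (dSymm x₀ y).comp (dChart x₀ ((extChartAt 𝓘(ℝ, E) x₀).symm y)) =
      ContinuousLinearMap.id ℝ E := ContinuousLinearMap.ext (dSymm_dChart hy)
  rw [this, pull_id, Module.End.one_apply]

/-- Expressions of a form in two charts are related by pullback along the transition map; smoothness
and the exterior derivative are transferred between charts by this formula. -/
theorem loc_transition (η : TotalForm E M) {x x₀ : M} {y : E}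
    (hy : y ∈ (extChartAt 𝓘(ℝ, E) x).target)
    (hx : (extChartAt 𝓘(ℝ, E) x).symm y ∈ (extChartAt 𝓘(ℝ, E) x₀).source) :
    loc x η y = pull (fderiv ℝ (transition E x x₀) y) (loc x₀ η (transition E x x₀ y)) := by
  have hx' := (extChartAt 𝓘(ℝ, E) x₀).map_source hx
  have h := fib_symm η hx'
  rw [(extChartAt 𝓘(ℝ, E) x₀).left_inv hx] at h
  rw [fderiv_transition hy hx, ← pull_mul_pull, Module.End.mul_apply, loc_eq x η, h]
  rfl

/-- Smoothness of forms of all degrees. -/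
def IsSmoothForm (η : TotalForm E M) : Prop := ∀ k, (η k).IsSmooth

theorem IsSmoothForm.smoothAt {η : TotalForm E M} (h : IsSmoothForm η) {x : M} {y : E}
    (hy : y ∈ (extChartAt 𝓘(ℝ, E) x).target) : SmoothAt (loc x η) y := fun k =>
  (h k x).contDiffAt ((isOpen_target x).mem_nhds hy)

/-- A form is smooth if it is smooth at the centres of the charts. -/
theorem isSmoothForm_of_smoothAt {η : TotalForm E M}
    (h : ∀ x, SmoothAt (loc x η) (extChartAt 𝓘(ℝ, E) x x)) : IsSmoothForm η := by
  intro k x₀ y hy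
  set x := (extChartAt 𝓘(ℝ, E) x₀).symm y with hx
  have hx' : (extChartAt 𝓘(ℝ, E) x₀).symm y ∈ (extChartAt 𝓘(ℝ, E) x).source :=
    mem_extChartAt_source x
  have hτ := contDiffAt_transition hy hx'
  -- Near y the expression in the chart around x₀ is the pullback, by a smooth transition map, of
  -- the expression in the chart centred at the corresponding point.
  have h₁ : SmoothAt (fun y' => loc x η (transition E x₀ x y')) y := fun k =>
    ContDiffAt.comp y (h x k) hτ
  have h₂ := (h₁.pull (hτ.fderiv_right (m := ∞) (by simp))).congr (G := loc x₀ η)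
    ((eventually_symm_mem hy hx').mono fun y' hy' => loc_transition η hy'.1 hy'.2)
  exact (h₂ k).contDiffWithinAt

/-- The de Rham differential on forms of all degrees. -/
def dTot (η : TotalForm E M) : TotalForm E M
  | 0 => 0
  | k + 1 => (η k).d

theorem fib_dTot (η : TotalForm E M) (x : M) :
    fib (dTot η) x = dLoc (loc x η) (extChartAt 𝓘(ℝ, E) x x) := by
  funext k
  cases k with
  | zero => rfl
  | succ k =>
    change (extDeriv ((η k).inChart x) (extChartAt 𝓘(ℝ, E) x x)).compContinuousLinearMap
      (dChart x x) = _
    rw [dChart_self]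
    rfl

/-- The de Rham differential in a chart. -/
theorem loc_dTot {η : TotalForm E M} (hη : IsSmoothForm η) {x₀ : M} {y : E}
    (hy : y ∈ (extChartAt 𝓘(ℝ, E) x₀).target) : loc x₀ (dTot η) y = dLoc (loc x₀ η) y := by
  set x := (extChartAt 𝓘(ℝ, E) x₀).symm y with hx
  have hx' : (extChartAt 𝓘(ℝ, E) x₀).symm y ∈ (extChartAt 𝓘(ℝ, E) x).source :=
    mem_extChartAt_source x
  have hτ := contDiffAt_transition hy hx'
  -- The chart around x has identity derivative at its own centre, so only the derivative of the
  -- other inverse chart remains. The claim is then naturality of the exterior derivative.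
  have hfd : fderiv ℝ (transition E x₀ x) y = dSymm x₀ y := by
    rw [fderiv_transition hy hx', ← hx, dChart_self]
    rfl
  have h₁ := dLoc_congr (F := loc x₀ η)
    ((eventually_symm_mem hy hx').mono fun y' hy' => loc_transition η hy'.1 hy'.2)
  rw [loc_eq, ← hx, fib_dTot, h₁]
  funext k
  cases k with
  | zero => rfl
  | succ k =>
    have h₀ : DifferentiableAt ℝ (fun y => loc x η y k) (transition E x₀ x y) :=
      (hη.smoothAt ((extChartAt 𝓘(ℝ, E) x).map_source hx')).diffAt k
    have h₂ := extDeriv_pullback h₀ hτ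
      (by
        rw [minSmoothness_of_isRCLikeNormedField]
        exact WithTop.coe_le_coe.2 le_top)
    refine Eq.trans ?_ h₂.symm
    rw [hfd]
    rfl

theorem isSmoothForm_dTot {η : TotalForm E M} (hη : IsSmoothForm η) : IsSmoothForm (dTot η) := by
  refine isSmoothForm_of_smoothAt fun x => ?_
  have hx := mem_extChartAt_target (I := 𝓘(ℝ, E)) x
  exact (hη.smoothAt hx).dLoc.congr
    (((isOpen_target x).eventually_mem hx).mono fun y hy => loc_dTot hη hy)

theorem dTot_dTot {η : TotalForm E M} (hη : IsSmoothForm η) : dTot (dTot η) = 0 := by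
  refine fib_ext fun x => ?_
  have hx := mem_extChartAt_target (I := 𝓘(ℝ, E)) x
  rw [fib_dTot, dLoc_congr (((isOpen_target x).eventually_mem hx).mono fun y hy => loc_dTot hη hy),
    dLoc_dLoc (hη.smoothAt hx)]
  rfl

/-- A field of endomorphisms in a chart. -/
def endLoc (A : M → E →L[ℝ] E) (x₀ : M) (y : E) : E →L[ℝ] E :=
  (dChart x₀ ((extChartAt 𝓘(ℝ, E) x₀).symm y)).comp
    ((A ((extChartAt 𝓘(ℝ, E) x₀).symm y)).comp (dSymm x₀ y))

theorem dSymm_endLoc (A : M → E →L[ℝ] E) {x₀ : M} {y : E}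
    (hy : y ∈ (extChartAt 𝓘(ℝ, E) x₀).target) : (dSymm x₀ y).comp (endLoc A x₀ y) =
      (A ((extChartAt 𝓘(ℝ, E) x₀).symm y)).comp (dSymm x₀ y) :=
  ContinuousLinearMap.ext fun _ => dSymm_dChart hy _

theorem endLoc_self (A : M → E →L[ℝ] E) (x : M) :
    endLoc A x (extChartAt 𝓘(ℝ, E) x x) = A x := by
  rw [endLoc, dSymm_self, extChartAt_to_inv, dChart_self]
  rfl

theorem endLoc_endLoc {A : M → E →L[ℝ] E} (hA : ∀ x v, A x (A x v) = -v) {x₀ : M} {y : E}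
    (hy : y ∈ (extChartAt 𝓘(ℝ, E) x₀).target) (v : E) :
    endLoc A x₀ y (endLoc A x₀ y v) = -v := by
  simp only [endLoc, ContinuousLinearMap.comp_apply, dSymm_dChart hy, hA, map_neg, dChart_dSymm hy]

/-- Application of a field of operators to a form. -/
def fibMap (P : M → Module.End ℂ (AltForm E)) (η : TotalForm E M) : TotalForm E M :=
  fun k x => P x (fib η x) k

theorem fib_fibMap (P : M → Module.End ℂ (AltForm E)) (η : TotalForm E M) (x : M) :
    fib (fibMap P η) x = P x (fib η x) := rfl

theorem loc_der (A : M → E →L[ℝ] E) (η : TotalForm E M) {x₀ : M} {y : E}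
    (hy : y ∈ (extChartAt 𝓘(ℝ, E) x₀).target) :
    loc x₀ (fibMap (fun x => der (A x)) η) y = der (endLoc A x₀ y) (loc x₀ η y) :=
  LinearMap.congr_fun (pull_der (dSymm_endLoc A hy)) _

theorem loc_pull (A : M → E →L[ℝ] E) (η : TotalForm E M) {x₀ : M} {y : E}
    (hy : y ∈ (extChartAt 𝓘(ℝ, E) x₀).target) :
    loc x₀ (fibMap (fun x => pull (A x)) η) y = pull (endLoc A x₀ y) (loc x₀ η y) := by
  rw [loc_eq, loc_eq, fib_fibMap, ← Module.End.mul_apply, ← Module.End.mul_apply, pull_mul_pull,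
    pull_mul_pull, dSymm_endLoc A hy]

theorem eventually_target (x : M) : ∀ᶠ y in nhds (extChartAt 𝓘(ℝ, E) x x),
    y ∈ (extChartAt 𝓘(ℝ, E) x).target :=
  (isOpen_target x).eventually_mem (mem_extChartAt_target x)

theorem isSmoothForm_der {A : M → E →L[ℝ] E}
    (hA : ∀ x, ContDiffAt ℝ ∞ (endLoc A x) (extChartAt 𝓘(ℝ, E) x x)) {η : TotalForm E M}
    (hη : IsSmoothForm η) : IsSmoothForm (fibMap (fun x => der (A x)) η) :=
  isSmoothForm_of_smoothAt fun x =>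
    ((hη.smoothAt (mem_extChartAt_target x)).der (hA x)).congr
      ((eventually_target x).mono fun _ hy => loc_der A η hy)

theorem isSmoothForm_pull {A : M → E →L[ℝ] E}
    (hA : ∀ x, ContDiffAt ℝ ∞ (endLoc A x) (extChartAt 𝓘(ℝ, E) x x)) {η : TotalForm E M}
    (hη : IsSmoothForm η) : IsSmoothForm (fibMap (fun x => pull (A x)) η) :=
  isSmoothForm_of_smoothAt fun x =>
    ((hη.smoothAt (mem_extChartAt_target x)).pull (hA x)).congr
      ((eventually_target x).mono fun _ hy => loc_pull A η hy)

variable {A : M → E →L[ℝ] E}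

/-- The double commutator of an integrable complex structure with the de Rham differential. -/
theorem der_der_dTot (hA : ∀ x, ContDiffAt ℝ ∞ (endLoc A x) (extChartAt 𝓘(ℝ, E) x x))
    (hAA : ∀ x v, A x (A x v) = -v)
    (hN : ∀ x u v, nijTensor (extChartAt 𝓘(ℝ, E) x x) (endLoc A x) u v =
      nijTensor (extChartAt 𝓘(ℝ, E) x x) (endLoc A x) v u)
    {η : TotalForm E M} (hη : IsSmoothForm η) (x : M) :
    der (A x) (der (A x) (fib (dTot η) x)) -
      (2 : ℂ) • der (A x) (fib (dTot (fibMap (fun x => der (A x)) η)) x) +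
      fib (dTot (fibMap (fun x => der (A x)) (fibMap (fun x => der (A x)) η))) x =
        -fib (dTot η) x := by
  have hx := mem_extChartAt_target (I := 𝓘(ℝ, E)) x
  have h := der_der_dLoc ((hA x).differentiableAt (by simp)) (hη.smoothAt hx).diffAt
    ((eventually_target x).mono fun y hy => endLoc_endLoc hAA hy) (hN x)
  have h₁ := dLoc_congr ((eventually_target x).mono fun y hy => loc_der A η hy)
  have h₂ := dLoc_congr ((eventually_target x).mono fun y hy =>
    (loc_der A (fibMap (fun x => der (A x)) η) hy).trans
      (congrArg (der (endLoc A x y)) (loc_der A η hy)))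
  rw [fib_dTot, fib_dTot, fib_dTot, h₁, h₂]
  rwa [endLoc_self] at h

theorem pull_dTot_pull (hA : ∀ x, ContDiffAt ℝ ∞ (endLoc A x) (extChartAt 𝓘(ℝ, E) x x))
    (hAA : ∀ x v, A x (A x v) = -v)
    (hN : ∀ x u v, nijTensor (extChartAt 𝓘(ℝ, E) x x) (endLoc A x) u v =
      nijTensor (extChartAt 𝓘(ℝ, E) x x) (endLoc A x) v u)
    {η : TotalForm E M} (hη : IsSmoothForm η) (x : M) :
    pull (-A x) (fib (dTot (fibMap (fun x => pull (A x)) η)) x) =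
      fib (dTot (fibMap (fun x => der (A x)) η)) x - der (A x) (fib (dTot η) x) := by
  have hx := mem_extChartAt_target (I := 𝓘(ℝ, E)) x
  have h := pull_dLoc_pull ((hA x).differentiableAt (by simp)) (hη.smoothAt hx).diffAt
    ((eventually_target x).mono fun y hy => endLoc_endLoc hAA hy) (hN x)
  have h₁ := dLoc_congr ((eventually_target x).mono fun y hy => loc_der A η hy)
  have h₂ := dLoc_congr ((eventually_target x).mono fun y hy => loc_pull A η hy)
  rw [fib_dTot, fib_dTot, fib_dTot, h₁, h₂]
  rwa [endLoc_self] at h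

/-- A two-form as a form of all degrees. -/
def ofTwo (β : DForm E M 2) : TotalForm E M
  | 2 => β
  | 0 => 0
  | 1 => 0
  | _ + 3 => 0

variable {ι : Type*} [Fintype ι] (b : Module.Basis ι ℝ E)

theorem loc_wedgeTwo (β : TotalForm E M) (η : TotalForm E M) (x₀ : M) (y : E) :
    loc x₀ (fibMap (fun x => wedgeTwo b (fib β x 2)) η) y =
      wedgeTwo b (loc x₀ β y 2) (loc x₀ η y) :=
  LinearMap.congr_fun (pull_wedgeTwo b _ _) _

theorem isSmoothForm_wedgeTwo {β η : TotalForm E M} (hβ : IsSmoothForm β) (hη : IsSmoothForm η) :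
    IsSmoothForm (fibMap (fun x => wedgeTwo b (fib β x 2)) η) :=
  isSmoothForm_of_smoothAt fun x =>
    ((hη.smoothAt (mem_extChartAt_target x)).wedgeTwo b
      (hβ.smoothAt (mem_extChartAt_target x) 2)).congr
      (Filter.Eventually.of_forall fun _ => loc_wedgeTwo b β η x _)

/-- The commutator of the de Rham differential and the multiplication by a two-form is the
multiplication by a three-form. -/
theorem exists_cubic_dTot_wedgeTwo {β : TotalForm E M} (hβ : IsSmoothForm β) (x : M) :
    ∃ X ∈ cubic E, ∀ η : TotalForm E M, IsSmoothForm η →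
      fib (dTot (fibMap (fun x => wedgeTwo b (fib β x 2)) η)) x =
        X (fib η x) + wedgeTwo b (fib β x 2) (fib (dTot η) x) := by
  have hx := mem_extChartAt_target (I := 𝓘(ℝ, E)) x
  -- The three-form is the exterior derivative of β, written in the chart at x as Σ b^l ∧ ∂_l β.
  refine ⟨∑ l, extMul (dual b l) * wedgeTwo b
    (fderiv ℝ (fun y => loc x β y 2) (extChartAt 𝓘(ℝ, E) x x) (b l)),
    Submodule.sum_mem _ fun l _ => extMul_mul_wedgeTwo_mem_cubic b _ _, fun η hη => ?_⟩
  have h := dLoc_wedgeTwo b ((hβ.smoothAt hx).diffAt 2) (hη.smoothAt hx).diffAt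
  have h₁ := dLoc_congr (z := extChartAt 𝓘(ℝ, E) x x)
    (Filter.Eventually.of_forall fun y => loc_wedgeTwo b β η x y)
  rw [fib_dTot, fib_dTot, h₁, h, loc_self, loc_self]

end Charts
end HKT
end

noncomputable section

namespace HKT

/-! ## Smoothness of tensors and integrability in charts -/

section Tensors

set_option linter.unusedSectionVars false

variable {E : Type*} [NormedAddCommGroup E] [NormedSpace ℝ E] [FiniteDimensional ℝ E]
  {M : Type*} [TopologicalSpace M] [ChartedSpace E M] [IsManifold 𝓘(ℝ, E) ∞ M]

theorem contDiffAt_comp_symm {G : Type*} [NormedAddCommGroup G] [NormedSpace ℝ G] {f : M → G}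
    {x : M} (hf : ContMDiffAt 𝓘(ℝ, E) 𝓘(ℝ, G) ∞ f x) :
    ContDiffAt ℝ ∞ (fun y => f ((extChartAt 𝓘(ℝ, E) x).symm y)) (extChartAt 𝓘(ℝ, E) x x) := by
  have h₁ : ContMDiffAt 𝓘(ℝ, E) 𝓘(ℝ, E) ∞ (extChartAt 𝓘(ℝ, E) x).symm (extChartAt 𝓘(ℝ, E) x x) :=
    (contMDiffOn_extChartAt_symm x).contMDiffAt
      ((isOpen_target x).mem_nhds (mem_extChartAt_target x))
  have h₂ : ContMDiffAt 𝓘(ℝ, E) 𝓘(ℝ, G) ∞ f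
      ((extChartAt 𝓘(ℝ, E) x).symm (extChartAt 𝓘(ℝ, E) x x)) := by
    rwa [extChartAt_to_inv]
  exact (h₂.comp _ h₁).contDiffAt

/-- A smooth field of endomorphisms is smooth in charts. -/
theorem contDiffAt_endLoc
    {A : ∀ x : M, TangentSpace 𝓘(ℝ, E) x →L[ℝ] TangentSpace 𝓘(ℝ, E) x}
    (hA : ContMDiff 𝓘(ℝ, E) (𝓘(ℝ, E).prod 𝓘(ℝ, E →L[ℝ] E)) ∞
      (fun x => Bundle.TotalSpace.mk' (E →L[ℝ] E)
        (E := fun x : M => TangentSpace 𝓘(ℝ, E) x →L[ℝ] TangentSpace 𝓘(ℝ, E) x) x (A x))) (x : M) :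
    ContDiffAt ℝ ∞ (endLoc A x) (extChartAt 𝓘(ℝ, E) x x) := by
  have h := ((contMDiffAt_hom_bundle _).1 (hA x)).2
  refine (contDiffAt_comp_symm h).congr_of_eventuallyEq ?_
  filter_upwards [eventually_target x] with y hy
  have hy' := (extChartAt 𝓘(ℝ, E) x).map_target hy
  rw [extChartAt_source] at hy'
  -- Smoothness of a section of the bundle of endomorphisms is smoothness in tangent coordinates,
  -- and these amount to conjugation by the derivative of the chart.
  have h₁ := inTangentCoordinates_eq_mfderiv_comp (I := 𝓘(ℝ, E)) (I' := 𝓘(ℝ, E)) (f := id)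
    (g := id) (ϕ := A) (x₀ := x) hy' hy'
  rw [modelWithCornersSelf_coe, Set.range_id, mfderivWithin_univ, id_eq, id_eq,
    (extChartAt 𝓘(ℝ, E) x).right_inv hy] at h₁
  exact h₁.symm

/-- The vector field that is constant in the chart around `x₀`. -/
def coordField (x₀ : M) (u : E) (x : M) : E := dSymm x₀ (extChartAt 𝓘(ℝ, E) x₀ x) u

theorem dChart_coordField {x₀ x : M} (hx : x ∈ (extChartAt 𝓘(ℝ, E) x₀).source) (u : E) :
    dChart x₀ x (coordField x₀ u x) = u := by
  have h := dChart_dSymm ((extChartAt 𝓘(ℝ, E) x₀).map_source hx) u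
  rwa [(extChartAt 𝓘(ℝ, E) x₀).left_inv hx] at h

/-- A function with values in the model space as a vector field. -/
def toField (V : M → E) (x : M) : TangentSpace 𝓘(ℝ, E) x := V x

theorem contMDiffOn_coordField (x₀ : M) (u : E) :
    ContMDiffOn 𝓘(ℝ, E) 𝓘(ℝ, E).tangent ∞
      (fun x => (toField (coordField x₀ u) x : TangentBundle 𝓘(ℝ, E) M)) (chartAt E x₀).source := by
  have h := (trivializationAt E (TangentSpace 𝓘(ℝ, E)) x₀).contMDiffOn_section_baseSet_iff
    (IB := 𝓘(ℝ, E)) (n := ∞) (s := toField (coordField x₀ u))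
  refine h.2 ((contMDiffOn_const (c := u)).congr fun x hx => ?_)
  have hx' : x ∈ (chartAt E x₀).source := hx
  have h₁ := TangentBundle.continuousLinearMapAt_trivializationAt (I := 𝓘(ℝ, E)) hx'
  have h₃ := (trivializationAt E (TangentSpace 𝓘(ℝ, E)) x₀).continuousLinearMapAt_apply_of_mem
    (R := ℝ) hx (toField (coordField x₀ u) x)
  rw [h₁] at h₃
  rw [← extChartAt_source 𝓘(ℝ, E)] at hx'
  exact h₃.symm.trans (dChart_coordField hx' u)

variable [T2Space M]

/-- Integrability is stated for global smooth vector fields, so coordinate fields have to be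
extended by means of a bump function. -/
theorem exists_smoothField (x : M) (u : E) :
    ∃ X : M → E, IsSmoothField (toField X) ∧ ∀ᶠ x' in nhds x, X x' = coordField x u x' := by
  obtain ⟨f⟩ : Nonempty (SmoothBumpFunction 𝓘(ℝ, E) x) := inferInstance
  refine ⟨fun x' => f x' • coordField x u x', ?_, f.eventuallyEq_one.mono fun x' hx' => ?_⟩
  · exact ContMDiffOn.smul_section_of_tsupport f.contMDiff.contMDiffOn (chartAt E x).open_source
      f.tsupport_subset_chartAt_source (contMDiffOn_coordField x u)
  · change f x' • coordField x u x' = _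
    rw [hx', Pi.one_apply, one_smul]

/-- The Lie bracket of vector fields, with values in the model space. -/
def fieldBracket (V W : M → E) (x : M) : E :=
  VectorField.mlieBracket 𝓘(ℝ, E) (toField V) (toField W) x

/-- The Lie bracket in a chart. -/
theorem fieldBracket_eq {V W : M → E} {x : M} {V' W' : E → E}
    (hV : ∀ᶠ y in nhds (extChartAt 𝓘(ℝ, E) x x), dChart x ((extChartAt 𝓘(ℝ, E) x).symm y)
      (V ((extChartAt 𝓘(ℝ, E) x).symm y)) = V' y)
    (hW : ∀ᶠ y in nhds (extChartAt 𝓘(ℝ, E) x x), dChart x ((extChartAt 𝓘(ℝ, E) x).symm y)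
      (W ((extChartAt 𝓘(ℝ, E) x).symm y)) = W' y) :
    fieldBracket V W x = VectorField.lieBracket ℝ V' W' (extChartAt 𝓘(ℝ, E) x x) := by
  have hloc : ∀ (V : M → E) (V' : E → E),
      (∀ᶠ y in nhds (extChartAt 𝓘(ℝ, E) x x), dChart x ((extChartAt 𝓘(ℝ, E) x).symm y)
        (V ((extChartAt 𝓘(ℝ, E) x).symm y)) = V' y) →
      (fun y : E => (dSymm x y).inverse (V ((extChartAt 𝓘(ℝ, E) x).symm y))) =ᶠ[nhds
        (extChartAt 𝓘(ℝ, E) x x)] V' := by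
    intro V V' h
    filter_upwards [h, eventually_target x] with y hy hy'
    rw [← hy]
    -- The pullback of vector fields in the definition of the Lie bracket inverts the derivative of
    -- the inverse chart, which is the derivative of the chart.
    have hinv : (dSymm x y).inverse = dChart x ((extChartAt 𝓘(ℝ, E) x).symm y) := by
      refine ContinuousLinearMap.inverse_eq ?_ ?_
      · exact ContinuousLinearMap.ext (dSymm_dChart hy')
      · exact ContinuousLinearMap.ext (dChart_dSymm hy')
    rw [hinv]
  have hpull : ∀ V : M → E, VectorField.mpullbackWithin 𝓘(ℝ, E) 𝓘(ℝ, E)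
      (extChartAt 𝓘(ℝ, E) x).symm (toField V) (Set.range 𝓘(ℝ, E)) =
        fun y : E => (dSymm x y).inverse (V ((extChartAt 𝓘(ℝ, E) x).symm y)) := by
    intro V
    funext y
    rw [VectorField.mpullbackWithin_apply, modelWithCornersSelf_coe, Set.range_id,
      mfderivWithin_univ]
    rfl
  have hlie : ∀ {V W : E → E} {s : Set E}, s = Set.univ → ∀ y,
      VectorField.lieBracketWithin ℝ V W s y = VectorField.lieBracket ℝ V W y := by
    rintro V W s rfl y
    rw [VectorField.lieBracketWithin_univ]
  have h₁ : fieldBracket V W x = (dChart x x).inverse (VectorField.lieBracket ℝ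
      (fun y : E => (dSymm x y).inverse (V ((extChartAt 𝓘(ℝ, E) x).symm y)))
      (fun y : E => (dSymm x y).inverse (W ((extChartAt 𝓘(ℝ, E) x).symm y)))
      (extChartAt 𝓘(ℝ, E) x x)) := by
    rw [fieldBracket, ← VectorField.mlieBracketWithin_univ, VectorField.mlieBracketWithin_apply,
      hpull, hpull]
    have h₂ := hlie (V := fun y : E => (dSymm x y).inverse (V ((extChartAt 𝓘(ℝ, E) x).symm y)))
      (W := fun y : E => (dSymm x y).inverse (W ((extChartAt 𝓘(ℝ, E) x).symm y)))
      (s := (extChartAt 𝓘(ℝ, E) x).symm ⁻¹' Set.univ ∩ Set.range 𝓘(ℝ, E)) (by simp)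
      (extChartAt 𝓘(ℝ, E) x x)
    rw [← h₂]
    rfl
  rw [h₁, (hloc V V' hV).lieBracket_vectorField_eq (hloc W W' hW), dChart_self,
    ContinuousLinearMap.inverse_id]
  rfl

/-- Integrability in terms of the derivatives of the complex structure in a chart. -/
theorem nijTensor_symm {A : M → E →L[ℝ] E}
    (hA : IsIntegrable (fun x => (A x : TangentSpace 𝓘(ℝ, E) x →L[ℝ] TangentSpace 𝓘(ℝ, E) x)))
    (hs : ∀ x, ContDiffAt ℝ ∞ (endLoc A x) (extChartAt 𝓘(ℝ, E) x x)) (x : M) (u v : E) :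
    nijTensor (extChartAt 𝓘(ℝ, E) x x) (endLoc A x) u v =
      nijTensor (extChartAt 𝓘(ℝ, E) x x) (endLoc A x) v u := by
  set z := extChartAt 𝓘(ℝ, E) x x with hz
  have hd : DifferentiableAt ℝ (endLoc A x) z := (hs x).differentiableAt (by simp)
  obtain ⟨X, hX, hXu⟩ := exists_smoothField x u
  obtain ⟨Y, hY, hYv⟩ := exists_smoothField x v
  have hcont : Filter.Tendsto (extChartAt 𝓘(ℝ, E) x).symm (nhds z) (nhds x) := by
    have := (continuousAt_extChartAt_symm (I := 𝓘(ℝ, E)) x).tendsto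
    rwa [extChartAt_to_inv] at this
  have h₁ : ∀ (X : M → E) (u : E), (∀ᶠ x' in nhds x, X x' = coordField x u x') →
      (∀ᶠ y in nhds z, dChart x ((extChartAt 𝓘(ℝ, E) x).symm y)
        (X ((extChartAt 𝓘(ℝ, E) x).symm y)) = (fun _ => u) y) := by
    intro X u h
    filter_upwards [hcont.eventually h, eventually_target x] with y hy hy'
    rw [hy]
    exact dChart_coordField ((extChartAt 𝓘(ℝ, E) x).map_target hy') u
  have h₂ : ∀ (X : M → E) (u : E), (∀ᶠ x' in nhds x, X x' = coordField x u x') →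
      (∀ᶠ y in nhds z, dChart x ((extChartAt 𝓘(ℝ, E) x).symm y)
        ((fun x => A x (X x)) ((extChartAt 𝓘(ℝ, E) x).symm y)) =
          (fun y => endLoc A x y u) y) := by
    intro X u h
    filter_upwards [hcont.eventually h, eventually_target x] with y hy hy'
    rw [hy, coordField, (extChartAt 𝓘(ℝ, E) x).right_inv hy']
    rfl
  -- For fields that are constant in the chart, the Lie brackets involve only derivatives of A, and
  -- the Nijenhuis expression becomes the antisymmetrization of `nijTensor`.
  have e := hA (toField X) (toField Y) hX hY x
  have e₁ : fieldBracket (fun x => A x (X x)) (fun x => A x (Y x)) x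
    - A x (fieldBracket (fun x => A x (X x)) Y x) - A x (fieldBracket X (fun x => A x (Y x)) x)
    - fieldBracket X Y x = 0 := e
  rw [fieldBracket_eq (h₂ X u hXu) (h₂ Y v hYv), fieldBracket_eq (h₂ X u hXu) (h₁ Y v hYv),
    fieldBracket_eq (h₁ X u hXu) (h₂ Y v hYv), fieldBracket_eq (h₁ X u hXu) (h₁ Y v hYv)] at e₁
  have hfd : ∀ u w, fderiv ℝ (fun y => endLoc A x y u) z w = fderiv ℝ (endLoc A x) z w u := by
    intro u w
    rw [fderiv_clm_apply hd (differentiableAt_const u)]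
    simp
  simp only [VectorField.lieBracket_eq, ← hz, hfd, fderiv_const_apply, zero_apply] at e₁
  rw [← endLoc_self A x, ← hz, zero_sub, map_neg, sub_zero, sub_zero, sub_zero] at e₁
  rw [nijTensor_apply, nijTensor_apply, ← sub_eq_zero, ← e₁]
  abel

end Tensors
end HKT
end

/-! ### The quaternionic Hermitian structure of the tangent spaces, in charts -/

noncomputable section

namespace HKT

set_option linter.unusedSectionVars false

namespace QuatHermitian

variable {E : Type*} [NormedAddCommGroup E] [NormedSpace ℝ E] (Q : QuatHermitian E)

/-- The pullback of a quaternionic Hermitian structure by a linear isomorphism. -/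
def comap (φ : E ≃L[ℝ] E) : QuatHermitian E where
  g := Q.g.bilinearComp (φ : E →L[ℝ] E) (φ : E →L[ℝ] E)
  I := (φ.symm : E →L[ℝ] E).comp (Q.I.comp (φ : E →L[ℝ] E))
  J := (φ.symm : E →L[ℝ] E).comp (Q.J.comp (φ : E →L[ℝ] E))
  K := (φ.symm : E →L[ℝ] E).comp (Q.K.comp (φ : E →L[ℝ] E))
  Om := Q.Om.compContinuousLinearMap (φ : E →L[ℝ] E)
  symm u v := by simpa using Q.symm _ _
  pos v hv := by simpa using Q.pos _ (by simpa using hv)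
  II v := by simp [Q.II]
  JJ v := by simp [Q.JJ]
  IJ v := by simp [Q.IJ]
  JI v := by simp [Q.JI]
  gI u v := by simp [Q.gI]
  gJ u v := by simp [Q.gJ]
  Om_apply u v := by
    have h : (fun i => φ (![u, v] i)) = ![φ u, φ v] := by
      funext i; fin_cases i <;> rfl
    change Q.Om (fun i => φ (![u, v] i)) = _
    rw [h, Q.Om_apply]
    simp

variable [FiniteDimensional ℝ E] {ι : Type*} [Fintype ι] [DecidableEq ι]

theorem musical_symm_comap (φ : E ≃L[ℝ] E) (a : E →L[ℝ] ℝ) :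
    (Q.comap φ).musical.symm a = φ.symm (Q.musical.symm (a.comp (φ.symm : E →L[ℝ] E))) := by
  rw [ContinuousLinearEquiv.symm_apply_eq, musical_apply]
  ext v
  have h : Q.g (Q.musical.symm (a.comp (φ.symm : E →L[ℝ] E))) = a.comp (φ.symm : E →L[ℝ] E) :=
    Q.musical.apply_symm_apply _
  change a v = Q.g (φ (φ.symm _)) (φ v)
  rw [φ.apply_symm_apply, h]
  simp

/-- By independence of the basis, Λ may be computed on the left with the image of b under φ;
contractions then pull back to contractions with b itself. -/
theorem pull_lam (φ : E ≃L[ℝ] E) (b : Module.Basis ι ℝ E) :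
    pull (φ : E →L[ℝ] E) * Q.lam b = (Q.comap φ).lam b * pull (φ : E →L[ℝ] E) := by
  have hd : ∀ i, dual (b.map φ.toLinearEquiv) i = (dual b i).comp (φ.symm : E →L[ℝ] E) :=
    fun i => rfl
  rw [Q.lam_eq b (b.map φ.toLinearEquiv), lam, lam, mul_neg, neg_mul, mul_smul_comm,
    smul_mul_assoc, Finset.mul_sum, Finset.sum_mul]
  congr 2
  refine Finset.sum_congr rfl fun i _ => ?_
  rw [mul_assoc, contr_pull, ← mul_assoc, ← mul_assoc, contr_pull, musical_symm_comap, hd]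
  congr 3
  simp [comap]

end QuatHermitian

section

variable {E : Type*} [NormedAddCommGroup E] [NormedSpace ℝ E] [FiniteDimensional ℝ E]
  {M : Type*} [TopologicalSpace M] [ChartedSpace E M] [IsManifold 𝓘(ℝ, E) ∞ M]

/-- The derivative of the inverse of a chart as an isomorphism. -/
def dSymmEquiv {x₀ : M} {y : E} (hy : y ∈ (extChartAt 𝓘(ℝ, E) x₀).target) : E ≃L[ℝ] E :=
  ContinuousLinearEquiv.equivOfInverse (dSymm x₀ y)
    (dChart x₀ ((extChartAt 𝓘(ℝ, E) x₀).symm y)) (dChart_dSymm hy) (dSymm_dChart hy)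

/-- A field of bilinear forms in a chart. -/
def bilinLoc (g : M → E →L[ℝ] E →L[ℝ] ℝ) (x₀ : M) (y : E) : E →L[ℝ] E →L[ℝ] ℝ :=
  (g ((extChartAt 𝓘(ℝ, E) x₀).symm y)).bilinearComp (dSymm x₀ y) (dSymm x₀ y)

namespace HypercomplexHermitian

variable (S : HypercomplexHermitian E M)

/-- The action of a quaternion, as a function with values in operators on the model space. -/
def op (q : ℍ[ℝ]) (x : M) : E →L[ℝ] E := S.quat x q

/-- The metric, as a function with values in bilinear forms on the model space. -/
def inn (x : M) : E →L[ℝ] E →L[ℝ] ℝ := S.metric.inner x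

theorem op_mul (p q : ℍ[ℝ]) (x : M) (v : E) : S.op p x (S.op q x v) = S.op (p * q) x v := by
  rw [op, op, op, map_mul]
  rfl

theorem op_neg (q : ℍ[ℝ]) (x : M) (v : E) : S.op (-q) x v = -S.op q x v := by
  rw [op, op, map_neg]
  rfl

theorem op_one (x : M) (v : E) : S.op 1 x v = v := by
  rw [op, map_one]
  rfl

theorem op_op_self {q : ℍ[ℝ]} (hq : q * q = -1) (x : M) (v : E) :
    S.op q x (S.op q x v) = -v := by
  rw [op_mul, hq, op_neg, op_one]

end HypercomplexHermitian

theorem quatI_mul_self : quatI * quatI = -1 := by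
  have h : quatI.re = 0 ∧ quatI.imI = 1 ∧ quatI.imJ = 0 ∧ quatI.imK = 0 := ⟨rfl, rfl, rfl, rfl⟩
  obtain ⟨h₀, h₁, h₂, h₃⟩ := h
  ext <;> simp [h₀, h₁, h₂, h₃]

theorem quatI_mul_quatJ : quatI * quatJ = quatK := by
  ext <;> simp <;> simp [quatI, quatJ, quatK]

theorem quatJ_mul_quatI : quatJ * quatI = -quatK := by
  ext <;> simp <;> simp [quatI, quatJ, quatK]

theorem norm_eq_one_of_mul_self {q : ℍ[ℝ]} (hq : q * q = -1) : ‖q‖ = 1 := by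
  have h := congrArg norm hq
  rw [norm_mul, norm_neg, norm_one] at h
  nlinarith [norm_nonneg q]

namespace HypercomplexHermitian

variable (S : HypercomplexHermitian E M)

theorem Omega_apply (x : M) (v : Fin 2 → E) : (S.Omega x : E [⋀^Fin 2]→L[ℝ] ℂ) v =
    2⁻¹ * ((S.inn x (v 0) (S.op quatJ x (v 1)) : ℂ) +
      Complex.I * (S.inn x (v 0) (S.op quatK x (v 1)) : ℂ)) := by
  rw [← one_div]
  rfl

/-- The quaternionic Hermitian structure on the tangent space. -/
def herm (x : M) : QuatHermitian E where
  g := S.inn x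
  I := S.op quatI x
  J := S.op quatJ x
  K := S.op quatK x
  Om := S.Omega x
  symm := S.metric.symm x
  pos := S.metric.pos x
  II := S.op_op_self quatI_mul_self x
  JJ := S.op_op_self quatJ_mul_self x
  IJ v := by rw [op_mul, quatI_mul_quatJ]
  JI v := by rw [op_mul, quatJ_mul_quatI, op_neg]
  gI := S.hermitian x _ (norm_eq_one_of_mul_self quatI_mul_self)
  gJ := S.hermitian x _ (norm_eq_one_of_mul_self quatJ_mul_self)
  Om_apply u v := S.Omega_apply x ![u, v]

theorem contDiffAt_op (q : ℍ[ℝ]) (x : M) :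
    ContDiffAt ℝ ∞ (endLoc (S.op q) x) (extChartAt 𝓘(ℝ, E) x x) :=
  contDiffAt_endLoc (S.smooth q) x

/-- Evaluate the metric on pairs of coordinate fields; a family of bilinear forms is smooth when its
values on fixed vectors are. -/
theorem contDiffAt_inn (x : M) :
    ContDiffAt ℝ ∞ (bilinLoc S.inn x) (extChartAt 𝓘(ℝ, E) x x) := by
  refine contDiffAt_clm fun u => contDiffAt_clm fun v => ?_
  have hu : ∀ u : E, ContMDiffAt 𝓘(ℝ, E) 𝓘(ℝ, E).tangent ∞
      (fun x' => (toField (coordField x u) x' : TangentBundle 𝓘(ℝ, E) M)) x := fun u =>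
    (contMDiffOn_coordField x u).contMDiffAt
      ((chartAt E x).open_source.mem_nhds (mem_chart_source E x))
  have h := ContMDiffAt.clm_bundle_apply₂ (F₁ := E) (F₂ := E) (F₃ := ℝ)
    (E₁ := fun x : M => TangentSpace 𝓘(ℝ, E) x) (E₂ := fun x : M => TangentSpace 𝓘(ℝ, E) x)
    (E₃ := Bundle.Trivial M ℝ) (b := fun x => x) (S.metric.contMDiff x) (hu u) (hu v)
  rw [Bundle.contMDiffAt_totalSpace] at h
  refine (contDiffAt_comp_symm h.2).congr_of_eventuallyEq ?_
  filter_upwards [eventually_target x] with y hy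
  change S.inn _ _ _ = S.inn _ (dSymm x (extChartAt 𝓘(ℝ, E) x _) u)
    (dSymm x (extChartAt 𝓘(ℝ, E) x _) v)
  rw [(extChartAt 𝓘(ℝ, E) x).right_inv hy]
  rfl

theorem isSmoothForm_Omega : IsSmoothForm (ofTwo S.Omega) := by
  refine isSmoothForm_of_smoothAt fun x k => ?_
  match k with
  | 0 => exact contDiffAt_const (c := (0 : E [⋀^Fin 0]→L[ℝ] ℂ))
  | 1 => exact contDiffAt_const (c := (0 : E [⋀^Fin 1]→L[ℝ] ℂ))
  | k + 3 => exact contDiffAt_const (c := (0 : E [⋀^Fin (k + 3)]→L[ℝ] ℂ))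
  | 2 =>
    refine contDiffAt_form fun w => ?_
    have h : ∀ q, ContDiffAt ℝ ∞ (fun y => ((bilinLoc S.inn x y (w 0)
        (endLoc (S.op q) x y (w 1)) : ℝ) : ℂ)) (extChartAt 𝓘(ℝ, E) x x) := fun q =>
      Complex.ofRealCLM.contDiff.contDiffAt.comp _
        (((S.contDiffAt_inn x).clm_apply contDiffAt_const).clm_apply
          ((S.contDiffAt_op q x).clm_apply contDiffAt_const))
    refine (contDiffAt_const (c := (2⁻¹ : ℂ)).mul ((h quatJ).add
      (contDiffAt_const (c := Complex.I).mul (h quatK)))).congr_of_eventuallyEq ?_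
    filter_upwards [eventually_target x] with y hy
    have h₁ : loc x (ofTwo S.Omega) y 2 w = _ :=
      S.Omega_apply ((extChartAt 𝓘(ℝ, E) x).symm y) (fun i => dSymm x y (w i))
    rw [h₁]
    have h₂ : ∀ q, dSymm x y (endLoc (S.op q) x y (w 1)) =
        S.op q ((extChartAt 𝓘(ℝ, E) x).symm y) (dSymm x y (w 1)) := fun q =>
      DFunLike.congr_fun (dSymm_endLoc (S.op q) hy) (w 1)
    simp only [bilinLoc, ContinuousLinearMap.bilinearComp_apply, h₂]

variable {ι : Type*} [Fintype ι] [DecidableEq ι] (b : Module.Basis ι ℝ E)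

theorem isSmoothForm_lam {η : TotalForm E M} (hη : IsSmoothForm η) :
    IsSmoothForm (fibMap (fun x => (S.herm x).lam b) η) := by
  refine isSmoothForm_of_smoothAt fun x => ?_
  -- In the chart Λ is built from the fixed basis, J and the inverse of the metric. The last is
  -- smooth because inversion of linear maps is smooth near an invertible one.
  have h : ∀ i, SmoothAt (fun y => contr (endLoc (S.op quatJ) x y
      ((bilinLoc S.inn x y).inverse (dual b i))) (contr (b i) (loc x η y)))
      (extChartAt 𝓘(ℝ, E) x x) := by
    intro i
    refine SmoothAt.contr (SmoothAt.contr (hη.smoothAt (mem_extChartAt_target x))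
      contDiffAt_const) ((S.contDiffAt_op _ x).clm_apply (ContDiffAt.clm_apply ?_ contDiffAt_const))
    refine ContDiffAt.comp (g := ContinuousLinearMap.inverse) (f := bilinLoc S.inn x) _ ?_
      (S.contDiffAt_inn x)
    have hm : bilinLoc S.inn x (extChartAt 𝓘(ℝ, E) x x) =
        ((S.herm x).musical : E →L[ℝ] E →L[ℝ] ℝ) := by
      rw [bilinLoc, dSymm_self, extChartAt_to_inv]
      rfl
    rw [hm]
    exact contDiffAt_map_inverse (S.herm x).musical
  refine ((SmoothAt.sum (s := Finset.univ) fun i _ => h i).const_smul (2⁻¹)).neg.congr ?_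
  filter_upwards [eventually_target x] with y hy
  have h₁ := LinearMap.congr_fun ((S.herm ((extChartAt 𝓘(ℝ, E) x).symm y)).pull_lam
    (dSymmEquiv hy) b) (fib η ((extChartAt 𝓘(ℝ, E) x).symm y))
  have hm : bilinLoc S.inn x y = (((S.herm ((extChartAt 𝓘(ℝ, E) x).symm y)).comap
      (dSymmEquiv hy)).musical : E →L[ℝ] E →L[ℝ] ℝ) := rfl
  simp only [hm, ContinuousLinearMap.inverse_equiv]
  refine Eq.trans h₁ ?_
  simp only [QuatHermitian.lam, Module.End.mul_apply, LinearMap.neg_apply, LinearMap.smul_apply,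
    LinearMap.sum_apply]
  rfl

variable [T2Space M]

theorem nijTensor_op {q : ℍ[ℝ]} (hq : q * q = -1) (x : M) (u v : E) :
    nijTensor (extChartAt 𝓘(ℝ, E) x x) (endLoc (S.op q) x) u v =
      nijTensor (extChartAt 𝓘(ℝ, E) x x) (endLoc (S.op q) x) v u :=
  nijTensor_symm (S.integrable q hq) (S.contDiffAt_op q) x u v

end HypercomplexHermitian

end

end HKT
end

noncomputable section

namespace HKT

/-! ## Quaternionic differentials -/

section QuaternionicDifferential

set_option linter.unusedSectionVars false

variable {B : Type*} [Ring B] [Algebra ℂ B]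

/-- An element `d` of square zero together with a triple `i, j, k` with the commutation relations of
the imaginary quaternions (acting contravariantly) such that `[q, [q, d]] = -d` for all unit `q` in
the span of the triple. -/
structure IsQuaternionicDifferential (d i j k : B) : Prop where
  dd : d * d = 0
  ij : i * j - j * i = -(k + k)
  jk : j * k - k * j = -(i + i)
  ki : k * i - i * k = -(j + j)
  iid : i * (i * d - d * i) - (i * d - d * i) * i = -d
  jjd : j * (j * d - d * j) - (j * d - d * j) * j = -d
  kkd : k * (k * d - d * k) - (k * d - d * k) * k = -d
  ijd : i * (j * d - d * j) - (j * d - d * j) * i + (j * (i * d - d * i) - (i * d - d * i) * j) = 0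
  jkd : j * (k * d - d * k) - (k * d - d * k) * j + (k * (j * d - d * j) - (j * d - d * j) * k) = 0
  kid : k * (i * d - d * i) - (i * d - d * i) * k + (i * (k * d - d * k) - (k * d - d * k) * i) = 0

theorem eq_zero_of_add_self {V : Type*} [AddCommGroup V] [Module ℂ V] {x : V} (h : x + x = 0) :
    x = 0 := by
  rw [← two_smul ℂ x] at h
  exact (smul_eq_zero.1 h).resolve_left two_ne_zero

/-- The bracket with i is a derivation of the anticommutator. -/
theorem anticommute_of_lie {i a b : B} (h : a * b + b * a = 0) :
    (i * a - a * i) * b + b * (i * a - a * i) + (a * (i * b - b * i) + (i * b - b * i) * a) = 0 := by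
  linear_combination (norm := skip) i * h - h * i
  noncomm_ring

theorem double_lie (a d : B) : a * (a * d) - (2 : ℂ) • (a * (d * a)) + d * (a * a) =
    a * (a * d - d * a) - (a * d - d * a) * a := by
  rw [two_smul]
  noncomm_ring

/-- The double bracket is quadratic in the acting element; comparing its value at (a+b)/√2 with
those at a and b isolates the mixed term. -/
theorem double_lie_polar {a b d : B} {r : ℂ} (hr : r * r = 2⁻¹)
    (ha : a * (a * d - d * a) - (a * d - d * a) * a = -d)
    (hb : b * (b * d - d * b) - (b * d - d * b) * b = -d)
    (h : (r • (a + b)) * ((r • (a + b)) * d - d * (r • (a + b))) -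
      ((r • (a + b)) * d - d * (r • (a + b))) * (r • (a + b)) = -d) :
    a * (b * d - d * b) - (b * d - d * b) * a + (b * (a * d - d * a) - (a * d - d * a) * b) = 0 := by
  have h₂ : ∀ c : B, (r • c) * ((r • c) * d - d * (r • c)) - ((r • c) * d - d * (r • c)) * (r • c) =
      (2⁻¹ : ℂ) • (c * (c * d - d * c) - (c * d - d * c) * c) := by
    intro c
    simp only [smul_mul_assoc, mul_smul_comm, ← smul_sub, smul_smul, hr]
  rw [h₂, inv_smul_eq_iff₀ two_ne_zero, two_smul] at h
  linear_combination (norm := skip) h - ha - hb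
  noncomm_ring

namespace IsQuaternionicDifferential

variable {d i j k : B}

theorem rotate (h : IsQuaternionicDifferential d i j k) : IsQuaternionicDifferential d j k i :=
  ⟨h.dd, h.jk, h.ki, h.ij, h.jjd, h.kkd, h.iid, h.jkd, h.kid, h.ijd⟩

/-- The polarised relation gives the symmetric part of the double bracket, and [[i, j], d] = -2[k,
d] the antisymmetric part. Hence d, [i, d], [j, d], [k, d] span a space stable under i, j, k. -/
theorem lie_left (h : IsQuaternionicDifferential d i j k) :
    i * (j * d - d * j) - (j * d - d * j) * i = -(k * d - d * k) := by
  rw [← sub_eq_zero]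
  refine eq_zero_of_add_self ?_
  linear_combination (norm := skip) h.ijd + h.ij * d - d * h.ij
  noncomm_ring

theorem lie_right (h : IsQuaternionicDifferential d i j k) :
    j * (i * d - d * i) - (i * d - d * i) * j = k * d - d * k := by
  rw [← sub_eq_zero]
  refine eq_zero_of_add_self ?_
  linear_combination (norm := skip) h.ijd - h.ij * d + d * h.ij
  noncomm_ring

theorem anticommute_d (h : IsQuaternionicDifferential d i j k) :
    d * (i * d - d * i) + (i * d - d * i) * d = 0 := by
  linear_combination (norm := skip) i * h.dd - h.dd * i
  noncomm_ring

/-- Bracketing {d, [i, d]} = 0 with i gives 2[i, d]² + {d, [i, [i, d]]} = 0, and the last term is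
-2d² = 0. -/
theorem square_lie (h : IsQuaternionicDifferential d i j k) :
    (i * d - d * i) * (i * d - d * i) = 0 := by
  refine eq_zero_of_add_self ?_
  have h₁ := anticommute_of_lie (i := i) h.anticommute_d
  rw [h.iid] at h₁
  linear_combination (norm := skip) h₁ + h.dd + h.dd
  noncomm_ring

/-- Bracketing {d, [j, d]} = 0 with i leaves this anticommutator and -{d, [k, d]}, which is already
known to vanish. -/
theorem anticommute_lie (h : IsQuaternionicDifferential d i j k) :
    (i * d - d * i) * (j * d - d * j) + (j * d - d * j) * (i * d - d * i) = 0 := by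
  have h₁ := anticommute_of_lie (i := i) h.rotate.anticommute_d
  rw [h.lie_left] at h₁
  linear_combination (norm := skip) h₁ + h.rotate.rotate.anticommute_d
  noncomm_ring

theorem del_mul_del (h : IsQuaternionicDifferential d i j k) :
    (d - Complex.I • (i * d - d * i)) * (d - Complex.I • (i * d - d * i)) = 0 := by
  have h₁ : ∀ a : B, (d - Complex.I • a) * (d - Complex.I • a) =
      d * d - Complex.I • (d * a + a * d) - a * a := by
    intro a
    simp only [sub_mul, mul_sub, smul_mul_assoc, mul_smul_comm, smul_smul, Complex.I_mul_I,
      smul_add, smul_sub, neg_smul, one_smul]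
    abel
  rw [h₁, h.dd, h.anticommute_d, h.square_lie]
  simp

theorem delJ_mul_delJ (h : IsQuaternionicDifferential d i j k) :
    ((j * d - d * j) + Complex.I • (k * d - d * k)) *
    ((j * d - d * j) + Complex.I • (k * d - d * k)) = 0 := by
  have h₁ : ∀ a b : B, (a + Complex.I • b) * (a + Complex.I • b) =
      a * a + Complex.I • (a * b + b * a) - b * b := by
    intro a b
    simp only [add_mul, mul_add, smul_mul_assoc, mul_smul_comm, smul_smul, Complex.I_mul_I,
      smul_add, neg_smul, one_smul]
    abel
  rw [h₁, h.rotate.square_lie, h.rotate.rotate.square_lie, h.rotate.anticommute_lie]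
  simp

theorem del_mul_delJ (h : IsQuaternionicDifferential d i j k) : (d - Complex.I • (i * d - d * i)) *
      ((j * d - d * j) + Complex.I • (k * d - d * k)) +
    ((j * d - d * j) + Complex.I • (k * d - d * k)) * (d - Complex.I • (i * d - d * i)) = 0 := by
  have h₁ : ∀ a b c : B, (d - Complex.I • a) * (b + Complex.I • c) +
      (b + Complex.I • c) * (d - Complex.I • a) = (d * b + b * d) + Complex.I • (d * c + c * d) -
      Complex.I • (a * b + b * a) + (c * a + a * c) := by
    intro a b c
    simp only [add_mul, mul_add, sub_mul, mul_sub, smul_mul_assoc, mul_smul_comm, smul_smul,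
      Complex.I_mul_I, smul_add, smul_sub, neg_smul, one_smul]
    abel
  rw [h₁, h.rotate.anticommute_d, h.rotate.rotate.anticommute_d, h.anticommute_lie,
    h.rotate.rotate.anticommute_lie]
  simp

/-- The bracket with i acts on the span of d and [i, d] with square -1, and the operator is its
eigenvector for √-1. `lie_delBar` is the conjugate case, and `lie_delJ` the same on the span of [j,
d] and [k, d]. -/
theorem lie_del (h : IsQuaternionicDifferential d i j k) :
    i * (d - Complex.I • (i * d - d * i)) - (d - Complex.I • (i * d - d * i)) * i =
    Complex.I • (d - Complex.I • (i * d - d * i)) := by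
  have h₁ : ∀ a : B, i * (d - Complex.I • a) - (d - Complex.I • a) * i =
      (i * d - d * i) - Complex.I • (i * a - a * i) := by
    intro a
    simp only [sub_mul, mul_sub, smul_mul_assoc, mul_smul_comm, smul_sub]
    abel
  rw [h₁, h.iid, smul_sub, smul_smul, Complex.I_mul_I, smul_neg, neg_smul, one_smul]
  abel

theorem lie_delBar (h : IsQuaternionicDifferential d i j k) :
    i * (d + Complex.I • (i * d - d * i)) - (d + Complex.I • (i * d - d * i)) * i =
    -(Complex.I • (d + Complex.I • (i * d - d * i))) := by
  have h₁ : ∀ a : B, i * (d + Complex.I • a) - (d + Complex.I • a) * i =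
      (i * d - d * i) + Complex.I • (i * a - a * i) := by
    intro a
    simp only [add_mul, mul_add, smul_mul_assoc, mul_smul_comm, smul_sub]
    abel
  rw [h₁, h.iid, smul_add, smul_smul, Complex.I_mul_I, smul_neg, neg_smul, one_smul]
  abel

theorem lie_delJ (h : IsQuaternionicDifferential d i j k) :
    i * ((j * d - d * j) + Complex.I • (k * d - d * k)) -
    ((j * d - d * j) + Complex.I • (k * d - d * k)) * i =
      Complex.I • ((j * d - d * j) + Complex.I • (k * d - d * k)) := by
  have h₁ : ∀ a b : B, i * (a + Complex.I • b) - (a + Complex.I • b) * i =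
      (i * a - a * i) + Complex.I • (i * b - b * i) := by
    intro a b
    simp only [add_mul, mul_add, smul_mul_assoc, mul_smul_comm, smul_sub]
    abel
  rw [h₁, h.lie_left, h.rotate.rotate.lie_right, smul_add, smul_smul, Complex.I_mul_I, neg_smul,
    one_smul]
  abel

end IsQuaternionicDifferential

end QuaternionicDifferential

end HKT
end

noncomputable section

namespace HKT

/-! ## Operators on smooth forms -/

section SmoothForms

set_option linter.unusedSectionVars false

variable {E : Type*} [NormedAddCommGroup E] [NormedSpace ℝ E] [FiniteDimensional ℝ E]
  {M : Type*} [TopologicalSpace M] [ChartedSpace E M] [IsManifold 𝓘(ℝ, E) ∞ M]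

theorem dLoc_add {F G : E → AltForm E} {z : E} (hF : DiffAt F z) (hG : DiffAt G z) :
    dLoc (fun y => F y + G y) z = dLoc F z + dLoc G z := by
  funext k
  cases k with
  | zero => exact (add_zero (0 : E [⋀^Fin 0]→L[ℝ] ℂ)).symm
  | succ k => exact extDeriv_fun_add (hF k) (hG k)

theorem dLoc_const_smul {F : E → AltForm E} {z : E} (hF : DiffAt F z) (c : ℂ) :
    dLoc (fun y => c • F y) z = c • dLoc F z := by
  let b := Module.finBasis ℝ E
  have h : ∀ v, pd (fun y => c • F y) z v = c • pd F z v := by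
    intro v
    funext k
    have h₁ : fderiv ℝ (fun y => c • F y k) z = c • fderiv ℝ (fun y => F y k) z :=
      fderiv_fun_const_smul (hF k) c
    exact DFunLike.congr_fun h₁ v
  rw [dLoc_eq b, dLoc_eq b, Finset.smul_sum]
  exact Finset.sum_congr rfl fun l _ => by rw [h, map_smul]

theorem loc_add (x : M) (η ζ : TotalForm E M) (y : E) : loc x (η + ζ) y = loc x η y + loc x ζ y :=
  map_add (pull (dSymm x y)) _ _

theorem loc_smul (x : M) (c : ℂ) (η : TotalForm E M) (y : E) : loc x (c • η) y = c • loc x η y :=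
  map_smul (pull (dSymm x y)) _ _

variable (E M) in
/-- The space of smooth forms of all degrees. -/
def smoothForms : Submodule ℂ (TotalForm E M) where
  carrier := {η | IsSmoothForm η}
  add_mem' {η ζ} hη hζ := isSmoothForm_of_smoothAt fun x =>
    ((hη.smoothAt (mem_extChartAt_target x)).add (hζ.smoothAt (mem_extChartAt_target x))).congr
      (Filter.Eventually.of_forall fun y => loc_add x η ζ y)
  zero_mem' := fun k _ => contDiffOn_const (c := (0 : E [⋀^Fin k]→L[ℝ] ℂ))
  smul_mem' c η hη := isSmoothForm_of_smoothAt fun x =>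
    ((hη.smoothAt (mem_extChartAt_target x)).const_smul c).congr
      (Filter.Eventually.of_forall fun y => loc_smul x c η y)

/-- The value of a smooth form at a point. -/
def ev (x : M) : smoothForms E M →ₗ[ℂ] AltForm E where
  toFun η := fib η.1 x
  map_add' _ _ := rfl
  map_smul' _ _ := rfl

theorem ev_ext {η ζ : smoothForms E M} (h : ∀ x, ev x η = ev x ζ) : η = ζ :=
  Subtype.ext (fib_ext h)

theorem end_ext {A B : Module.End ℂ (smoothForms E M)} (h : ∀ x η, ev x (A η) = ev x (B η)) :
    A = B := LinearMap.ext fun η => ev_ext fun x => h x η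

variable (E M) in
/-- The de Rham differential on smooth forms. -/
def dOp : Module.End ℂ (smoothForms E M) where
  toFun η := ⟨dTot η.1, isSmoothForm_dTot η.2⟩
  map_add' η ζ := ev_ext fun x => by
    have h := mem_extChartAt_target (I := 𝓘(ℝ, E)) x
    have h₁ := dLoc_congr (z := extChartAt 𝓘(ℝ, E) x x)
      (Filter.Eventually.of_forall fun y => loc_add x η.1 ζ.1 y)
    rw [map_add]
    change fib (dTot (η.1 + ζ.1)) x = fib (dTot η.1) x + fib (dTot ζ.1) x
    rw [fib_dTot, fib_dTot, fib_dTot, h₁]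
    exact dLoc_add (η.2.smoothAt h).diffAt (ζ.2.smoothAt h).diffAt
  map_smul' c η := ev_ext fun x => by
    have h := mem_extChartAt_target (I := 𝓘(ℝ, E)) x
    have h₁ := dLoc_congr (z := extChartAt 𝓘(ℝ, E) x x)
      (Filter.Eventually.of_forall fun y => loc_smul x c η.1 y)
    rw [map_smul]
    change fib (dTot (c • η.1)) x = c • fib (dTot η.1) x
    rw [fib_dTot, fib_dTot, h₁]
    exact dLoc_const_smul (η.2.smoothAt h).diffAt c

theorem dOp_mul_dOp : dOp E M * dOp E M = 0 :=
  LinearMap.ext fun η => Subtype.ext (dTot_dTot η.2)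

/-- A field of operators on the exterior algebras of the tangent spaces that preserves smoothness. -/
def fibOp (P : M → Module.End ℂ (AltForm E))
    (hP : ∀ η : TotalForm E M, IsSmoothForm η → IsSmoothForm (fibMap P η)) :
    Module.End ℂ (smoothForms E M) where
  toFun η := ⟨fibMap P η.1, hP η.1 η.2⟩
  map_add' η ζ := ev_ext fun x => map_add (P x) (ev x η) (ev x ζ)
  map_smul' c η := ev_ext fun x => map_smul (P x) c (ev x η)

namespace HypercomplexHermitian

variable (S : HypercomplexHermitian E M)

/-- The derivation of the algebra of forms given by the action of a quaternion. -/
def iOp (q : ℍ[ℝ]) : Module.End ℂ (smoothForms E M) :=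
  fibOp (fun x => der (S.op q x)) fun _ hη => isSmoothForm_der (S.contDiffAt_op q) hη

theorem ev_iOp (q : ℍ[ℝ]) (x : M) (η : smoothForms E M) :
    ev x (S.iOp q η) = der (S.op q x) (ev x η) := rfl

theorem iOp_add (p q : ℍ[ℝ]) : S.iOp (p + q) = S.iOp p + S.iOp q := by
  refine end_ext fun x η => ?_
  have h : S.op (p + q) x = S.op p x + S.op q x := map_add (S.quat x) p q
  rw [ev_iOp, h, der_add]
  rfl

theorem iOp_smul (r : ℝ) (q : ℍ[ℝ]) : S.iOp (r • q) = (r : ℂ) • S.iOp q := by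
  refine end_ext fun x η => ?_
  have h : S.op (r • q) x = r • S.op q x := map_smul (S.quat x) r q
  rw [ev_iOp, h, der_smul]
  rfl

theorem iOp_zero : S.iOp 0 = 0 := by
  simpa using S.iOp_smul 0 0

theorem iOp_mul_iOp (p q : ℍ[ℝ]) :
    S.iOp p * S.iOp q - S.iOp q * S.iOp p = S.iOp (q * p - p * q) := by
  refine end_ext fun x η => ?_
  have h : S.op (q * p - p * q) x = (S.op q x).comp (S.op p x) - (S.op p x).comp (S.op q x) := by
    ext v
    rw [sub_apply, ContinuousLinearMap.comp_apply, ContinuousLinearMap.comp_apply, op_mul, op_mul]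
    have h₁ : S.op (q * p - p * q) x = S.op (q * p) x - S.op (p * q) x := map_sub (S.quat x) _ _
    rw [h₁, sub_apply]
  rw [ev_iOp, h, LinearMap.sub_apply, map_sub]
  have h₂ := LinearMap.congr_fun (der_der (S.op p x) (S.op q x)) (ev x η)
  exact sub_eq_iff_eq_add'.2 h₂

/-- The degree operator. -/
def degOp : Module.End ℂ (smoothForms E M) := S.iOp 1

theorem ev_degOp (x : M) (η : smoothForms E M) (k : ℕ) :
    ev x (S.degOp η) k = (k : ℂ) • ev x η k := by
  have h : S.op 1 x = ContinuousLinearMap.id ℝ E := map_one (S.quat x)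
  rw [degOp, ev_iOp, h, der_id_apply]

theorem degOp_mul_iOp (q : ℍ[ℝ]) : S.degOp * S.iOp q = S.iOp q * S.degOp := by
  rw [← sub_eq_zero, degOp, iOp_mul_iOp, mul_one, one_mul, sub_self, iOp_zero]

/-- In each degree the component of dη depends only on the preceding component of η, on which the
degree operator is a scalar. -/
theorem degOp_mul_dOp : S.degOp * dOp E M = dOp E M * S.degOp + dOp E M := by
  refine end_ext fun x η => funext fun k => ?_
  cases k with
  | zero =>
    have h : ∀ ζ : smoothForms E M, ev x (dOp E M ζ) 0 = 0 := fun _ => rfl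
    rw [Module.End.mul_apply, ev_degOp, LinearMap.add_apply, map_add, AltForm.add_apply,
      Module.End.mul_apply, h, h, smul_zero_form]
    simp
  | succ k =>
    rw [Module.End.mul_apply, ev_degOp, LinearMap.add_apply, map_add, AltForm.add_apply,
      Module.End.mul_apply]
    have h : ev x (dOp E M (S.degOp η)) (k + 1) = ev x (dOp E M ((k : ℂ) • η)) (k + 1) := by
      have h₁ : ∀ x, (S.degOp η).1 k x = (((k : ℂ) • η : smoothForms E M)).1 k x := fun x =>
        S.ev_degOp x η k
      change DForm.d ((S.degOp η).1 k) x = DForm.d (((k : ℂ) • η : smoothForms E M).1 k) x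
      rw [funext h₁]
    rw [h, map_smul, map_smul, AltForm.smul_apply]
    refine ContinuousAlternatingMap.ext fun w => ?_
    simp only [ContinuousAlternatingMap.add_apply, ContinuousAlternatingMap.smul_apply, smul_eq_mul]
    push_cast
    ring

variable [T2Space M]

theorem iOp_iOp_dOp {q : ℍ[ℝ]} (hq : q * q = -1) :
    S.iOp q * (S.iOp q * dOp E M - dOp E M * S.iOp q) -
      (S.iOp q * dOp E M - dOp E M * S.iOp q) * S.iOp q = -dOp E M := by
  have h₁ : S.iOp q * (S.iOp q * dOp E M) - (2 : ℂ) • (S.iOp q * (dOp E M * S.iOp q)) +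
      dOp E M * (S.iOp q * S.iOp q) = -dOp E M := end_ext fun x η =>
    der_der_dTot (S.contDiffAt_op q) (S.op_op_self hq) (S.nijTensor_op hq) η.2 x
  rw [← h₁, double_lie]

/-- When p and q anticommute, (p+q)/√2 is again an imaginary unit, so integrability of that complex
structure is available too. -/
theorem iOp_iOp_dOp_polar {p q : ℍ[ℝ]} (hp : p * p = -1) (hq : q * q = -1) (h : p * q + q * p = 0) :
    S.iOp p * (S.iOp q * dOp E M - dOp E M * S.iOp q) -
      (S.iOp q * dOp E M - dOp E M * S.iOp q) * S.iOp p +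
    (S.iOp q * (S.iOp p * dOp E M - dOp E M * S.iOp p) -
      (S.iOp p * dOp E M - dOp E M * S.iOp p) * S.iOp q) = 0 := by
  set r : ℝ := (Real.sqrt 2)⁻¹ with hr
  have hrr : r * r = 2⁻¹ := by
    rw [hr, ← mul_inv, Real.mul_self_sqrt (by norm_num)]
  have hpq : (r • (p + q)) * (r • (p + q)) = -1 := by
    have h₁ : (p + q) * (p + q) = -1 + -1 := by
      linear_combination (norm := skip) hp + hq + h
      noncomm_ring
    rw [smul_mul_smul_comm, hrr, h₁, smul_add, ← add_smul]
    norm_num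
  have hc : (r : ℂ) * r = 2⁻¹ := by
    rw [← Complex.ofReal_mul, hrr]
    simp
  have h₁ := S.iOp_iOp_dOp hpq
  rw [S.iOp_smul, S.iOp_add] at h₁
  exact double_lie_polar hc (S.iOp_iOp_dOp hp) (S.iOp_iOp_dOp hq) h₁

end HypercomplexHermitian

theorem quatJ_mul_quatK : quatJ * quatK = quatI := by
  ext <;> simp <;> simp [quatI, quatJ, quatK]

theorem quatK_mul_quatJ : quatK * quatJ = -quatI := by
  ext <;> simp <;> simp [quatI, quatJ, quatK]

theorem quatK_mul_quatI : quatK * quatI = quatJ := by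
  ext <;> simp <;> simp [quatI, quatJ, quatK]

theorem quatI_mul_quatK : quatI * quatK = -quatJ := by
  ext <;> simp <;> simp [quatI, quatJ, quatK]

theorem HypercomplexHermitian.isQuaternionicDifferential [T2Space M]
    (S : HypercomplexHermitian E M) :
    IsQuaternionicDifferential (dOp E M) (S.iOp quatI) (S.iOp quatJ) (S.iOp quatK) := by
  have hneg : ∀ p : ℍ[ℝ], S.iOp (-p - p) = -(S.iOp p + S.iOp p) := by
    intro p
    rw [eq_neg_iff_add_eq_zero, ← S.iOp_add, ← S.iOp_add, ← S.iOp_zero]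
    congr 1
    abel
  refine ⟨dOp_mul_dOp, ?_, ?_, ?_, S.iOp_iOp_dOp quatI_mul_self, S.iOp_iOp_dOp quatJ_mul_self,
    S.iOp_iOp_dOp quatK_mul_self, S.iOp_iOp_dOp_polar quatI_mul_self quatJ_mul_self ?_,
    S.iOp_iOp_dOp_polar quatJ_mul_self quatK_mul_self ?_,
    S.iOp_iOp_dOp_polar quatK_mul_self quatI_mul_self ?_⟩
  · rw [S.iOp_mul_iOp, quatI_mul_quatJ, quatJ_mul_quatI, hneg]
  · rw [S.iOp_mul_iOp, quatJ_mul_quatK, quatK_mul_quatJ, hneg]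
  · rw [S.iOp_mul_iOp, quatK_mul_quatI, quatI_mul_quatK, hneg]
  · rw [quatI_mul_quatJ, quatJ_mul_quatI, add_neg_cancel]
  · rw [quatJ_mul_quatK, quatK_mul_quatJ, add_neg_cancel]
  · rw [quatK_mul_quatI, quatI_mul_quatK, add_neg_cancel]

end SmoothForms

end HKT
end

noncomputable section

namespace HKT

/-! ## The Dolbeault differentials -/

section DegreeOperator

set_option linter.unusedSectionVars false

variable {B : Type*} [Ring B]

theorem degree_lie {n i d : B} (hi : n * i = i * n) (hd : n * d = d * n + d) :
    n * (i * d - d * i) = (i * d - d * i) * n + (i * d - d * i) := by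
  linear_combination (norm := skip) hi * d + i * hd - hd * i - d * hi
  noncomm_ring

variable [Algebra ℂ B]

theorem degree_add {n a b : B} (ha : n * a = a * n + a) (hb : n * b = b * n + b) :
    n * (a + b) = (a + b) * n + (a + b) := by
  rw [mul_add, ha, hb, add_mul]
  abel

theorem degree_sub {n a b : B} (ha : n * a = a * n + a) (hb : n * b = b * n + b) :
    n * (a - b) = (a - b) * n + (a - b) := by
  rw [mul_sub, ha, hb, sub_mul]
  abel

theorem degree_smul {n a : B} (c : ℂ) (ha : n * a = a * n + a) :
    n * (c • a) = (c • a) * n + c • a := by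
  rw [mul_smul_comm, ha, smul_add, smul_mul_assoc]

theorem weight_smul {i a : B} {s : ℂ} (c : ℂ) (h : i * a - a * i = s • a) :
    i * (c • a) = (c • a) * i + s • (c • a) := by
  rw [mul_smul_comm, smul_mul_assoc, ← sub_eq_iff_eq_add', ← smul_sub, h, smul_comm]

/-- Conjugation of the Dolbeault differential of a quaternionic differential. -/
theorem IsQuaternionicDifferential.conj_delBar {P P' d i j k : B}
    (h : IsQuaternionicDifferential d i j k) (hP : P * P' = 1) (hP' : P' * P = 1)
    (hi : P * i = -(i * P)) (hd : P' * d * P = -(j * d - d * j)) :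
    P' * ((2⁻¹ : ℂ) • (d + Complex.I • (i * d - d * i))) * P =
      (-2⁻¹ : ℂ) • ((j * d - d * j) + Complex.I • (k * d - d * k)) := by
  have hi' : P' * i * P = -i := by
    rw [mul_assoc, ← neg_eq_iff_eq_neg.2 hi, mul_neg, ← mul_assoc, hP', one_mul]
  -- Conjugation by P turns i into -i and d into -[j, d], hence [i, d] into [i, [j, d]].
  have h₁ : P' * (i * d - d * i) * P = -(k * d - d * k) := by
    have h₂ : P' * (i * d - d * i) * P = P' * i * P * (P' * d * P) - P' * d * P * (P' * i * P) := by
      linear_combination (norm := skip) P' * d * hP * i * P - P' * i * hP * d * P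
      noncomm_ring
    rw [h₂, hi', hd, neg_mul_neg, neg_mul_neg, h.lie_left]
  rw [mul_smul_comm, smul_mul_assoc, mul_add, add_mul, mul_smul_comm, smul_mul_assoc, hd, h₁,
    neg_smul, ← smul_neg, neg_add, smul_neg]

end DegreeOperator

section Dolbeault

set_option linter.unusedSectionVars false

variable {E : Type*} [NormedAddCommGroup E] [NormedSpace ℝ E] [FiniteDimensional ℝ E]
  {M : Type*} [TopologicalSpace M] [ChartedSpace E M] [IsManifold 𝓘(ℝ, E) ∞ M]

theorem hodgeComponent_add {k : ℕ} (I : E →L[ℝ] E) (p q : ℕ) (α β : E [⋀^Fin k]→L[ℝ] ℂ) :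
    hodgeComponent I p q (α + β) = hodgeComponent I p q α + hodgeComponent I p q β := by
  ext v
  simp only [hodgeComponent, ContinuousAlternatingMap.smul_apply,
    ContinuousAlternatingMap.sum_apply, ContinuousAlternatingMap.add_apply,
    ContinuousAlternatingMap.compContinuousLinearMap_apply, smul_add, Finset.sum_add_distrib]

namespace HypercomplexHermitian

variable (S : HypercomplexHermitian E M)

/-- The Dolbeault differential `∂` on smooth forms. -/
def delOp : Module.End ℂ (smoothForms E M) :=
  (2⁻¹ : ℂ) • (dOp E M - Complex.I • (S.iOp quatI * dOp E M - dOp E M * S.iOp quatI))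

/-- The Dolbeault differential `∂bar` on smooth forms. -/
def delBarOp : Module.End ℂ (smoothForms E M) :=
  (2⁻¹ : ℂ) • (dOp E M + Complex.I • (S.iOp quatI * dOp E M - dOp E M * S.iOp quatI))

/-- The conjugate of `∂bar` by the action of `J` on smooth forms. -/
def delJOp : Module.End ℂ (smoothForms E M) :=
  (-2⁻¹ : ℂ) • ((S.iOp quatJ * dOp E M - dOp E M * S.iOp quatJ) +
    Complex.I • (S.iOp quatK * dOp E M - dOp E M * S.iOp quatK))

/-- The multiplicative action of a quaternion on forms. -/
def actOp (q : ℍ[ℝ]) : Module.End ℂ (smoothForms E M) :=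
  fibOp (fun x => pull (S.op q x)) fun _ hη => isSmoothForm_pull (S.contDiffAt_op q) hη

theorem ev_actOp (q : ℍ[ℝ]) (x : M) (η : smoothForms E M) :
    ev x (S.actOp q η) = pull (S.op q x) (ev x η) := rfl

theorem delOp_add_delBarOp : S.delOp + S.delBarOp = dOp E M := by
  rw [delOp, delBarOp, ← smul_add, sub_add_add_cancel, ← two_smul ℂ (dOp E M), smul_smul,
    inv_mul_cancel₀ two_ne_zero, one_smul]

theorem degOp_mul_lie (q : ℍ[ℝ]) :
    S.degOp * (S.iOp q * dOp E M - dOp E M * S.iOp q) =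
      (S.iOp q * dOp E M - dOp E M * S.iOp q) * S.degOp +
        (S.iOp q * dOp E M - dOp E M * S.iOp q) :=
  degree_lie (S.degOp_mul_iOp q) S.degOp_mul_dOp

theorem degOp_mul_delOp : S.degOp * S.delOp = S.delOp * S.degOp + S.delOp :=
  degree_smul _ (degree_sub S.degOp_mul_dOp (degree_smul _ (S.degOp_mul_lie _)))

theorem degOp_mul_delBarOp : S.degOp * S.delBarOp = S.delBarOp * S.degOp + S.delBarOp :=
  degree_smul _ (degree_add S.degOp_mul_dOp (degree_smul _ (S.degOp_mul_lie _)))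

theorem degOp_mul_delJOp : S.degOp * S.delJOp = S.delJOp * S.degOp + S.delJOp :=
  degree_smul _ (degree_add (S.degOp_mul_lie _) (degree_smul _ (S.degOp_mul_lie _)))

theorem iOp_apply_zero (q : ℍ[ℝ]) (x : M) (η : smoothForms E M) : ev x (S.iOp q η) 0 = 0 := by
  rw [ev_iOp, der_zero_degree]

theorem dOp_apply_zero (x : M) (η : smoothForms E M) : ev x (dOp E M η) 0 = 0 := rfl

theorem delOp_apply_zero (x : M) (η : smoothForms E M) : ev x (S.delOp η) 0 = 0 := by
  have h : ev x (S.delOp η) 0 = (2⁻¹ : ℂ) • (ev x (dOp E M η) 0 - Complex.I •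
    (ev x (S.iOp quatI (dOp E M η)) 0 - ev x (dOp E M (S.iOp quatI η)) 0)) := rfl
  rw [h, iOp_apply_zero, dOp_apply_zero, dOp_apply_zero, sub_zero, smul_zero_form, sub_zero,
    smul_zero_form]

theorem delJOp_apply_zero (x : M) (η : smoothForms E M) : ev x (S.delJOp η) 0 = 0 := by
  have h : ev x (S.delJOp η) 0 = (-2⁻¹ : ℂ) • ((ev x (S.iOp quatJ (dOp E M η)) 0 -
    ev x (dOp E M (S.iOp quatJ η)) 0) + Complex.I •
    (ev x (S.iOp quatK (dOp E M η)) 0 - ev x (dOp E M (S.iOp quatK η)) 0)) := rfl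
  rw [h, iOp_apply_zero, iOp_apply_zero, dOp_apply_zero, dOp_apply_zero, sub_zero, smul_zero_form,
    add_zero, smul_zero_form]

theorem actOp_mul_actOp_neg {q : ℍ[ℝ]} (hq : q * q = -1) : S.actOp q * S.actOp (-q) = 1 := by
  refine end_ext fun x η => ?_
  rw [Module.End.mul_apply, ev_actOp, ev_actOp, ← Module.End.mul_apply, pull_mul_pull]
  have h : (S.op (-q) x).comp (S.op q x) = ContinuousLinearMap.id ℝ E := by
    ext v
    rw [ContinuousLinearMap.comp_apply, op_mul, neg_mul, hq, neg_neg, op_one,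
      ContinuousLinearMap.id_apply]
  rw [h, pull_id]
  rfl

theorem iOp_mul_actOp {p q : ℍ[ℝ]} (h : p * q + q * p = 0) :
    S.actOp p * S.iOp q = -(S.iOp q * S.actOp p) := by
  refine end_ext fun x η => ?_
  have h₁ : (S.op p x).comp (S.op (-q) x) = (S.op q x).comp (S.op p x) := by
    ext v
    rw [ContinuousLinearMap.comp_apply, ContinuousLinearMap.comp_apply, op_mul, op_mul, mul_neg,
      eq_neg_of_add_eq_zero_right h]
  have h₂ := LinearMap.congr_fun (pull_der h₁) (ev x η)
  have h₃ : S.op (-q) x = (-1 : ℝ) • S.op q x := by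
    ext v
    rw [op_neg, smul_apply, neg_one_smul]
  rw [h₃, der_smul] at h₂
  refine h₂.trans ?_
  rw [LinearMap.neg_apply, map_neg, Complex.ofReal_neg, Complex.ofReal_one, neg_one_smul]
  rfl

variable [T2Space M]

theorem actOp_conj_dOp {q : ℍ[ℝ]} (hq : q * q = -1) :
    S.actOp (-q) * dOp E M * S.actOp q = -(S.iOp q * dOp E M - dOp E M * S.iOp q) := by
  refine end_ext fun x η => ?_
  have h := pull_dTot_pull (S.contDiffAt_op q) (S.op_op_self hq) (S.nijTensor_op hq) η.2 x
  have h₁ : S.op (-q) x = -S.op q x := map_neg (S.quat x) q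
  rw [neg_sub, mul_assoc, Module.End.mul_apply, ev_actOp, h₁]
  exact h

theorem actOp_conj_delBarOp : S.actOp (-quatJ) * S.delBarOp * S.actOp quatJ = S.delJOp := by
  have hP := S.actOp_mul_actOp_neg quatJ_mul_self
  have hP' : S.actOp (-quatJ) * S.actOp quatJ = 1 := by
    have h := S.actOp_mul_actOp_neg (q := -quatJ) (by rw [neg_mul_neg, quatJ_mul_self])
    rwa [neg_neg] at h
  exact S.isQuaternionicDifferential.conj_delBar hP hP' (S.iOp_mul_actOp
    (by rw [quatI_mul_quatJ, quatJ_mul_quatI, neg_add_cancel])) (S.actOp_conj_dOp quatJ_mul_self)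

theorem iOp_mul_delOp :
    S.iOp quatI * S.delOp = S.delOp * S.iOp quatI + Complex.I • S.delOp :=
  weight_smul _ S.isQuaternionicDifferential.lie_del

theorem iOp_mul_delBarOp :
    S.iOp quatI * S.delBarOp = S.delBarOp * S.iOp quatI + (-Complex.I) • S.delBarOp := by
  refine weight_smul _ ?_
  rw [neg_smul]
  exact S.isQuaternionicDifferential.lie_delBar

theorem iOp_mul_delJOp :
    S.iOp quatI * S.delJOp = S.delJOp * S.iOp quatI + Complex.I • S.delJOp :=
  weight_smul _ S.isQuaternionicDifferential.lie_delJ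

/-- An operator raising the degree by one and the eigenvalue of I by s maps degree-k forms of
eigenvalue tk to eigenvalue tk + s. It is used with t = √-1 for type (k, 0) and t = -√-1 for type
(0, k). -/
theorem derCLM_ev {A : Module.End ℂ (smoothForms E M)} {s t : ℂ}
    (hdeg : S.degOp * A = A * S.degOp + A) (hw : S.iOp quatI * A = A * S.iOp quatI + s • A)
    {η : smoothForms E M} (hη : S.iOp quatI η = t • S.degOp η) (x : M) (k : ℕ) :
    derCLM (S.op quatI x) (k + 1) (ev x (A η) (k + 1)) = (t * k + s) • ev x (A η) (k + 1) := by
  have h₁ := LinearMap.congr_fun hdeg η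
  have h₂ := LinearMap.congr_fun hw η
  simp only [Module.End.mul_apply, LinearMap.add_apply, LinearMap.smul_apply] at h₁ h₂
  rw [hη, map_smul, ← sub_eq_iff_eq_add.2 h₁] at h₂
  have h₃ := congrArg (fun ζ => ev x ζ (k + 1)) h₂
  have h₄ : ev x (t • (S.degOp (A η) - A η) + s • A η) (k + 1) =
      t • (ev x (S.degOp (A η)) (k + 1) - ev x (A η) (k + 1)) + s • ev x (A η) (k + 1) := rfl
  refine h₃.trans (h₄.trans ?_)
  rw [S.ev_degOp]
  refine ContinuousAlternatingMap.ext fun w => ?_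
  simp only [ContinuousAlternatingMap.add_apply, ContinuousAlternatingMap.sub_apply,
    ContinuousAlternatingMap.smul_apply, smul_eq_mul]
  push_cast
  ring

theorem mem_holForms_iff (η : smoothForms E M) :
    η.1 ∈ S.holForms ↔ S.iOp quatI η = Complex.I • S.degOp η := by
  have h₁ : η.1 ∈ S.holForms ↔ ∀ x k, IsHolomorphicType (S.herm x).I (ev x η k) :=
    ⟨fun h x k => (h k).2 x, fun h k => ⟨η.2 k, fun x => h x k⟩⟩
  rw [h₁]
  have h₂ : ∀ x, S.op 1 x = ContinuousLinearMap.id ℝ E := fun x => map_one (S.quat x)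
  have h₃ : ∀ x, ev x (Complex.I • S.degOp η) =
      Complex.I • der (ContinuousLinearMap.id ℝ E) (ev x η) := by
    intro x
    rw [map_smul, degOp, ev_iOp, h₂]
  constructor
  · intro h
    exact ev_ext fun x => (QuatHermitian.isHolomorphicType_iff.1 (h x)).trans (h₃ x).symm
  · intro h x
    refine QuatHermitian.isHolomorphicType_iff.2 ?_
    rw [← h₃, ← h]
    rfl

/-- On a form of type (k, 0), dη is the sum of a part of weight k + 1 and a part of weight k - 1;
the Hodge component defining ∂ keeps the first and kills the second. -/
theorem coe_delOp {η : smoothForms E M} (hη : η.1 ∈ S.holForms) : (S.delOp η).1 = S.del η.1 := by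
  rw [mem_holForms_iff] at hη
  refine fib_ext fun x => funext fun k => ?_
  cases k with
  | zero => exact S.delOp_apply_zero x η
  | succ k =>
    have h₁ := S.derCLM_ev S.degOp_mul_delOp S.iOp_mul_delOp hη x k
    have h₂ := S.derCLM_ev S.degOp_mul_delBarOp S.iOp_mul_delBarOp hη x k
    have hd : ev x (dOp E M η) (k + 1) =
        ev x (S.delOp η) (k + 1) + ev x (S.delBarOp η) (k + 1) := by
      rw [← S.delOp_add_delBarOp]
      rfl
    have hII := S.op_op_self quatI_mul_self x
    have e₁ := hodgeComponent_of_derCLM (m := k + 1) hII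
      (h₁.trans (by push_cast; congr 1; ring)) (k + 1) 0 (by push_cast; simp; omega)
    have e₂ := hodgeComponent_of_derCLM (m := k - 1) hII
      (h₂.trans (by push_cast; congr 1; ring)) (k + 1) 0
      (by rw [abs_lt]; push_cast; constructor <;> linarith)
    rw [if_pos (by push_cast; ring)] at e₁
    rw [if_neg (by push_cast; omega)] at e₂
    have h : hodgeComponent (S.op quatI x) (k + 1) 0 (ev x (dOp E M η) (k + 1)) =
        ev x (S.delOp η) (k + 1) := by
      rw [hd, hodgeComponent_add, e₁, e₂, add_zero]
    exact h.symm

/-- The form Jη has type (0, k), as J anticommutes with I. So its differential has parts of weights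
1 - k and -k - 1, and the component defining the conjugate differential is the second. -/
theorem coe_delJOp {η : smoothForms E M} (hη : η.1 ∈ S.holForms) :
    (S.delJOp η).1 = S.delJ η.1 := by
  rw [mem_holForms_iff] at hη
  set ζ := S.actOp quatJ η with hζdef
  have hζ : S.iOp quatI ζ = (-Complex.I) • S.degOp ζ := by
    have h := LinearMap.congr_fun (S.iOp_mul_actOp (p := quatJ) (q := quatI)
      (by rw [quatI_mul_quatJ, quatJ_mul_quatI, neg_add_cancel])) η
    rw [LinearMap.neg_apply, Module.End.mul_apply, Module.End.mul_apply, hη, map_smul] at h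
    have h₂ : S.actOp quatJ (S.degOp η) = S.degOp ζ := ev_ext fun x => funext fun k => by
      rw [S.ev_degOp]
      change (ev x (S.degOp η) k).compContinuousLinearMap (S.op quatJ x) = _
      rw [S.ev_degOp]
      rfl
    rw [neg_smul, ← h₂, h, neg_neg]
  refine fib_ext fun x => funext fun k => ?_
  cases k with
  | zero => exact S.delJOp_apply_zero x η
  | succ k =>
    have h₁ := S.derCLM_ev S.degOp_mul_delOp S.iOp_mul_delOp hζ x k
    have h₂ := S.derCLM_ev S.degOp_mul_delBarOp S.iOp_mul_delBarOp hζ x k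
    have hd : ev x (dOp E M ζ) (k + 1) =
        ev x (S.delOp ζ) (k + 1) + ev x (S.delBarOp ζ) (k + 1) := by
      rw [← S.delOp_add_delBarOp]
      rfl
    have hII := S.op_op_self quatI_mul_self x
    have e₁ := hodgeComponent_of_derCLM (m := -k + 1) hII
      (h₁.trans (by push_cast; congr 1; ring)) 0 (k + 1)
      (by rw [abs_lt]; push_cast; constructor <;> linarith)
    have e₂ := hodgeComponent_of_derCLM (m := -(k + 1)) hII
      (h₂.trans (by push_cast; congr 1; ring)) 0 (k + 1)
      (by rw [abs_lt]; push_cast; constructor <;> linarith)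
    rw [if_neg (by push_cast; omega)] at e₁
    rw [if_pos (by push_cast; ring)] at e₂
    have h : hodgeComponent (S.op quatI x) 0 (k + 1) (ev x (dOp E M ζ) (k + 1)) =
        ev x (S.delBarOp ζ) (k + 1) := by
      rw [hd, hodgeComponent_add, e₁, e₂, zero_add]
    have h₃ : ev x (S.delJOp η) (k + 1) =
        (ev x (S.delBarOp ζ) (k + 1)).compContinuousLinearMap (S.op (-quatJ) x) := by
      rw [← S.actOp_conj_delBarOp]
      rfl
    have h₄ : S.op (-quatJ) x = -S.op quatJ x := map_neg (S.quat x) quatJ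
    rw [← h, h₄] at h₃
    exact h₃

end HypercomplexHermitian

end Dolbeault

end HKT
end

noncomputable section

namespace HKT

/-! ## Multiplication by the standard form and the Dolbeault differentials -/

theorem lie_lie_right {B : Type*} [Ring B] (i d l : B) :
    (i * d - d * i) * l - l * (i * d - d * i) =
      (i * (d * l - l * d) - (d * l - l * d) * i) - (d * (i * l - l * i) - (i * l - l * i) * d) := by
  noncomm_ring

theorem lie_smul_add {B : Type*} [Ring B] [Algebra ℂ B] (a b l : B) (c s : ℂ) :
    (c • (a + s • b)) * l - l * (c • (a + s • b)) =
      c • ((a * l - l * a) + s • (b * l - l * b)) := by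
  simp only [smul_mul_assoc, mul_smul_comm, smul_sub, smul_add, add_mul, mul_add]
  abel

theorem lie_smul_sub {B : Type*} [Ring B] [Algebra ℂ B] (a b l : B) (c s : ℂ) :
    (c • (a - s • b)) * l - l * (c • (a - s • b)) =
      c • ((a * l - l * a) - s • (b * l - l * b)) := by
  rw [sub_eq_add_neg a, ← neg_smul, lie_smul_add, neg_smul, ← sub_eq_add_neg]

section Conjugation

variable {E : Type*} [NormedAddCommGroup E] [NormedSpace ℝ E]

variable (E) in
/-- Complex conjugation of forms. -/
def conjCLM (k : ℕ) : (E [⋀^Fin k]→L[ℝ] ℂ) →L[ℝ] (E [⋀^Fin k]→L[ℝ] ℂ) :=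
  ContinuousLinearMap.compContinuousAlternatingMapCLM ℝ E ℂ ℂ (Fin k)
    (Complex.conjCLE : ℂ →L[ℝ] ℂ)

theorem conjCLM_apply (k : ℕ) (α : E [⋀^Fin k]→L[ℝ] ℂ) (v : Fin k → E) :
    conjCLM E k α v = starRingEnd ℂ (α v) := rfl

theorem extDeriv_conj {k : ℕ} {F : E → E [⋀^Fin k]→L[ℝ] ℂ} {z : E}
    (hF : DifferentiableAt ℝ F z) :
    extDeriv (fun y => conjCLM E k (F y)) z = conjCLM E (k + 1) (extDeriv F z) := by
  have h : fderiv ℝ (fun y => conjCLM E k (F y)) z = (conjCLM E k).comp (fderiv ℝ F z) :=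
    ((conjCLM E k).hasFDerivAt.comp z hF.hasFDerivAt).fderiv
  ext v
  rw [conjCLM_apply, extDeriv, extDeriv, h, ContinuousAlternatingMap.alternatizeUncurryFin_apply,
    ContinuousAlternatingMap.alternatizeUncurryFin_apply, map_sum]
  refine Finset.sum_congr rfl fun i _ => ?_
  rw [ContinuousLinearMap.comp_apply, conjCLM_apply]
  simp

/-- Conjugation changes the sign of the Fourier frequency. -/
theorem hodgeComponent_conj {k : ℕ} (I : E →L[ℝ] E) (p q : ℕ) (α : E [⋀^Fin k]→L[ℝ] ℂ) :
    hodgeComponent I q p (conjCLM E k α) = conjCLM E k (hodgeComponent I p q α) := by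
  ext v
  rw [conjCLM_apply]
  simp only [hodgeComponent, ContinuousAlternatingMap.smul_apply,
    ContinuousAlternatingMap.sum_apply, ContinuousAlternatingMap.compContinuousLinearMap_apply,
    conjCLM_apply, smul_eq_mul, map_mul, map_sum, ← Complex.exp_conj]
  congr 1
  · simp [map_ofNat]
  · refine Finset.sum_congr rfl fun m _ => ?_
    congr 2
    simp [map_ofNat]
    ring

end Conjugation

section Commutation

set_option linter.unusedSectionVars false

variable {E : Type*} [NormedAddCommGroup E] [NormedSpace ℝ E] [FiniteDimensional ℝ E]
  {M : Type*} [TopologicalSpace M] [ChartedSpace E M] [IsManifold 𝓘(ℝ, E) ∞ M]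

theorem d_conj {k : ℕ} {η : DForm E M k} (hη : η.IsSmooth) (x : M) :
    DForm.d (fun x => conjCLM E k (η x)) x = conjCLM E (k + 1) (η.d x) := by
  have hx := mem_extChartAt_target (I := 𝓘(ℝ, E)) x
  have h : DifferentiableAt ℝ (η.inChart x) (extChartAt 𝓘(ℝ, E) x x) :=
    ((hη x).contDiffAt ((isOpen_target x).mem_nhds hx)).differentiableAt (by simp)
  exact congrArg (fun α : E [⋀^Fin (k + 1)]→L[ℝ] ℂ => α.compContinuousLinearMap (dChart x x))
    (extDeriv_conj h)

/-- Multiplication by the component of degree two of a smooth form. -/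
def wOp (β : smoothForms E M) : Module.End ℂ (smoothForms E M) :=
  fibOp (fun x => wedgeTwo (Module.finBasis ℝ E) (fib β.1 x 2))
    fun _ hη => isSmoothForm_wedgeTwo (Module.finBasis ℝ E) β.2 hη

variable (E M) in
/-- The operators of multiplication by a three-form. -/
def cubicOps : Submodule ℂ (Module.End ℂ (smoothForms E M)) where
  carrier := {A | ∀ x, ∃ X ∈ cubic E, ∀ η, ev x (A η) = X (ev x η)}
  add_mem' {A B} hA hB x := by
    obtain ⟨X, hX, h⟩ := hA x
    obtain ⟨Y, hY, h'⟩ := hB x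
    exact ⟨X + Y, add_mem hX hY, fun η => congrArg₂ (· + ·) (h η) (h' η)⟩
  zero_mem' x := ⟨0, zero_mem _, fun η => map_zero (ev x)⟩
  smul_mem' c A hA x := by
    obtain ⟨X, hX, h⟩ := hA x
    exact ⟨c • X, Submodule.smul_mem _ c hX, fun η => congrArg (c • ·) (h η)⟩

theorem dOp_wOp_mem_cubicOps (β : smoothForms E M) :
    dOp E M * wOp β - wOp β * dOp E M ∈ cubicOps E M := by
  intro x
  obtain ⟨X, hX, h⟩ := exists_cubic_dTot_wedgeTwo (Module.finBasis ℝ E) β.2 x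
  exact ⟨X, hX, fun η => sub_eq_iff_eq_add.2 (h η.1 η.2)⟩

variable (E M) in
/-- The constant function `1` as a smooth form. -/
def oneSmooth : smoothForms E M :=
  ⟨fun k _ => (oneForm : AltForm E) k, isSmoothForm_of_smoothAt fun x k => by
    cases k with
    | zero =>
      exact contDiffAt_const (c := ContinuousAlternatingMap.constOfIsEmpty ℝ E (Fin 0) (1 : ℂ))
    | succ k => exact contDiffAt_const (c := (0 : E [⋀^Fin (k + 1)]→L[ℝ] ℂ))⟩

theorem ev_oneSmooth (x : M) : ev x (oneSmooth E M) = oneForm := rfl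

/-- Multiplication by a three-form is determined by its value on the constant function 1, which
lives in degree three only. -/
theorem eq_zero_of_mem_cubicOps {A : Module.End ℂ (smoothForms E M)} (hA : A ∈ cubicOps E M)
    (h : ∀ x, ev x (A (oneSmooth E M)) 3 = 0) : A = 0 := by
  refine end_ext fun x η => ?_
  obtain ⟨X, hX, hAX⟩ := hA x
  have h₁ : X oneForm = 0 := by
    obtain ⟨hlow, hdeg⟩ := degree_of_mem_cubic hX
    funext k
    match k with
    | 0 => exact (hlow _).1
    | 1 => exact (hlow _).2.1
    | 2 => exact (hlow _).2.2
    | 3 =>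
      rw [← ev_oneSmooth x, ← hAX]
      exact h x
    | k + 4 =>
      have h₂ := hdeg oneForm 0 (k + 1) rfl
      rw [map_zero] at h₂
      exact h₂
  rw [hAX, eq_zero_of_mem_cubic hX h₁]
  exact (map_zero (ev x)).symm

theorem dOp_oneSmooth : dOp E M (oneSmooth E M) = 0 := by
  refine ev_ext fun x => ?_
  rw [map_zero]
  refine (fib_dTot _ x).trans ?_
  have h : ∀ v, pd (loc x (oneSmooth E M).1) (extChartAt 𝓘(ℝ, E) x x) v = 0 := by
    intro v
    funext k
    have h₁ : ∃ c : E [⋀^Fin k]→L[ℝ] ℂ, (fun y => loc x (oneSmooth E M).1 y k) = fun _ => c := by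
      cases k with
      | zero => exact ⟨ContinuousAlternatingMap.constOfIsEmpty ℝ E (Fin 0) (1 : ℂ), rfl⟩
      | succ k => exact ⟨0, rfl⟩
    obtain ⟨c, hc⟩ := h₁
    rw [pd, hc, fderiv_const_apply]
    rfl
  rw [dLoc_eq (Module.finBasis ℝ E)]
  exact Finset.sum_eq_zero fun l _ => by rw [h, map_zero]

namespace HypercomplexHermitian

variable (S : HypercomplexHermitian E M)

theorem iOp_lie_mem_cubicOps (q : ℍ[ℝ]) {A : Module.End ℂ (smoothForms E M)}
    (hA : A ∈ cubicOps E M) : S.iOp q * A - A * S.iOp q ∈ cubicOps E M := by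
  intro x
  obtain ⟨X, hX, h⟩ := hA x
  refine ⟨_, der_mem_cubic hX (S.op q x), fun η => ?_⟩
  have h₁ : ev x ((S.iOp q * A - A * S.iOp q) η) =
    der (S.op q x) (ev x (A η)) - ev x (A (S.iOp q η)) := rfl
  rw [h₁, h, h, S.ev_iOp]
  rfl

theorem iOp_lie_wOp (q : ℍ[ℝ]) (β : smoothForms E M) :
    S.iOp q * wOp β - wOp β * S.iOp q = wOp (S.iOp q β) :=
  end_ext fun x η => sub_eq_iff_eq_add'.2
    (LinearMap.congr_fun (der_wedgeTwo (Module.finBasis ℝ E) (S.op q x) (ev x β 2)) (ev x η))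

/-- By the Jacobi identity the commutator is the bracket of q with [d, β∧] minus the commutator of d
with multiplication by the derived two-form; both are multiplications by three-forms. -/
theorem lie_wOp_mem_cubicOps (q : ℍ[ℝ]) (β : smoothForms E M) :
    (S.iOp q * dOp E M - dOp E M * S.iOp q) * wOp β -
      wOp β * (S.iOp q * dOp E M - dOp E M * S.iOp q) ∈ cubicOps E M := by
  rw [lie_lie_right, S.iOp_lie_wOp]
  exact sub_mem (S.iOp_lie_mem_cubicOps q (dOp_wOp_mem_cubicOps β)) (dOp_wOp_mem_cubicOps _)

/-- The standard form as a smooth form of all degrees. -/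
def OmegaSmooth : smoothForms E M := ⟨ofTwo S.Omega, S.isSmoothForm_Omega⟩

/-- Multiplication by the standard form. -/
def lOp : Module.End ℂ (smoothForms E M) := wOp S.OmegaSmooth

theorem iOp_mul_lOp : S.iOp quatI * S.lOp = S.lOp * S.iOp quatI + (2 * Complex.I) • S.lOp := by
  refine end_ext fun x η => ?_
  have h := LinearMap.congr_fun (der_wedgeTwo (Module.finBasis ℝ E) (S.op quatI x)
    (S.herm x).Om) (ev x η)
  have h₁ : derCLM (S.op quatI x) 2 (S.herm x).Om = (2 * Complex.I) • (S.herm x).Om :=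
    (S.herm x).derCLM_I_Om
  rw [h₁, wedgeTwo_smul] at h
  exact h

theorem degOp_mul_lOp : S.degOp * S.lOp = S.lOp * S.degOp + (2 : ℂ) • S.lOp := by
  refine end_ext fun x η => ?_
  have h := LinearMap.congr_fun (der_wedgeTwo (Module.finBasis ℝ E) (S.op 1 x)
    (S.herm x).Om) (ev x η)
  have h₁ : derCLM (S.op 1 x) 2 (S.herm x).Om = (2 : ℂ) • (S.herm x).Om := by
    have h₂ : S.op 1 x = ContinuousLinearMap.id ℝ E := map_one (S.quat x)
    ext w
    rw [h₂, derCLM_apply, Fin.sum_univ_two]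
    simp [two_mul]
  rw [h₁, wedgeTwo_smul] at h
  exact h

theorem iOp_oneSmooth (q : ℍ[ℝ]) : S.iOp q (oneSmooth E M) = 0 := by
  refine ev_ext fun x => funext fun k => ?_
  cases k with
  | zero => exact S.iOp_apply_zero q x _
  | succ k => exact map_zero (derCLM (S.op q x) (k + 1))

theorem delOp_oneSmooth : S.delOp (oneSmooth E M) = 0 := by
  simp only [delOp, LinearMap.smul_apply, LinearMap.sub_apply, Module.End.mul_apply, dOp_oneSmooth,
    S.iOp_oneSmooth, map_zero, sub_zero, smul_zero]

theorem delJOp_oneSmooth : S.delJOp (oneSmooth E M) = 0 := by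
  simp only [delJOp, LinearMap.smul_apply, LinearMap.sub_apply, LinearMap.add_apply,
    Module.End.mul_apply, dOp_oneSmooth, S.iOp_oneSmooth, map_zero, sub_zero, smul_zero, add_zero]

theorem delOp_lOp_mem_cubicOps : S.delOp * S.lOp - S.lOp * S.delOp ∈ cubicOps E M := by
  have h : S.delOp * S.lOp - S.lOp * S.delOp = _ := lie_smul_sub _ _ _ _ _
  rw [h]
  exact Submodule.smul_mem _ _ (sub_mem (dOp_wOp_mem_cubicOps _)
    (Submodule.smul_mem _ _ (S.lie_wOp_mem_cubicOps _ _)))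

theorem delJOp_lOp_mem_cubicOps : S.delJOp * S.lOp - S.lOp * S.delJOp ∈ cubicOps E M := by
  have h : S.delJOp * S.lOp - S.lOp * S.delJOp = _ := lie_smul_add _ _ _ _ _
  rw [h]
  exact Submodule.smul_mem _ _ (add_mem (S.lie_wOp_mem_cubicOps _ _)
    (Submodule.smul_mem _ _ (S.lie_wOp_mem_cubicOps _ _)))

variable [T2Space M]

theorem lOp_mem_holForms {η : smoothForms E M} (hη : η.1 ∈ S.holForms) :
    (S.lOp η).1 ∈ S.holForms := by
  rw [mem_holForms_iff] at hη ⊢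
  have h₁ := LinearMap.congr_fun S.iOp_mul_lOp η
  have h₂ := LinearMap.congr_fun S.degOp_mul_lOp η
  simp only [Module.End.mul_apply, LinearMap.add_apply, LinearMap.smul_apply] at h₁ h₂
  rw [h₁, h₂, hη, map_smul, smul_add, smul_smul, mul_comm Complex.I]

theorem oneSmooth_mem_holForms : (oneSmooth E M).1 ∈ S.holForms := by
  rw [mem_holForms_iff, degOp, iOp_oneSmooth, iOp_oneSmooth, smul_zero]

theorem lOp_oneSmooth_two : (S.lOp (oneSmooth E M)).1 2 = S.Omega :=
  funext fun x => wedgeTwo_oneForm (Module.finBasis ℝ E) (S.herm x).Om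

/-- On an HKT manifold the multiplication by the standard form commutes with `∂`. -/
theorem delOp_mul_lOp (hS : S.IsHKT) : S.delOp * S.lOp = S.lOp * S.delOp := by
  rw [← sub_eq_zero]
  refine eq_zero_of_mem_cubicOps S.delOp_lOp_mem_cubicOps fun x => ?_
  rw [LinearMap.sub_apply, Module.End.mul_apply, Module.End.mul_apply, delOp_oneSmooth, map_zero,
    sub_zero]
  have h := S.coe_delOp (S.lOp_mem_holForms S.oneSmooth_mem_holForms)
  have h₁ : S.del (S.lOp (oneSmooth E M)).1 3 = 0 := by
    change DForm.del S.I 2 0 ((S.lOp (oneSmooth E M)).1 2) = 0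
    rw [lOp_oneSmooth_two]
    exact hS
  rw [← h] at h₁
  exact congrFun h₁ x

/-- On an HKT manifold the multiplication by the standard form commutes with `∂_J`. -/
theorem delJOp_mul_lOp (hS : S.IsHKT) : S.delJOp * S.lOp = S.lOp * S.delJOp := by
  rw [← sub_eq_zero]
  refine eq_zero_of_mem_cubicOps S.delJOp_lOp_mem_cubicOps fun x => ?_
  rw [LinearMap.sub_apply, Module.End.mul_apply, Module.End.mul_apply, delJOp_oneSmooth, map_zero,
    sub_zero]
  have h := S.coe_delJOp (S.lOp_mem_holForms S.oneSmooth_mem_holForms)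
  have h₁ : S.delJ (S.lOp (oneSmooth E M)).1 3 = 0 := by
    change (DForm.delBar S.I 0 2 (((S.lOp (oneSmooth E M)).1 2).act S.J)).act (fun x => -S.J x) = 0
    rw [lOp_oneSmooth_two]
    -- Since JΩ is the conjugate of Ω and d is real, the (0,3)-component of d(JΩ) is the conjugate
    -- of ∂Ω, which vanishes.
    have hJ : S.Omega.act S.J = fun x => conjCLM E 2 (S.Omega x) := by
      funext x
      refine ContinuousAlternatingMap.ext fun w => ?_
      have h₂ := (S.herm x).pull_J_Om (w 0) (w 1)
      have h₃ : ∀ w : Fin 2 → E, ![w 0, w 1] = w := fun w => by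
        funext i
        fin_cases i <;> rfl
      rw [h₃ w] at h₂
      rw [h₃ (fun i => (S.herm x).J (w i))] at h₂
      exact h₂
    have h₂ : DForm.delBar S.I 0 2 (S.Omega.act S.J) = 0 := by
      funext x
      rw [hJ]
      have h₃ : hodgeComponent (S.op quatI x) 0 3 (DForm.d (fun x => conjCLM E 2 (S.Omega x)) x) =
          conjCLM E 3 (hodgeComponent (S.op quatI x) 3 0 (S.Omega.d x)) :=
        (congrArg (hodgeComponent (S.op quatI x) 0 3) (d_conj (S.isSmoothForm_Omega 2) x)).trans
          (hodgeComponent_conj _ 3 0 _)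
      have h₄ : hodgeComponent (S.op quatI x) 3 0 (S.Omega.d x) = 0 := congrFun hS x
      rw [h₄, map_zero] at h₃
      exact h₃
    rw [h₂]
    rfl
  rw [← h] at h₁
  exact congrFun h₁ x

end HypercomplexHermitian

end Commutation

end HKT
end

noncomputable section

namespace HKT

/-! ## The adjoint of the multiplication by the standard form, and the Laplacian on functions -/

section

variable {E : Type*} [NormedAddCommGroup E] [NormedSpace ℝ E]

theorem contr_contr_extMul_extMul (u v : E) (a b : E →L[ℝ] ℝ) :
    contr u (contr v (extMul a (extMul b oneForm))) =
      ((a v : ℂ) * b u - b v * a u) • oneForm := by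
  have h₁ := LinearMap.congr_fun (contr_extMul v a) (extMul b oneForm)
  simp only [LinearMap.add_apply, Module.End.mul_apply, LinearMap.smul_apply, Module.End.one_apply,
    contr_extMul_oneForm, map_smul] at h₁
  rw [eq_sub_of_add_eq h₁]
  simp only [map_sub, map_smul, contr_extMul_oneForm]
  rw [smul_smul, smul_smul, ← sub_smul]

namespace QuatHermitian

variable {Q : QuatHermitian E} [FiniteDimensional ℝ E] {ι : Type*} [Fintype ι] [DecidableEq ι]
  {e : Module.Basis ι ℝ E}

/-- With a = df this evaluates Λ on ∂_J f ∧ ∂f. Contracting with e_i and Je_i gives products of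
complex conjugate numbers, hence a sum of four squares. -/
theorem IsON.lam_extMul_extMul (he : Q.IsON e) (a : E →L[ℝ] ℝ) :
    Q.lam e ((-2⁻¹ : ℂ) • (extMul (a.comp Q.J) + Complex.I • extMul (a.comp Q.K))
      ((2⁻¹ : ℂ) • (extMul a - Complex.I • extMul (a.comp Q.I)) oneForm)) =
      ((8⁻¹ * ∑ i, (a (e i) ^ 2 + a (Q.I (e i)) ^ 2 + a (Q.J (e i)) ^ 2 + a (Q.K (e i)) ^ 2) : ℝ) :
        ℂ) • oneForm := by
  have h : ∀ i, contr (Q.J (e i)) (contr (e i)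
      ((-2⁻¹ : ℂ) • (extMul (a.comp Q.J) + Complex.I • extMul (a.comp Q.K))
      ((2⁻¹ : ℂ) • (extMul a - Complex.I • extMul (a.comp Q.I)) oneForm))) =
      ((-4⁻¹ * (a (e i) ^ 2 + a (Q.I (e i)) ^ 2 + a (Q.J (e i)) ^ 2 + a (Q.K (e i)) ^ 2) : ℝ) :
        ℂ) • oneForm := by
    intro i
    simp only [LinearMap.add_apply, LinearMap.sub_apply, LinearMap.smul_apply, map_smul, map_add,
      map_sub, contr_contr_extMul_extMul, ContinuousLinearMap.comp_apply, Q.JJ, Q.KJ, Q.IJ, map_neg]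
    simp only [smul_smul, ← add_smul, ← sub_smul]
    congr 1
    push_cast
    linear_combination (4⁻¹ * ((a (Q.K (e i)) : ℂ) ^ 2 + (a (Q.I (e i)) : ℂ) ^ 2)) * Complex.I_sq
  rw [he.lam_eq, LinearMap.neg_apply, LinearMap.smul_apply, LinearMap.sum_apply]
  simp only [Module.End.mul_apply]
  rw [Finset.sum_congr rfl fun i _ => h i, ← Finset.sum_smul, smul_smul, ← neg_smul,
    ← Complex.ofReal_sum, ← Finset.mul_sum]
  congr 1
  push_cast
  ring

end QuatHermitian

end

section Laplacian

set_option linter.unusedSectionVars false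

variable {E : Type*} [NormedAddCommGroup E] [NormedSpace ℝ E] [FiniteDimensional ℝ E]
  {M : Type*} [TopologicalSpace M] [ChartedSpace E M] [IsManifold 𝓘(ℝ, E) ∞ M]

/-- The differential of a function. -/
def dFun (f : M → ℝ) (x : M) : E →L[ℝ] ℝ :=
  fderiv ℝ (fun y => f ((extChartAt 𝓘(ℝ, E) x).symm y)) (extChartAt 𝓘(ℝ, E) x x)

/-- Multiplication by a smooth function. -/
def mulOp (f : M → ℝ) (hf : ContMDiff 𝓘(ℝ, E) 𝓘(ℝ, ℝ) ∞ f) : Module.End ℂ (smoothForms E M) :=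
  fibOp (fun x => (f x : ℂ) • 1) fun _ hη => isSmoothForm_of_smoothAt fun x =>
    ((hη.smoothAt (mem_extChartAt_target x)).smul
      (Complex.ofRealCLM.contDiff.contDiffAt.comp _ (contDiffAt_comp_symm (hf x)))).congr
      (Filter.Eventually.of_forall fun y => map_smul (pull (dSymm x y)) _ _)

variable {f : M → ℝ} (hf : ContMDiff 𝓘(ℝ, E) 𝓘(ℝ, ℝ) ∞ f)

theorem ev_mulOp (x : M) (η : smoothForms E M) : ev x (mulOp f hf η) = (f x : ℂ) • ev x η := rfl

theorem ev_dOp_mulOp (x : M) (η : smoothForms E M) :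
    ev x (dOp E M (mulOp f hf η)) = extMul (dFun f x) (ev x η) + (f x : ℂ) • ev x (dOp E M η) := by
  have h := dLoc_smul (f := fun y => f ((extChartAt 𝓘(ℝ, E) x).symm y))
    ((contDiffAt_comp_symm (hf x)).differentiableAt (by simp))
    (η.2.smoothAt (mem_extChartAt_target x)).diffAt
  have h₁ := dLoc_congr (F := loc x (mulOp f hf η).1) (z := extChartAt 𝓘(ℝ, E) x x)
    (Filter.Eventually.of_forall fun y => map_smul (pull (dSymm x y)) _ _)
  rw [loc_self, extChartAt_to_inv] at h
  refine (fib_dTot _ x).trans (h₁.trans (h.trans ?_))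
  rw [← fib_dTot]
  rfl

namespace HypercomplexHermitian

variable (S : HypercomplexHermitian E M)

theorem ev_lie_mulOp (q : ℍ[ℝ]) (x : M) (η : smoothForms E M) :
    ev x ((S.iOp q * dOp E M - dOp E M * S.iOp q) (mulOp f hf η)) =
      extMul ((dFun f x).comp (S.op q x)) (ev x η) +
        (f x : ℂ) • ev x ((S.iOp q * dOp E M - dOp E M * S.iOp q) η) := by
  have h₁ : S.iOp q (mulOp f hf η) = mulOp f hf (S.iOp q η) :=
    ev_ext fun x => map_smul (der (S.op q x)) _ _
  have h₂ := LinearMap.congr_fun (der_extMul (S.op q x) (dFun f x)) (ev x η)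
  simp only [LinearMap.add_apply, Module.End.mul_apply] at h₂
  simp only [LinearMap.sub_apply, Module.End.mul_apply, map_sub, h₁, ev_dOp_mulOp, ev_iOp, map_add,
    map_smul, h₂, smul_sub]
  abel

theorem ev_delOp_mulOp (x : M) (η : smoothForms E M) :
    ev x (S.delOp (mulOp f hf η)) =
      (2⁻¹ : ℂ) • (extMul (dFun f x) - Complex.I • extMul ((dFun f x).comp (S.op quatI x)) :
        Module.End ℂ (AltForm E)) (ev x η) + (f x : ℂ) • ev x (S.delOp η) := by
  have h : ∀ ζ, ev x (S.delOp ζ) = (2⁻¹ : ℂ) • (ev x (dOp E M ζ) -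
    Complex.I • ev x ((S.iOp quatI * dOp E M - dOp E M * S.iOp quatI) ζ)) := fun ζ => rfl
  rw [h, h, ev_lie_mulOp, ev_dOp_mulOp, LinearMap.sub_apply (extMul _), LinearMap.smul_apply]
  module

theorem ev_delJOp_mulOp (x : M) (η : smoothForms E M) :
    ev x (S.delJOp (mulOp f hf η)) =
      (-2⁻¹ : ℂ) • (extMul ((dFun f x).comp (S.op quatJ x)) +
        Complex.I • extMul ((dFun f x).comp (S.op quatK x)) : Module.End ℂ (AltForm E)) (ev x η) +
          (f x : ℂ) • ev x (S.delJOp η) := by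
  have h : ∀ ζ, ev x (S.delJOp ζ) = (-2⁻¹ : ℂ) •
    (ev x ((S.iOp quatJ * dOp E M - dOp E M * S.iOp quatJ) ζ) +
      Complex.I • ev x ((S.iOp quatK * dOp E M - dOp E M * S.iOp quatK) ζ)) := fun ζ => rfl
  rw [h, h, ev_lie_mulOp, ev_lie_mulOp, LinearMap.add_apply (extMul _), LinearMap.smul_apply]
  module

/-- The adjoint of the multiplication by the standard form. -/
def mOp : Module.End ℂ (smoothForms E M) :=
  fibOp (fun x => (S.herm x).lam (Module.finBasis ℝ E))
    fun _ hη => S.isSmoothForm_lam (Module.finBasis ℝ E) hη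

theorem ev_mOp (x : M) (η : smoothForms E M) :
    ev x (S.mOp η) = (S.herm x).lam (Module.finBasis ℝ E) (ev x η) := rfl

theorem degOp_mul_mOp : S.degOp * S.mOp = S.mOp * S.degOp - (2 : ℂ) • S.mOp := by
  refine end_ext fun x η => ?_
  have h₁ : S.op 1 x = ContinuousLinearMap.id ℝ E := map_one (S.quat x)
  have h : ∀ u v, der (S.op 1 x) (contr u (contr v (ev x η))) =
      contr u (contr v (der (S.op 1 x) (ev x η))) - (2 : ℂ) • contr u (contr v (ev x η)) := by
    intro u v
    have h₂ := LinearMap.congr_fun (contr_der v (S.op 1 x)) (ev x η)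
    have h₃ := LinearMap.congr_fun (contr_der u (S.op 1 x)) (contr v (ev x η))
    simp only [LinearMap.add_apply, Module.End.mul_apply, S.op_one] at h₂ h₃
    rw [h₂, map_add, h₃]
    module
  simp only [Module.End.mul_apply, LinearMap.sub_apply, LinearMap.smul_apply, map_sub, map_smul,
    degOp, ev_iOp, ev_mOp, QuatHermitian.lam, LinearMap.neg_apply, LinearMap.sum_apply, map_neg,
    map_sum, h, Finset.sum_sub_distrib, ← Finset.smul_sum]
  module

theorem lOp_mul_mOp : S.lOp * S.mOp - S.mOp * S.lOp =
    (2⁻¹ : ℂ) • (S.degOp - Complex.I • S.iOp quatI) -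
      ((Module.finrank ℝ E : ℂ) / 4) • 1 := by
  refine end_ext fun x η => ?_
  obtain ⟨e, he⟩ := (S.herm x).exists_isON
  have h := LinearMap.congr_fun he.wedgeTwo_lam (ev x η)
  rw [(S.herm x).lam_eq e (Module.finBasis ℝ E),
    QuatHermitian.wedgeTwo_eq e (Module.finBasis ℝ E), Fintype.card_fin] at h
  have h₁ : S.op 1 x = ContinuousLinearMap.id ℝ E := map_one (S.quat x)
  rw [← h₁] at h
  exact h

/-- Λ lowers the degree by two, and forms of degree above the dimension vanish. -/
theorem isNilpotent_mOp : IsNilpotent S.mOp := by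
  have h : ∀ (j k : ℕ) (x : M) (η : smoothForms E M), Module.finrank ℝ E < k + 2 * j →
      ev x ((S.mOp ^ j) η) k = 0 := by
    intro j
    induction j with
    | zero => exact fun k x η hk => eq_zero_of_finrank_lt (by omega) _
    | succ j ih =>
      intro k x η hk
      rw [pow_succ', Module.End.mul_apply, ev_mOp]
      exact (S.herm x).lam_degree_eq_zero _ (ih (k + 2) x η (by omega))
  refine ⟨Module.finrank ℝ E + 1, end_ext fun x η => funext fun k => ?_⟩
  exact h _ k x η (by omega)

variable [T2Space M]

theorem mOp_mem_holForms {η : smoothForms E M} (hη : η.1 ∈ S.holForms) :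
    (S.mOp η).1 ∈ S.holForms := fun k => ⟨(S.mOp η).2 k, fun x =>
  (S.herm x).isHolomorphicType_lam (Module.finBasis ℝ E) (η := ev x η) (fun k => (hη k).2 x) k⟩

theorem exists_dFun_ne_zero [Nontrivial E] (x : M) :
    ∃ f : M → ℝ, ContMDiff 𝓘(ℝ, E) 𝓘(ℝ, ℝ) ∞ f ∧ f x = 0 ∧ (dFun f x : E →L[ℝ] ℝ) ≠ 0 := by
  obtain ⟨a, ha⟩ : ∃ a : E →L[ℝ] ℝ, a ≠ 0 := by
    obtain ⟨v, hv⟩ := exists_ne (0 : E)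
    obtain ⟨a, -, ha⟩ := exists_dual_vector ℝ v (norm_ne_zero_iff.2 hv)
    refine ⟨a, fun h => hv ?_⟩
    rw [h] at ha
    simpa using ha.symm
  obtain ⟨χ⟩ : Nonempty (SmoothBumpFunction 𝓘(ℝ, E) x) := inferInstance
  have hg : ContMDiffOn 𝓘(ℝ, E) 𝓘(ℝ, ℝ) ∞ (fun x' => a (extChartAt 𝓘(ℝ, E) x x') -
      a (extChartAt 𝓘(ℝ, E) x x)) (chartAt E x).source :=
    (a.contDiff.contMDiff.comp_contMDiffOn contMDiffOn_extChartAt).sub contMDiffOn_const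
  refine ⟨fun x' => χ x' • (a (extChartAt 𝓘(ℝ, E) x x') - a (extChartAt 𝓘(ℝ, E) x x)),
    χ.contMDiff_smul hg, by simp, ?_⟩
  have hcont : Filter.Tendsto (extChartAt 𝓘(ℝ, E) x).symm (nhds (extChartAt 𝓘(ℝ, E) x x))
      (nhds x) := by
    have := (continuousAt_extChartAt_symm (I := 𝓘(ℝ, E)) x).tendsto
    rwa [extChartAt_to_inv] at this
  have h : (fun y => χ ((extChartAt 𝓘(ℝ, E) x).symm y) •
      (a (extChartAt 𝓘(ℝ, E) x ((extChartAt 𝓘(ℝ, E) x).symm y)) - a (extChartAt 𝓘(ℝ, E) x x)))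
      =ᶠ[nhds (extChartAt 𝓘(ℝ, E) x x)] fun y => a y - a (extChartAt 𝓘(ℝ, E) x x) := by
    filter_upwards [hcont.eventually χ.eventuallyEq_one, eventually_target x] with y hy hy'
    rw [hy, (extChartAt 𝓘(ℝ, E) x).right_inv hy', Pi.one_apply, one_smul]
  rw [dFun, h.fderiv_eq, fderiv_sub_const, ContinuousLinearMap.fderiv]
  exact ha

/-- The Laplacian does not vanish on functions. -/
theorem exists_laplacian_ne_zero [Nontrivial E] (x : M) :
    ∃ φ : smoothForms E M, φ.1 ∈ S.holForms ∧
      (S.delOp * (S.mOp * S.delJOp - S.delJOp * S.mOp) +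
        (S.mOp * S.delJOp - S.delJOp * S.mOp) * S.delOp) φ ≠ 0 := by
  obtain ⟨f, hf, hfx, hdf⟩ := exists_dFun_ne_zero (E := E) x
  have hdeg : ∀ (q : ℍ[ℝ]) (ζ : smoothForms E M), S.iOp q (mulOp f hf ζ) = mulOp f hf (S.iOp q ζ) :=
    fun q ζ => ev_ext fun x => map_smul (der (S.op q x)) _ _
  refine ⟨mulOp f hf (mulOp f hf (oneSmooth E M)), ?_, fun h => ?_⟩
  · rw [mem_holForms_iff, degOp, hdeg, hdeg, hdeg, hdeg, S.iOp_oneSmooth, S.iOp_oneSmooth,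
      map_zero, map_zero, smul_zero]
  · have h₀ := congrArg (fun ζ : smoothForms E M => ev x ζ 0) h
    -- The test function is f², with ∂(f²) = 2f ∂f. At the point where f vanishes, applying ∂_J
    -- leaves only 2 ∂_J f ∧ ∂f.
    have h₁ : S.delOp (mulOp f hf (mulOp f hf (oneSmooth E M))) =
        (2 : ℂ) • mulOp f hf (S.delOp (mulOp f hf (oneSmooth E M))) := by
      refine ev_ext fun x' => ?_
      rw [map_smul, ev_mulOp, ev_delOp_mulOp, ev_delOp_mulOp, delOp_oneSmooth, map_zero, smul_zero,
        add_zero, ev_mulOp, map_smul]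
      module
    -- In degree zero every term of the Laplacian beginning with a differential drops out, leaving Λ
    -- ∂_J ∂.
    simp only [LinearMap.add_apply, LinearMap.sub_apply, Module.End.mul_apply, map_add, map_sub,
      AltForm.add_apply, AltForm.sub_apply, delOp_apply_zero, delJOp_apply_zero, map_zero,
      sub_zero, zero_add] at h₀
    obtain ⟨e, he⟩ := (S.herm x).exists_isON
    rw [h₁, map_smul, map_smul, map_smul, ev_mOp, ev_delJOp_mulOp, hfx, Complex.ofReal_zero,
      zero_smul, add_zero, ev_delOp_mulOp, delOp_oneSmooth, map_zero, smul_zero, add_zero,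
      (S.herm x).lam_eq _ e] at h₀
    have h₂ := he.lam_extMul_extMul (dFun f x)
    have h₃ := congrArg (fun ζ : AltForm E => ((2 : ℂ) • ζ) 0 ![]) h₂
    have h₄ : ((2 : ℂ) • (((8⁻¹ * ∑ i, (dFun f x (e i) ^ 2 + dFun f x ((S.herm x).I (e i)) ^ 2 +
        dFun f x ((S.herm x).J (e i)) ^ 2 + dFun f x ((S.herm x).K (e i)) ^ 2) : ℝ) : ℂ) •
          (oneForm : AltForm E))) 0 ![] = 0 :=
      h₃.symm.trans (congrArg (fun α : E [⋀^Fin 0]→L[ℝ] ℂ => α ![]) h₀)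
    have h₅ : (2 : ℂ) * (((8⁻¹ * ∑ i, (dFun f x (e i) ^ 2 + dFun f x ((S.herm x).I (e i)) ^ 2 +
        dFun f x ((S.herm x).J (e i)) ^ 2 + dFun f x ((S.herm x).K (e i)) ^ 2) : ℝ) : ℂ) * 1) = 0 :=
      h₄
    rw [mul_one, mul_eq_zero, Complex.ofReal_eq_zero, mul_eq_zero] at h₅
    have h₆ := (h₅.resolve_left two_ne_zero).resolve_left (by norm_num)
    rw [Finset.sum_eq_zero_iff_of_nonneg fun i _ => by positivity] at h₆
    refine hdf (ContinuousLinearMap.coe_injective (e.ext fun i => ?_))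
    have h₇ := h₆ i (Finset.mem_univ i)
    have h₈ : dFun f x (e i) ^ 2 = 0 := by
      refine le_antisymm ?_ (sq_nonneg _)
      nlinarith [sq_nonneg (dFun f x ((S.herm x).I (e i))),
        sq_nonneg (dFun f x ((S.herm x).J (e i))), sq_nonneg (dFun f x ((S.herm x).K (e i)))]
    simpa using h₈

end HypercomplexHermitian

end Laplacian

end HKT
end

noncomputable section

namespace HKT

/-! ## The Lie superalgebra of an HKT manifold -/

section Algebra

variable {B : Type*} [Ring B] [Algebra ℂ B]

theorem smul_mul_smul_eq_zero {a : B} (h : a * a = 0) (s : ℂ) : (s • a) * (s • a) = 0 := by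
  rw [smul_mul_assoc, mul_smul_comm, h, smul_zero, smul_zero]

theorem smul_anticommute {a b : B} (h : a * b + b * a = 0) (s t : ℂ) :
    (s • a) * (t • b) + (t • b) * (s • a) = 0 := by
  rw [smul_mul_assoc, mul_smul_comm, smul_mul_assoc, mul_smul_comm, smul_comm t s, ← smul_add,
    ← smul_add, h, smul_zero, smul_zero]

/-- Operators `l`, `m` with `[l, m]` equal up to a constant to a degree operator `n`, for which `l`
is of degree `2`, `m` of degree `-2`, and `d`, `c` of degree `1`, generate the Kähler-de Rham
superalgebra. -/
theorem nonempty_iso_kahlerDeRham {l m d c n : B} {t : ℂ} (hH : l * m - m * l = n - t • 1)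
    (nl : n * l = l * n + (2 : ℂ) • l) (nm : n * m = m * n - (2 : ℂ) • m) (nd : n * d = d * n + d)
    (nc : n * c = c * n + c) (dl : d * l = l * d) (cl : c * l = l * c) (hn : IsNilpotent m)
    (dd : d * d = 0) (cc : c * c = 0) (dc : d * c + c * d = 0)
    (hΔ : d * (m * c - c * m) + (m * c - c * m) * d ≠ 0) :
    Nonempty (LieSuperalgebra.Iso (LieSuperalgebra.generated ℂ {l, m, l * m - m * l} {d, c})
      kahlerDeRham) := by
  have h : ∀ x, (l * m - m * l) * x - x * (l * m - m * l) = n * x - x * n := by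
    intro x
    rw [hH, sub_mul, mul_sub, smul_mul_assoc, mul_smul_comm, one_mul, mul_one]
    abel
  have hl : (l * m - m * l) * l - l * (l * m - m * l) = (2 : ℂ) • l := by
    rw [h, nl, add_sub_cancel_left]
  have hm : (l * m - m * l) * m - m * (l * m - m * l) = -((2 : ℂ) • m) := by
    rw [h, nm, sub_sub_cancel_left]
  have hd : (l * m - m * l) * d - d * (l * m - m * l) = d := by
    rw [h, nd, add_sub_cancel_left]
  have hc : (l * m - m * l) * c - c * (l * m - m * l) = c := by
    rw [h, nc, add_sub_cancel_left]
  have ld : l * d - d * l = 0 := by rw [dl, sub_self]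
  have lc : l * c - c * l = 0 := by rw [cl, sub_self]
  exact LieSuperalgebra.nonempty_iso_generated hl hm hd hc ld lc
    (lie_lie_eq_zero_of_isNilpotent hl hm hd ld hn) (lie_lie_eq_zero_of_isNilpotent hl hm hc lc hn)
    dd cc dc hΔ

end Algebra

/-! ### Restriction to forms of type (p, 0) and the final assembly -/

section Main

set_option linter.unusedSectionVars false

variable {E : Type*} [NormedAddCommGroup E] [NormedSpace ℝ E] [FiniteDimensional ℝ E]
  {M : Type*} [TopologicalSpace M] [ChartedSpace E M] [IsManifold 𝓘(ℝ, E) ∞ M]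

namespace HypercomplexHermitian

variable (S : HypercomplexHermitian E M)

/-- The operators on smooth forms that preserve `Λ^{*,0}(M, I)`. -/
def holPreserving : Subalgebra ℂ (Module.End ℂ (smoothForms E M)) where
  carrier := {A | ∀ η : smoothForms E M, η.1 ∈ S.holForms → (A η).1 ∈ S.holForms}
  mul_mem' hA hB η hη := hA _ (hB η hη)
  add_mem' hA hB η hη := add_mem (hA η hη) (hB η hη)
  algebraMap_mem' c _ hη := S.holForms.smul_mem c hη

/-- A form in `Λ^{*,0}(M, I)` as a smooth form. -/
def toSmooth : S.holForms →ₗ[ℂ] smoothForms E M where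
  toFun η := ⟨η.1, fun k => (η.2 k).1⟩
  map_add' _ _ := rfl
  map_smul' _ _ := rfl

/-- Restriction of operators to `Λ^{*,0}(M, I)`. -/
def res : S.holPreserving →ₐ[ℂ] Module.End ℂ S.holForms where
  toFun A :=
    { toFun := fun η => ⟨(A.1 (S.toSmooth η)).1, A.2 _ η.2⟩
      map_add' := fun η ζ => Subtype.ext (congrArg (fun θ : smoothForms E M => θ.1)
        (map_add A.1 (S.toSmooth η) (S.toSmooth ζ)))
      map_smul' := fun c η => Subtype.ext (congrArg (fun θ : smoothForms E M => θ.1)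
        (map_smul A.1 c (S.toSmooth η))) }
  map_one' := rfl
  map_mul' _ _ := rfl
  map_zero' := rfl
  map_add' _ _ := rfl
  commutes' _ := rfl

variable [T2Space M]

theorem mem_holPreserving {A : Module.End ℂ (smoothForms E M)}
    (hdeg : S.degOp * A = A * S.degOp + A)
    (hw : S.iOp quatI * A = A * S.iOp quatI + Complex.I • A) : A ∈ S.holPreserving := by
  intro η hη
  rw [mem_holForms_iff] at hη ⊢
  have h₁ := LinearMap.congr_fun hdeg η
  have h₂ := LinearMap.congr_fun hw η
  simp only [Module.End.mul_apply, LinearMap.add_apply, LinearMap.smul_apply] at h₁ h₂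
  rw [h₂, h₁, hη, map_smul, smul_add]

theorem degOp_mem_holPreserving : S.degOp ∈ S.holPreserving := by
  intro η hη
  rw [mem_holForms_iff] at hη ⊢
  have h := LinearMap.congr_fun (S.degOp_mul_iOp quatI) η
  simp only [Module.End.mul_apply] at h
  rw [← h, hη, map_smul]

theorem delOp_mul_delOp : S.delOp * S.delOp = 0 :=
  smul_mul_smul_eq_zero S.isQuaternionicDifferential.del_mul_del _

theorem delJOp_mul_delJOp : S.delJOp * S.delJOp = 0 :=
  smul_mul_smul_eq_zero S.isQuaternionicDifferential.delJ_mul_delJ _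

theorem delOp_mul_delJOp : S.delOp * S.delJOp + S.delJOp * S.delOp = 0 :=
  smul_anticommute S.isQuaternionicDifferential.del_mul_delJ _ _

theorem coe_lOp (η : smoothForms E M) : (S.lOp η).1 = S.lefschetz η.1 := by
  refine fib_ext fun x => funext fun k => ?_
  match k with
  | 0 => exact wedgeTwo_zero_degree _ _ _
  | 1 => exact wedgeTwo_one_degree _ _ _
  | k + 2 => exact (wedge_eq_wedgeTwo (Module.finBasis ℝ E) (S.herm x).Om (ev x η) k).symm

/-- The operator `L_Ω` on `Λ^{*,0}(M, I)`. -/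
def lHol : S.holPreserving := ⟨S.lOp, fun _ hη => S.lOp_mem_holForms hη⟩

/-- The operator `Λ_Ω` on `Λ^{*,0}(M, I)`. -/
def mHol : S.holPreserving := ⟨S.mOp, fun _ hη => S.mOp_mem_holForms hη⟩

/-- The operator `∂` on `Λ^{*,0}(M, I)`. -/
def delHol : S.holPreserving := ⟨S.delOp, S.mem_holPreserving S.degOp_mul_delOp S.iOp_mul_delOp⟩

/-- The operator `∂_J` on `Λ^{*,0}(M, I)`. -/
def delJHol : S.holPreserving :=
  ⟨S.delJOp, S.mem_holPreserving S.degOp_mul_delJOp S.iOp_mul_delJOp⟩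

/-- The degree operator on `Λ^{*,0}(M, I)`. -/
def degHol : S.holPreserving := ⟨S.degOp, S.degOp_mem_holPreserving⟩

theorem isHermitianAdjoint_res : S.IsHermitianAdjoint (S.res S.lHol) (S.res S.mHol) := by
  intro η ζ x e he
  have he' : (S.herm x).IsON (show Module.Basis (Fin (Module.finrank ℝ E)) ℝ E from e) := he
  have h := he'.sum_formInner_wedgeTwo (ev x (S.toSmooth η)) (ζ := ev x (S.toSmooth ζ))
    (fun k => (ζ.2 k).2 x)
  rw [(S.herm x).lam_eq _ (Module.finBasis ℝ E),
    QuatHermitian.wedgeTwo_eq _ (Module.finBasis ℝ E)] at h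
  exact h

/-- On forms of type (p, 0) the derivation by I is √-1 times the degree, so ½(deg - √-1 I) becomes
the degree. -/
theorem lie_res : S.res S.lHol * S.res S.mHol - S.res S.mHol * S.res S.lHol =
    S.res S.degHol - ((Module.finrank ℝ E : ℂ) / 4) • 1 := by
  refine LinearMap.ext fun η => Subtype.ext ?_
  have hη := (S.mem_holForms_iff (S.toSmooth η)).1 η.2
  have h := LinearMap.congr_fun S.lOp_mul_mOp (S.toSmooth η)
  simp only [LinearMap.sub_apply, LinearMap.smul_apply, Module.End.one_apply] at h
  rw [hη, smul_smul, Complex.I_mul_I, neg_one_smul, sub_neg_eq_add, ← two_smul ℂ (S.degOp _),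
    smul_smul, inv_mul_cancel₀ two_ne_zero, one_smul] at h
  exact congrArg (fun θ : smoothForms E M => θ.1) h

/-- The relations are inherited from operators on all smooth forms and transported by the algebra
homomorphism `res`; only `lie_res` is specific to type (p, 0). -/
theorem nonempty_iso_generated_res [Nontrivial E] [Nonempty M] (hS : S.IsHKT) :
    Nonempty (LieSuperalgebra.Iso (LieSuperalgebra.generated ℂ {S.res S.lHol, S.res S.mHol,
      S.res S.lHol * S.res S.mHol - S.res S.mHol * S.res S.lHol}
      {S.res S.delHol, S.res S.delJHol}) kahlerDeRham) := by
  have nl : S.degHol * S.lHol = S.lHol * S.degHol + (2 : ℂ) • S.lHol := Subtype.ext S.degOp_mul_lOp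
  have nm : S.degHol * S.mHol + (2 : ℂ) • S.mHol = S.mHol * S.degHol :=
    Subtype.ext (eq_sub_iff_add_eq.1 S.degOp_mul_mOp)
  have nd : S.degHol * S.delHol = S.delHol * S.degHol + S.delHol := Subtype.ext S.degOp_mul_delOp
  have nc : S.degHol * S.delJHol = S.delJHol * S.degHol + S.delJHol :=
    Subtype.ext S.degOp_mul_delJOp
  have dl : S.delHol * S.lHol = S.lHol * S.delHol := Subtype.ext (S.delOp_mul_lOp hS)
  have cl : S.delJHol * S.lHol = S.lHol * S.delJHol := Subtype.ext (S.delJOp_mul_lOp hS)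
  have dd : S.delHol * S.delHol = 0 := Subtype.ext S.delOp_mul_delOp
  have cc : S.delJHol * S.delJHol = 0 := Subtype.ext S.delJOp_mul_delJOp
  have dc : S.delHol * S.delJHol + S.delJHol * S.delHol = 0 := Subtype.ext S.delOp_mul_delJOp
  have hn : IsNilpotent S.mHol := by
    obtain ⟨k, hk⟩ := S.isNilpotent_mOp
    exact ⟨k, Subtype.ext hk⟩
  refine nonempty_iso_kahlerDeRham (n := S.res S.degHol) S.lie_res ?_ ?_ ?_ ?_ ?_ ?_
    (hn.map S.res) ?_ ?_ ?_ ?_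
  · simpa only [map_mul, map_add, map_smul] using congrArg S.res nl
  · refine eq_sub_iff_add_eq.2 ?_
    simpa only [map_mul, map_add, map_smul] using congrArg S.res nm
  · simpa only [map_mul, map_add] using congrArg S.res nd
  · simpa only [map_mul, map_add] using congrArg S.res nc
  · simpa only [map_mul] using congrArg S.res dl
  · simpa only [map_mul] using congrArg S.res cl
  · simpa only [map_mul, map_zero] using congrArg S.res dd
  · simpa only [map_mul, map_zero] using congrArg S.res cc
  · simpa only [map_mul, map_add, map_zero] using congrArg S.res dc
  -- The form on which the Laplacian does not vanish is a function, so it lies in the restricted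
  -- space.
  · intro h
    obtain ⟨x⟩ := ‹Nonempty M›
    obtain ⟨φ, hφ, hne⟩ := S.exists_laplacian_ne_zero x
    have h₁ := congrArg Subtype.val (LinearMap.congr_fun h ⟨φ.1, hφ⟩)
    exact hne (Subtype.ext h₁)

end HypercomplexHermitian

end Main

end HKT
end

theorem mainTheorem3
    {E : Type*} [NormedAddCommGroup E] [NormedSpace ℝ E] [FiniteDimensional ℝ E] [Nontrivial E]
    {M : Type*} [TopologicalSpace M] [T2Space M] [SigmaCompactSpace M] [Nonempty M]
    [ChartedSpace E M] [IsManifold 𝓘(ℝ, E) ∞ M]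
    (S : HKT.HypercomplexHermitian E M) (hS : S.IsHKT) :
    ∃ L Λ D DJ : Module.End ℂ S.holForms,
      (∀ η : S.holForms, (L η : HKT.TotalForm E M) = S.lefschetz η) ∧
      S.IsHermitianAdjoint L Λ ∧
      (∀ η : S.holForms, (D η : HKT.TotalForm E M) = S.del η) ∧
      (∀ η : S.holForms, (DJ η : HKT.TotalForm E M) = S.delJ η) ∧
      Nonempty (HKT.LieSuperalgebra.Iso
        (HKT.LieSuperalgebra.generated ℂ {L, Λ, L * Λ - Λ * L} {D, DJ}) HKT.kahlerDeRham) := by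
  exact ⟨S.res S.lHol, S.res S.mHol, S.res S.delHol, S.res S.delJHol,
    fun η => S.coe_lOp (S.toSmooth η), S.isHermitianAdjoint_res,
    fun η => S.coe_delOp (η := S.toSmooth η) η.2, fun η => S.coe_delJOp (η := S.toSmooth η) η.2,
    S.nonempty_iso_generated_res hS⟩
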